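/- Let $(M,d)$ be a compact metric space with a finite Borel measure $\mu$, let $\mathbb S^1=\mathbb R/2\pi\mathbb Z$ carry Lebesgue measure, and let $H:=L^2(M\times\mathbb S^1)$ be the real $L^2$-space of the product measure $d(x,t)$. Let $\mathcal A:D(\mathcal A)\subset L^2(M)\to L^2(M)$ be a self-adjoint operator with compact resolvent such that (A1) $\inf\{\langle\mathcal A\phi,\phi\rangle/\langle\phi,\phi\rangle:\phi\in D(\mathcal A)\setminus\{0\}\}>-\infty$; (A2) $\sup\{\langle\mathcal A\phi,\phi\rangle/\langle\phi,\phi\rangle:\phi\in D(\mathcal A)\setminus\{0\},\ \phi\equiv0\text{ in }M\setminus U\}=\infty$ for every nonempty open $U\subset M$; (A3) for every nonempty open $U\subset M$ and $\phi\in D(\mathcal A)$, $\phi\equiv0$ in $U$ implies $\mathcal A\phi\equiv0$ in $U$. Let $(\zeta_k)_{k\in\mathbb N_0}$ be an orthonormal basis of $L^2(M)$ of eigenfunctions of $\mathcal A$ with eigenvalues $\nu_k$, and let $e_l(t)=\cos(lt)$ for $l\ge0$ and $e_l(t)=\sin(|l|t)$ for $l<0$. Let $L_{\mathcal A}=\mathcal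 A+\partial_{tt}$ be the self-adjoint operator in $H$ given by $$L_{\mathcal A}\sum_{k,l}a_{kl}\,\zeta_k\otimes e_l=\sum_{k,l}(\nu_k-l^2)a_{kl}\,\zeta_k\otimes e_l$$ on the domain of all $\sum a_{kl}\,\zeta_k\otimes e_l\in H$ for which the right-hand side lies in $H$. Let $E(\cdot)$ be its spectral resolution, let $P^+,P^-$ be its spectral projections for $(0,\infty)$ and $(-\infty,0)$, let $P^0$ be the orthogonal projection on $\ker L_{\mathcal A}$, and write $u^\pm=P^\pm u$, $u^0=P^0u$. Put $$\langle u,v\rangle_+=\int_{(0,\infty)}\lambda\,d\langle E(\lambda)u,v\rangle_H,\quad \langle u,v\rangle_-=\int_{(-\infty,0)}|\lambda|\,d\langle E(\lambda)u,v\rangle_H,\quad \|u\|_\pm^2=\langle u,u\rangle_\pm,$$ and $E^\pm=\{u\in P^\pm H:\|u\|_\pm<\infty\}$. Let $p>2$, let $f\in C(\mathbb R)$, and let $q\in L^\infty(M\times\mathbb S^1)$ satisfy $q\ge0$ a.e. and $q>0$ a.e. on some nonempty open subset of $M\times\mathbb S^1$. Assume: $(CE)_p$ the spaces $(E^\pm,\|\cdot\|_\pm)$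 are compactly embedded into $L^p(M\times\mathbb S^1)$; $(CC)_q$ there is $C>0$ with $\int|u|^2\,d(x,t)\le C\int q|u|^2\,d(x,t)$ for all $u\in\ker L_{\mathcal A}$; $(MC)_p$ the function $r\mapsto f(r)/|r|$ is strictly increasing on $\mathbb R\setminus\{0\}$ with $\lim_{r\to0}f(r)/|r|=0$, and there are $c,C>0$ with $F(s):=\int_0^sf(\tau)\,d\tau\ge c|s|^p$ and $|f(s)|\le C(1+|s|^{p-1})$ for all $s\in\mathbb R$. Put $E^0=\{u\in\ker L_{\mathcal A}:\int q|u|^p\,d(x,t)<\infty\}$ and $E=E^-\oplus E^0\oplus E^+\subset H$. A function $u\in E$ is called a weak solution of $$\mathcal A u+u_{tt}=q(x,t)f(u)\qquad\text{on }M\times\mathbb S^1$$ if $\langle u^+,v^+\rangle_+-\langle u^-,v^-\rangle_-=\int q\,f(u)\,v\,d(x,t)$ for all $v\in E$, and a ground state solution if it is a nonzero weak solution that minimizes $$\Phi(u)=\tfrac12\|u^+\|_+^2-\tfrac12\|u^-\|_-^2-\int qF(u)\,d(x,t)$$ among all nonzero weak solutions. Then this equation has a ground state solution. -/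

import Mathlib

open MeasureTheory Filter Topology
open scoped ENNReal

noncomputable section

namespace NonlinearWave

/-! ### Spectral calculus of operators with an orthonormal basis of eigenvectors -/

section Spectral

variable {H : Type*} [NormedAddCommGroup H] [InnerProductSpace ℝ H]

/-- The eigenspace `ker (T - lam)` of an unbounded operator `T`: all `v ∈ D(T)` with
`T v = lam v` (the zero vector included). -/
def eigenspace (T : H →ₗ.[ℝ] H) (lam : ℝ) : Submodule ℝ H :=
  T.graph.comap (LinearMap.prod LinearMap.id (lam • LinearMap.id))

theorem mem_eigenspace_iff (T : H →ₗ.[ℝ] H) (lam : ℝ) (v : H) :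
    v ∈ eigenspace T lam ↔ ∃ hv : v ∈ T.domain, T ⟨v, hv⟩ = lam • v := by
  simp [eigenspace, LinearPMap.mem_graph_iff]

/-- `T` has compact resolvent: for some real `z` the inverse `(T - z)⁻¹` exists as a bounded
operator on `H` and is compact. -/
def HasCompactResolvent (T : H →ₗ.[ℝ] H) : Prop :=
  ∃ (z : ℝ) (R : H →L[ℝ] H), IsCompactOperator R ∧
    (∀ g : H, ∃ hg : R g ∈ T.domain, T ⟨R g, hg⟩ - z • R g = g) ∧
    (∀ u : T.domain, R (T u - z • (u : H)) = u)

/-- The spectral subspace `E(B) H` of a set `B ⊆ ℝ`, for a self-adjoint operator `T` whose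
eigenvectors span a dense subspace (so that the spectral resolution is pure point): the closed
span of all eigenvectors with eigenvalue in `B`. -/
def spectralSubspace (T : H →ₗ.[ℝ] H) (B : Set ℝ) : Submodule ℝ H :=
  (⨆ lam ∈ B, eigenspace T lam).topologicalClosure

variable [CompleteSpace H]

/-- The spectral projection `E(B)`, the orthogonal projection onto `E(B) H`. -/
def spectralProj (T : H →ₗ.[ℝ] H) (B : Set ℝ) : H →L[ℝ] H :=
  haveI : CompleteSpace (spectralSubspace T B) :=
    Submodule.topologicalClosure.completeSpace _
  (spectralSubspace T B).starProjection

/-- `∫_B |lam| d⟨E(lam)u, u⟩ = ∑_{lam ∈ B} |lam| ‖E({lam})u‖²`, with values in `[0, ∞]`. -/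
def formNormSq (T : H →ₗ.[ℝ] H) (B : Set ℝ) (u : H) : ℝ≥0∞ :=
  ∑' lam : B, ENNReal.ofReal (|(lam : ℝ)| * ‖spectralProj T {(lam : ℝ)} u‖ ^ 2)

/-- `∫_B |lam| d⟨E(lam)u, v⟩ = ∑_{lam ∈ B} |lam| ⟨E({lam})u, v⟩`; the sum converges absolutely
whenever `formNormSq T B u` and `formNormSq T B v` are finite. -/
def formInner (T : H →ₗ.[ℝ] H) (B : Set ℝ) (u v : H) : ℝ :=
  ∑' lam : B, |(lam : ℝ)| * inner ℝ (spectralProj T {(lam : ℝ)} u) v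

/-- The form space `{u ∈ E(B) H : ∫_B |lam| d⟨E(lam)u, u⟩ < ∞}`. -/
def formSpace (T : H →ₗ.[ℝ] H) (B : Set ℝ) : Set H :=
  {u | u ∈ spectralSubspace T B ∧ formNormSq T B u < ∞}

end Spectral

/-! ### The circle of length `2π` and the generalized wave operator -/

instance factTwoPiPos : Fact (0 < 2 * Real.pi) := ⟨Real.two_pi_pos⟩

/-- The unit circle: functions on it are the `2π`-periodic functions on `ℝ`. It carries the
one-dimensional Lebesgue measure `volume`, of total mass `2π`. -/
abbrev TimeCircle : Type := AddCircle (2 * Real.pi)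

/-- The functions `e_l` on the circle: `cos (l t)` for `l ≥ 0` and `sin (|l| t)` for `l < 0`. -/
def circleMode (l : ℤ) : C(TimeCircle, ℝ) :=
  if 0 ≤ l then ⟨fun t => (fourier l t).re, by fun_prop⟩
  else ⟨fun t => (fourier (-l) t).im, by fun_prop⟩

theorem fourier_coe_eq (l : ℤ) (t : ℝ) :
    fourier l (t : TimeCircle) = Complex.exp ((l * t : ℝ) * Complex.I) := by
  rw [fourier_coe_apply]
  congr 1
  have : (Real.pi : ℂ) ≠ 0 := by exact_mod_cast Real.pi_ne_zero
  push_cast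
  field_simp

theorem circleMode_of_nonneg {l : ℤ} (hl : 0 ≤ l) (t : ℝ) :
    circleMode l (t : TimeCircle) = Real.cos (l * t) := by
  rw [circleMode, if_pos hl, ContinuousMap.coe_mk, fourier_coe_eq, Complex.exp_ofReal_mul_I_re]

theorem circleMode_of_neg {l : ℤ} (hl : l < 0) (t : ℝ) :
    circleMode l (t : TimeCircle) = Real.sin (-l * t) := by
  rw [circleMode, if_neg (not_le.mpr hl), ContinuousMap.coe_mk, fourier_coe_eq,
    Complex.exp_ofReal_mul_I_im]
  push_cast
  rfl

section Wave

variable {M : Type*} [MetricSpace M] [MeasurableSpace M] [BorelSpace M]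

/-- The product of `μ` with the Lebesgue measure on the circle. -/
abbrev prodMeasure (μ : Measure M) : Measure (M × TimeCircle) := μ.prod volume

/-- The real Hilbert space `L²(M)`. -/
abbrev L2M (μ : Measure M) : Type _ := Lp ℝ 2 μ

/-- The real Hilbert space `H = L²(M × S¹)`. -/
abbrev L2MS (μ : Measure M) : Type _ := Lp ℝ 2 (prodMeasure μ)

theorem memLp_tensor (μ : Measure M) [IsFiniteMeasure μ] (φ : L2M μ) (e : C(TimeCircle, ℝ)) :
    MemLp (fun z : M × TimeCircle => φ z.1 * e z.2) 2 (prodMeasure μ) := by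
  obtain ⟨C, hC⟩ := (isCompact_range e.continuous).isBounded.exists_norm_le
  have h1 : MemLp (fun z : M × TimeCircle => φ z.1) 2 (prodMeasure μ) :=
    (Lp.memLp φ).comp_fst _
  refine h1.of_le_mul (c := C) ?_ (Eventually.of_forall fun z => ?_)
  · exact h1.1.mul (e.continuous.comp continuous_snd).aestronglyMeasurable
  · rw [norm_mul, mul_comm]
    exact mul_le_mul_of_nonneg_right (hC _ ⟨_, rfl⟩) (norm_nonneg _)

/-- The function `(φ ⊗ e)(x,t) = φ(x) e(t)` as an element of `L²(M × S¹)`. -/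
def tensor (μ : Measure M) [IsFiniteMeasure μ] (φ : L2M μ) (e : C(TimeCircle, ℝ)) : L2MS μ :=
  (memLp_tensor μ φ e).toLp _

/-- The graph of `L_A`: the pairs `(v, w)` such that, for every eigenfunction `ζ` of `A`
(with eigenvalue `ν`) and all `l ∈ ℤ`, the coefficient of `w` with respect to `ζ ⊗ e_l` is
`ν - l²` times the one of `v`. -/
def waveGraph (μ : Measure M) [IsFiniteMeasure μ] (A : L2M μ →ₗ.[ℝ] L2M μ) :
    Submodule ℝ (L2MS μ × L2MS μ) where
  carrier := {p | ∀ (ν : ℝ) (ζ : L2M μ), ζ ∈ eigenspace A ν → ∀ l : ℤ,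
    inner ℝ (tensor μ ζ (circleMode l)) p.2
      = (ν - (l : ℝ) ^ 2) * inner ℝ (tensor μ ζ (circleMode l)) p.1}
  add_mem' := by
    intro p p' hp hp' ν ζ hζ l
    simp only [Prod.fst_add, Prod.snd_add, inner_add_right, hp ν ζ hζ l, hp' ν ζ hζ l]
    ring
  zero_mem' := by
    intro ν ζ _ l
    simp
  smul_mem' := by
    intro c p hp ν ζ hζ l
    simp only [Prod.smul_fst, Prod.smul_snd, real_inner_smul_right, hp ν ζ hζ l]
    ring

/-- The generalized wave operator `L_A = A + ∂_tt` in `L²(M × S¹)`, defined through the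
eigenfunction expansion: `L_A (∑ a_{kl} ζ_k ⊗ e_l) = ∑ (ν_k - l²) a_{kl} ζ_k ⊗ e_l`, on the
domain of all `∑ a_{kl} ζ_k ⊗ e_l ∈ L²(M × S¹)` for which the right-hand side is in
`L²(M × S¹)`. -/
def waveOperator (μ : Measure M) [IsFiniteMeasure μ] (A : L2M μ →ₗ.[ℝ] L2M μ) :
    L2MS μ →ₗ.[ℝ] L2MS μ :=
  (waveGraph μ A).toLinearPMap

/-! ### The assumptions -/

/-- Assumption (A) on the operator `A` in `L²(M)`. -/
structure AssumptionA (μ : Measure M) (A : L2M μ →ₗ.[ℝ] L2M μ) : Prop where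
  selfAdjoint : IsSelfAdjoint A
  compactResolvent : HasCompactResolvent A
  /-- (A1) The quotients `⟨Aφ,φ⟩ / ⟨φ,φ⟩` are bounded below. -/
  boundedBelow : BddBelow {r : ℝ | ∃ φ : A.domain, φ ≠ 0 ∧
    r = inner ℝ (A φ) (φ : L2M μ) / inner ℝ (φ : L2M μ) (φ : L2M μ)}
  /-- (A2) The quotients are not bounded above on the functions that vanish off `U`. -/
  unboundedAbove : ∀ U : Set M, IsOpen U → U.Nonempty →
    ¬ BddAbove {r : ℝ | ∃ φ : A.domain, φ ≠ 0 ∧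
      (∀ᵐ x ∂(μ.restrict Uᶜ), (φ : L2M μ) x = 0) ∧
      r = inner ℝ (A φ) (φ : L2M μ) / inner ℝ (φ : L2M μ) (φ : L2M μ)}
  /-- (A3) `A` is local. -/
  isLocal : ∀ U : Set M, IsOpen U → U.Nonempty → ∀ φ : A.domain,
    (∀ᵐ x ∂(μ.restrict U), (φ : L2M μ) x = 0) → ∀ᵐ x ∂(μ.restrict U), (A φ) x = 0

/-- The `p`-monotonicity condition on the nonlinearity `f`. -/
structure MonotonicityCondition (p : ℝ) (f : ℝ → ℝ) : Prop where
  strictMono : StrictMonoOn (fun r => f r / |r|) {0}ᶜ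
  tendsto_zero : Tendsto (fun r => f r / |r|) (𝓝[≠] 0) (𝓝 0)
  lower : ∃ c > 0, ∀ s : ℝ, c * |s| ^ p ≤ ∫ τ in (0 : ℝ)..s, f τ
  upper : ∃ C > 0, ∀ s : ℝ, |f s| ≤ C * (1 + |s| ^ (p - 1))

/-- `{u ∈ S}` with the norm whose square is `N` embeds compactly into `L^p`: every element of `S`
lies in `L^p`, and every `N`-bounded sequence in `S` has a subsequence that converges in `L^p`. -/
def EmbedsCompactly (μ : Measure M) (p : ℝ) (S : Set (L2MS μ)) (N : L2MS μ → ℝ≥0∞) : Prop :=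
  (∀ u ∈ S, MemLp u (ENNReal.ofReal p) (prodMeasure μ)) ∧
  ∀ (u : ℕ → L2MS μ) (C : ℝ), (∀ n, u n ∈ S ∧ N (u n) ≤ ENNReal.ofReal C) →
    ∃ (g : M × TimeCircle → ℝ) (σ : ℕ → ℕ), MemLp g (ENNReal.ofReal p) (prodMeasure μ) ∧
      StrictMono σ ∧
      Tendsto (fun n => eLpNorm (fun z => u (σ n) z - g z) (ENNReal.ofReal p) (prodMeasure μ))
        atTop (𝓝 0)

variable (μ : Measure M) [IsFiniteMeasure μ] (A : L2M μ →ₗ.[ℝ] L2M μ)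

/-- The orthogonal projection `P⁺` onto the positive spectral subspace of `L_A`. -/
def Ppos : L2MS μ →L[ℝ] L2MS μ := spectralProj (waveOperator μ A) (Set.Ioi 0)

/-- The orthogonal projection `P⁻` onto the negative spectral subspace of `L_A`. -/
def Pneg : L2MS μ →L[ℝ] L2MS μ := spectralProj (waveOperator μ A) (Set.Iio 0)

/-- The orthogonal projection `P⁰` onto the kernel of `L_A`. -/
def Pzero : L2MS μ →L[ℝ] L2MS μ := spectralProj (waveOperator μ A) {0}

/-- `‖u‖₊²`. -/
def normSqPos (u : L2MS μ) : ℝ≥0∞ := formNormSq (waveOperator μ A) (Set.Ioi 0) u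

/-- `‖u‖₋²`. -/
def normSqNeg (u : L2MS μ) : ℝ≥0∞ := formNormSq (waveOperator μ A) (Set.Iio 0) u

/-- `⟨u, v⟩₊`. -/
def innerPos (u v : L2MS μ) : ℝ := formInner (waveOperator μ A) (Set.Ioi 0) u v

/-- `⟨u, v⟩₋`. -/
def innerNeg (u v : L2MS μ) : ℝ := formInner (waveOperator μ A) (Set.Iio 0) u v

/-- The space `E⁺`. -/
def Epos : Set (L2MS μ) := formSpace (waveOperator μ A) (Set.Ioi 0)

/-- The space `E⁻`. -/
def Eneg : Set (L2MS μ) := formSpace (waveOperator μ A) (Set.Iio 0)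

/-- The compact embedding condition: `E⁺` and `E⁻` embed compactly into `L^p(M × S¹)`. -/
def CompactEmbedding (p : ℝ) : Prop :=
  EmbedsCompactly μ p (Epos μ A) (normSqPos μ A) ∧
  EmbedsCompactly μ p (Eneg μ A) (normSqNeg μ A)

/-- The `q`-control condition: `∫ |u|² ≤ C ∫ q |u|²` for all `u ∈ ker L_A`. -/
def ControlCondition (q : M × TimeCircle → ℝ) : Prop :=
  ∃ C > 0, ∀ u ∈ eigenspace (waveOperator μ A) 0,
    ∫ z, |u z| ^ 2 ∂(prodMeasure μ) ≤ C * ∫ z, q z * |u z| ^ 2 ∂(prodMeasure μ)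

/-- The space `E⁰ = {u ∈ ker L_A : ∫ q |u|^p < ∞}`. Under the `q`-control condition it is
complete for the norm `‖u‖₀ = (∫ q |u|^p)^{1/p}`. -/
def Ezero (p : ℝ) (q : M × TimeCircle → ℝ) : Set (L2MS μ) :=
  {u | u ∈ eigenspace (waveOperator μ A) 0 ∧
    ∫⁻ z, ENNReal.ofReal (q z * |u z| ^ p) ∂(prodMeasure μ) < ∞}

/-- The space `E = E⁻ ⊕ E⁰ ⊕ E⁺` inside `L²(M × S¹)`. -/
def E (p : ℝ) (q : M × TimeCircle → ℝ) : Set (L2MS μ) :=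
  {u | Ppos μ A u ∈ Epos μ A ∧ Pneg μ A u ∈ Eneg μ A ∧ Pzero μ A u ∈ Ezero μ A p q}

/-- `u ∈ E` is a weak solution of `A u + u_tt = q f(u)`:
`⟨u⁺,v⁺⟩₊ - ⟨u⁻,v⁻⟩₋ = ∫ q f(u) v` for all `v ∈ E`. -/
def IsWeakSolution (p : ℝ) (q : M × TimeCircle → ℝ) (f : ℝ → ℝ) (u : L2MS μ) : Prop :=
  u ∈ E μ A p q ∧ ∀ v ∈ E μ A p q,
    Integrable (fun z => q z * f (u z) * v z) (prodMeasure μ) ∧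
    innerPos μ A (Ppos μ A u) (Ppos μ A v) - innerNeg μ A (Pneg μ A u) (Pneg μ A v)
      = ∫ z, q z * f (u z) * v z ∂(prodMeasure μ)

/-- The energy `Φ(u) = ½‖u⁺‖₊² - ½‖u⁻‖₋² - ∫ q F(u)` with `F(r) = ∫₀^r f`. -/
def energy (q : M × TimeCircle → ℝ) (f : ℝ → ℝ) (u : L2MS μ) : ℝ :=
  (normSqPos μ A (Ppos μ A u)).toReal / 2 - (normSqNeg μ A (Pneg μ A u)).toReal / 2
    - ∫ z, q z * (∫ τ in (0 : ℝ)..(u z), f τ) ∂(prodMeasure μ)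

/-- A ground state solution: a nonzero weak solution that minimizes the energy among all nonzero
weak solutions. -/
def IsGroundState (p : ℝ) (q : M × TimeCircle → ℝ) (f : ℝ → ℝ) (u : L2MS μ) : Prop :=
  IsWeakSolution μ A p q f u ∧ u ≠ 0 ∧
    ∀ v, IsWeakSolution μ A p q f v → v ≠ 0 → energy μ A q f u ≤ energy μ A q f v

end Wave

end NonlinearWave

end

open MeasureTheory Filter Topology
open scoped ENNReal

noncomputable section

set_option linter.unusedSectionVars false

/-! Let ν be the measure q d(x,t) and L the wave operator. Then Φ(u) = ½‖u⁺‖₊² − C(u), where C(u) =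
½‖u⁻‖₋² + ∫F(u) dν (`cost`) is convex. Convexity of C does most of the work: neither weak topologies
nor differentiability of a reduced functional are used.

Reduction to E⁺. Over a fixed positive part w, the sublevel sets of C are convex, closed and bounded
in L², so C attains its minimum k(w) (`minCost`, `exists_minimizer`), and k is convex. Thus ψ(w) =
½‖w‖₊² − k(w) is the maximum of Φ on the fibre over w, and `rayMax` at w is the supremum of Φ (cut
off below at 0) on the half space spanned by w and the nonpositive part.

A finite level. If ψ(nw) ≥ 0 for all n ≥ 1, superquadratic growth of F produces z with z⁺ = w, ‖z⁻‖₋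
≤ ‖w‖₊ and z = 0 ν-a.e. (`exists_null_of_psi_nonneg`). Conditions (A2) and (A3) give u in D(L) with
⟨u, Lu⟩ > 0 such that Lu lives on an open set where q > 0. For w = u⁺ such a z would satisfy 0 = ⟨z,
Lu⟩ = ‖u⁺‖₊² − ⟨z⁻, u⁻⟩₋, and Cauchy–Schwarz gives ‖u⁺‖₊ ≤ ‖u⁻‖₋, a contradiction
(`exists_direction`).

Minimax. A normalized minimizing sequence for `rayMax` has a subsequence converging in L^p; k is
upper semicontinuous for this convergence and a loss of form norm only lowers the level, so the
infimum is attained (`exists_minimax`). Take the maximum of ψ on the optimal ray and the minimizer u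
of C over it. Minimality in the fibre gives the equation for nonpositive test functions, maximality
on the ray gives it for u itself, and for φ in E⁺ a convexity argument in the plane of u⁺ and φ
gives it (`slope_le_of_minimax`, `critical_pos`).

Least energy. Monotonicity of f(r)/|r| yields F(y) ≥ F(u) + f(u)(τy − ½(1+τ²)u) for τ ≥ 0, strictly
if y ≠ u (`primitive_gt`). Hence every weak solution v maximizes Φ on its half space
(`phi_le_of_critical`), and v⁺ ≠ 0 if v ≠ 0, so Φ(v) is at least the minimax level, which is Φ(u).
-/

namespace NonlinearWave

/-! ### Pointwise properties of the nonlinearity -/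

/-- The primitive `F(s) = ∫₀ˢ f`. -/
def primitive (f : ℝ → ℝ) (s : ℝ) : ℝ := ∫ τ in (0 : ℝ)..s, f τ

theorem primitive_zero (f : ℝ → ℝ) : primitive f 0 = 0 := by simp [primitive]

theorem hasDerivAt_primitive {f : ℝ → ℝ} (hf : Continuous f) (s : ℝ) :
    HasDerivAt (primitive f) (f s) s :=
  intervalIntegral.integral_hasDerivAt_right (hf.intervalIntegrable _ _)
    hf.stronglyMeasurable.stronglyMeasurableAtFilter hf.continuousAt

theorem continuous_primitive {f : ℝ → ℝ} (hf : Continuous f) : Continuous (primitive f) :=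
  continuous_iff_continuousAt.2 fun s => (hasDerivAt_primitive hf s).continuousAt

theorem primitive_reflect (f : ℝ → ℝ) (s : ℝ) :
    primitive (fun r => -f (-r)) s = primitive f (-s) := by
  simp only [primitive, intervalIntegral.integral_neg]
  rw [intervalIntegral.integral_comp_neg (fun r => f r), intervalIntegral.integral_symm]
  simp

namespace MonotonicityCondition

variable {p : ℝ} {f : ℝ → ℝ}

/-- The reflection r ↦ −f(−r) exchanges the half lines, so statements for negative arguments follow
from those for positive ones. -/
theorem reflect (h : MonotonicityCondition p f) :
    MonotonicityCondition p (fun r => -f (-r)) where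
  strictMono := by
    intro x hx y hy hxy
    have := h.strictMono (a := -y) (b := -x) (by simpa using hy) (by simpa using hx) (by linarith)
    simp only [abs_neg] at this
    simp only [neg_div]
    linarith
  tendsto_zero := by
    have h1 : Tendsto (fun r : ℝ => -r) (𝓝[≠] 0) (𝓝[≠] 0) := by
      apply tendsto_nhdsWithin_iff.2 ⟨?_, ?_⟩
      · simpa using (continuous_neg.tendsto (0 : ℝ)).mono_left nhdsWithin_le_nhds
      · filter_upwards [self_mem_nhdsWithin] with x hx
        simpa using hx
    simpa [Function.comp_def, neg_div] using (h.tendsto_zero.comp h1).neg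
  lower := by
    obtain ⟨c, hc, h1⟩ := h.lower
    refine ⟨c, hc, fun s => ?_⟩
    have := primitive_reflect f s
    unfold primitive at this
    rw [this]
    simpa using h1 (-s)
  upper := by
    obtain ⟨c, hc, h1⟩ := h.upper
    refine ⟨c, hc, fun s => ?_⟩
    simpa using h1 (-s)

theorem pos_of_pos (h : MonotonicityCondition p f) {r : ℝ} (hr : 0 < r) : 0 < f r := by
  have h1 : ∀ r : ℝ, 0 < r → 0 ≤ f r / |r| := by
    intro r hr
    have h2 : Tendsto (fun r => f r / |r|) (𝓝[>] 0) (𝓝 0) :=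
      h.tendsto_zero.mono_left (nhdsWithin_mono _ fun x hx => ne_of_gt hx)
    refine le_of_tendsto h2 ?_
    filter_upwards [Ioo_mem_nhdsGT hr] with x hx
    exact (h.strictMono (ne_of_gt hx.1) (ne_of_gt hr) hx.2).le
  have h2 := h1 (r / 2) (by positivity)
  have h3 := h.strictMono (a := r / 2) (b := r) (ne_of_gt (by positivity)) (ne_of_gt hr)
    (by linarith)
  have h4 : 0 < f r / |r| := lt_of_le_of_lt h2 h3
  rw [abs_of_pos hr] at h4
  exact (div_pos_iff_of_pos_right hr).1 h4

theorem neg_of_neg (h : MonotonicityCondition p f) {r : ℝ} (hr : r < 0) : f r < 0 := by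
  have := h.reflect.pos_of_pos (r := -r) (by linarith)
  simpa using this

theorem map_zero (h : MonotonicityCondition p f) (hf : Continuous f) : f 0 = 0 := by
  have h1 : Tendsto f (𝓝[>] 0) (𝓝 (f 0)) := (hf.tendsto 0).mono_left nhdsWithin_le_nhds
  have h2 : Tendsto f (𝓝[<] 0) (𝓝 (f 0)) := (hf.tendsto 0).mono_left nhdsWithin_le_nhds
  refine le_antisymm (le_of_tendsto h2 ?_) (ge_of_tendsto h1 ?_)
  · filter_upwards [self_mem_nhdsWithin] with x hx using (h.neg_of_neg hx).le
  · filter_upwards [self_mem_nhdsWithin] with x hx using (h.pos_of_pos hx).le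

theorem primitive_nonneg (h : MonotonicityCondition p f) (s : ℝ) : 0 ≤ primitive f s := by
  obtain ⟨c, hc, h1⟩ := h.lower
  exact le_trans (by positivity) (h1 s)

theorem primitive_pos (h : MonotonicityCondition p f) {s : ℝ} (hs : s ≠ 0) :
    0 < primitive f s := by
  obtain ⟨c, hc, h1⟩ := h.lower
  have : 0 < |s| := abs_pos.2 hs
  exact lt_of_lt_of_le (by positivity) (h1 s)

/-- The function F(r) − f(u)/(2u)·r² has derivative r(f(r)/r − f(u)/u) for r > 0, so r = u is its
strict minimum on [0, ∞). -/
theorem primitive_sub_gt_of_pos (h : MonotonicityCondition p f) (hf : Continuous f) {u y : ℝ}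
    (hu : 0 < u) (hy : 0 ≤ y) (hne : y ≠ u) :
    f u / (2 * u) * (y ^ 2 - u ^ 2) < primitive f y - primitive f u := by
  let D : ℝ → ℝ := fun r => primitive f r - f u / (2 * u) * r ^ 2
  have hD : ∀ r, HasDerivAt D (f r - f u / u * r) r := by
    intro r
    have h1 := (hasDerivAt_primitive hf r).sub ((hasDerivAt_pow 2 r).const_mul (f u / (2 * u)))
    refine h1.congr_deriv ?_
    field_simp
    norm_num
    ring
  have hc : Continuous D := continuous_iff_continuousAt.2 fun r => (hD r).continuousAt
  have hlt : ∀ a b : ℝ, 0 < a → a < b → f a / a < f b / b := by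
    intro a b ha hab
    have := h.strictMono (ne_of_gt ha) (ne_of_gt (ha.trans hab)) hab
    simpa [abs_of_pos ha, abs_of_pos (ha.trans hab)] using this
  have key : D u < D y := by
    rcases lt_or_gt_of_ne hne with hlt' | hgt
    · have : StrictAntiOn D (Set.Icc 0 u) := by
        refine strictAntiOn_of_deriv_neg (convex_Icc 0 u) hc.continuousOn fun r hr => ?_
        rw [interior_Icc] at hr
        rw [(hD r).deriv]
        have := hlt r u hr.1 hr.2
        rw [div_lt_iff₀ hr.1] at this
        linarith
      exact this ⟨hy, hlt'.le⟩ ⟨hu.le, le_rfl⟩ hlt'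
    · have : StrictMonoOn D (Set.Ici u) := by
        refine strictMonoOn_of_deriv_pos (convex_Ici u) hc.continuousOn fun r hr => ?_
        rw [interior_Ici] at hr
        rw [(hD r).deriv]
        have := hlt u r hu hr
        rw [lt_div_iff₀ (hu.trans hr)] at this
        linarith
      exact this (Set.mem_Ici.2 le_rfl) (Set.mem_Ici.2 hgt.le) hgt
  simp only [D] at key
  linarith

theorem primitive_le_of_pos (h : MonotonicityCondition p f) (hf : Continuous f) {u : ℝ}
    (hu : 0 < u) : primitive f u ≤ f u * u / 2 := by
  have := (h.primitive_sub_gt_of_pos hf hu le_rfl hu.ne).le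
  rw [primitive_zero] at this
  have e : f u / (2 * u) * (0 ^ 2 - u ^ 2) = -(f u * u / 2) := by field_simp; ring
  linarith

theorem primitive_gt_of_pos (h : MonotonicityCondition p f) (hf : Continuous f) {u y τ : ℝ}
    (hu : 0 < u) (hτ : 0 ≤ τ) (hne : y ≠ u) :
    primitive f u + f u * (τ * y - (1 + τ ^ 2) / 2 * u) < primitive f y := by
  have hfu := h.pos_of_pos hu
  rcases le_or_gt 0 y with hy | hy
  · have h1 := h.primitive_sub_gt_of_pos hf hu hy hne
    -- Completing the square: the dependence on τ is confined to −(y − τu)², which can be dropped.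
    have h2 : f u * (τ * y - (1 + τ ^ 2) / 2 * u)
        = f u / (2 * u) * (y ^ 2 - u ^ 2) - f u / (2 * u) * (y - τ * u) ^ 2 := by
      field_simp
      ring
    have h3 : 0 ≤ f u / (2 * u) * (y - τ * u) ^ 2 := by positivity
    linarith
  -- For y < 0 the term f(u)τy is nonpositive, −½f(u)u compensates F(u), and strictness comes from
  -- F(y) > 0.
  · have h1 := h.primitive_le_of_pos hf hu
    have h2 := h.primitive_pos hy.ne
    have h3 : 0 ≤ f u * (τ * (-y)) := mul_nonneg hfu.le (mul_nonneg hτ (by linarith))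
    have h4 : 0 ≤ f u * (τ ^ 2 * u) := by positivity
    nlinarith

/-- The pointwise inequality behind the uniqueness of the maximum of the energy on half spaces. -/
theorem primitive_gt (h : MonotonicityCondition p f) (hf : Continuous f) {u y τ : ℝ}
    (hτ : 0 ≤ τ) (hne : y ≠ u) :
    primitive f u + f u * (τ * y - (1 + τ ^ 2) / 2 * u) < primitive f y := by
  rcases lt_trichotomy u 0 with hu | hu | hu
  · have h1 := h.reflect.primitive_gt_of_pos (by fun_prop) (u := -u) (y := -y) (by linarith) hτ
      (by simpa using hne)
    simp only [primitive_reflect, neg_neg] at h1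
    linarith
  · subst hu
    rw [primitive_zero, h.map_zero hf]
    simpa using h.primitive_pos hne
  · exact h.primitive_gt_of_pos hf hu hτ hne

/-- At y = u the two sides differ by ½(τ−1)² f(u)u ≥ 0; elsewhere the strict inequality applies. -/
theorem primitive_ge (h : MonotonicityCondition p f) (hf : Continuous f) (u y : ℝ) {τ : ℝ}
    (hτ : 0 ≤ τ) :
    primitive f u + f u * (τ * y - (1 + τ ^ 2) / 2 * u) ≤ primitive f y := by
  rcases eq_or_ne y u with rfl | hne
  · have h0 : 0 ≤ f y * y := by
      rcases lt_trichotomy y 0 with hy | hy | hy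
      · exact (mul_pos_of_neg_of_neg (h.neg_of_neg hy) hy).le
      · simp [hy]
      · exact (mul_pos (h.pos_of_pos hy) hy).le
    nlinarith [mul_nonneg h0 (sq_nonneg (τ - 1))]
  · exact (h.primitive_gt hf hτ hne).le

theorem two_mul_primitive_le (h : MonotonicityCondition p f) (hf : Continuous f) (u : ℝ) :
    2 * primitive f u ≤ f u * u := by
  have := h.primitive_ge hf u 0 le_rfl
  rw [primitive_zero] at this
  linarith

/-- With τ = t and y = tu, `primitive_ge` gains ½(t²−1)f(u)u, which is at least (t²−1)F(u). -/
theorem primitive_mul_ge (h : MonotonicityCondition p f) (hf : Continuous f) (u : ℝ) {t : ℝ}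
    (ht : 1 ≤ t) : t ^ 2 * primitive f u ≤ primitive f (t * u) := by
  have h1 := h.primitive_ge hf u (t * u) (τ := t) (by linarith)
  have h2 := h.two_mul_primitive_le hf u
  nlinarith [mul_nonneg (by nlinarith : (0 : ℝ) ≤ t ^ 2 - 1) (sub_nonneg.2 h2)]

/-- The case τ = 1 of `primitive_ge` says that F lies above each of its tangents. -/
theorem convexOn_primitive (h : MonotonicityCondition p f) (hf : Continuous f) :
    ConvexOn ℝ Set.univ (primitive f) := by
  refine ⟨convex_univ, fun x _ y _ a b ha hb hab => ?_⟩
  have h1 := h.primitive_ge hf (a • x + b • y) x (τ := 1) (by norm_num)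
  have h2 := h.primitive_ge hf (a • x + b • y) y (τ := 1) (by norm_num)
  simp only [smul_eq_mul] at *
  have hb' : b = 1 - a := by linarith
  subst hb'
  nlinarith [mul_le_mul_of_nonneg_left h1 ha, mul_le_mul_of_nonneg_left h2 hb]

theorem primitive_le (h : MonotonicityCondition p f) (hf : Continuous f) (hp : 2 < p) :
    ∃ C > 0, ∀ s : ℝ, primitive f s ≤ C * (|s| + |s| ^ p) := by
  obtain ⟨C, hC, h1⟩ := h.upper
  refine ⟨C, hC, fun s => ?_⟩
  have h2 := h.two_mul_primitive_le hf s
  have h3 := h.primitive_nonneg s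
  have h4 : f s * s ≤ |f s| * |s| := by rw [← abs_mul]; exact le_abs_self _
  have h5 : |f s| * |s| ≤ C * (1 + |s| ^ (p - 1)) * |s| := by
    gcongr
    exact h1 s
  have h6 : |s| ^ (p - 1) * |s| = |s| ^ p := by
    rcases eq_or_ne s 0 with rfl | hs
    · rw [abs_zero, mul_zero, Real.zero_rpow (by linarith)]
    · rw [← Real.rpow_add_one (abs_ne_zero.2 hs)]; simp
  have h7 : C * (1 + |s| ^ (p - 1)) * |s| = C * (|s| + |s| ^ p) := by
    rw [← h6]; ring
  linarith

/-- Absorbing |s|^(p−1)|v| into (|s|+|v|)^p makes integrability of f(g)v immediate for g, v in L^p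
on a finite measure space. -/
theorem abs_mul_le (h : MonotonicityCondition p f) (hp : 2 < p) :
    ∃ C > 0, ∀ s v : ℝ, |f s * v| ≤ C * (|v| + (|s| + |v|) ^ p) := by
  obtain ⟨C, hC, h1⟩ := h.upper
  refine ⟨C, hC, fun s v => ?_⟩
  have h2 : |s| ^ (p - 1) * |v| ≤ (|s| + |v|) ^ p := by
    have h6 : (|s| + |v|) ^ (p - 1) * (|s| + |v|) = (|s| + |v|) ^ p := by
      rcases eq_or_ne (|s| + |v|) 0 with hs | hs
      · rw [hs, mul_zero, Real.zero_rpow (by linarith)]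
      · rw [← Real.rpow_add_one hs]; simp
    rw [← h6]
    gcongr
    · linarith
    · linarith [abs_nonneg v]
    · linarith [abs_nonneg s]
  calc |f s * v| = |f s| * |v| := abs_mul _ _
    _ ≤ C * (1 + |s| ^ (p - 1)) * |v| := by gcongr; exact h1 s
    _ = C * (|v| + |s| ^ (p - 1) * |v|) := by ring
    _ ≤ _ := by gcongr

theorem tendsto_primitive_mul_div_sq (h : MonotonicityCondition p f) (hf : Continuous f) (s : ℝ) :
    Tendsto (fun t : ℝ => primitive f (t * s) / t ^ 2) (𝓝[>] 0) (𝓝 0) := by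
  rcases eq_or_ne s 0 with rfl | hs
  · simp [primitive_zero]
  have h1 : Tendsto (fun t : ℝ => t * s) (𝓝[>] 0) (𝓝[≠] 0) := by
    apply tendsto_nhdsWithin_iff.2 ⟨?_, ?_⟩
    · have : Continuous fun t : ℝ => t * s := by fun_prop
      simpa using (this.tendsto 0).mono_left nhdsWithin_le_nhds
    · filter_upwards [self_mem_nhdsWithin] with x hx
      exact mul_ne_zero (ne_of_gt hx) hs
  have h2 := (((h.tendsto_zero.comp h1).abs).mul_const (s ^ 2 / 2))
  simp only [abs_zero, zero_mul] at h2
  refine squeeze_zero' (Eventually.of_forall fun t =>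
    div_nonneg (h.primitive_nonneg _) (sq_nonneg t)) ?_ h2
  filter_upwards [self_mem_nhdsWithin] with t ht
  have ht : 0 < t := ht
  have h3 := h.two_mul_primitive_le hf (t * s)
  have h4 : f (t * s) * (t * s) ≤ |f (t * s)| * |t * s| := by rw [← abs_mul]; exact le_abs_self _
  simp only [Function.comp, abs_div, abs_abs, abs_mul, abs_of_pos ht] at h4 ⊢
  rw [div_le_iff₀ (by positivity)]
  have h5 : |f (t * s)| / (t * |s|) * (s ^ 2 / 2) * t ^ 2 = |f (t * s)| * (t * |s|) / 2 := by
    rw [← sq_abs s]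
    have : |s| ≠ 0 := abs_ne_zero.2 hs
    field_simp
  linarith

end MonotonicityCondition

/-! ### Auxiliary facts from convex analysis -/

/-- A decreasing sequence of nonempty bounded closed convex sets in a Hilbert space has nonempty
intersection. -/
theorem nonempty_iInter_of_convex {H : Type*} [NormedAddCommGroup H] [InnerProductSpace ℝ H]
    [CompleteSpace H] {C : ℕ → Set H} (hanti : Antitone C) (hne : ∀ n, (C n).Nonempty)
    (hcl : ∀ n, IsClosed (C n)) (hconv : ∀ n, Convex ℝ (C n)) {R : ℝ}
    (hb : ∀ u ∈ C 0, ‖u‖ ≤ R) : (⋂ n, C n).Nonempty := by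
  have hmin : ∀ n, ∃ x ∈ C n, ∀ y ∈ C n, ‖x‖ ≤ ‖y‖ := by
    intro n
    obtain ⟨x, hx, h⟩ := exists_norm_eq_iInf_of_complete_convex (hne n) (hcl n).isComplete
      (hconv n) 0
    refine ⟨x, hx, fun y hy => ?_⟩
    have h1 : (⨅ w : C n, ‖(0 : H) - w‖) ≤ ‖(0 : H) - y‖ :=
      ciInf_le (f := fun w : C n => ‖(0 : H) - w‖)
        ⟨0, by rintro _ ⟨w, rfl⟩; exact norm_nonneg _⟩ ⟨y, hy⟩
    rw [← h] at h1
    simpa using h1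
  choose x hx hxmin using hmin
  have hmono : Monotone fun n => ‖x n‖ ^ 2 := fun i j hij => by
    have := hxmin i (x j) (hanti hij (hx j))
    dsimp only
    gcongr
  have hbdd : BddAbove (Set.range fun n => ‖x n‖ ^ 2) := by
    refine ⟨R ^ 2, ?_⟩
    rintro _ ⟨n, rfl⟩
    have := hb (x n) (hanti (Nat.zero_le n) (hx n))
    dsimp only
    gcongr
  have hlim := tendsto_atTop_ciSup hmono hbdd
  set L := ⨆ n, ‖x n‖ ^ 2
  -- The midpoint of `x i` and `x j` lies in `C i`, so its norm is at least ‖x i‖; the parallelogram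
  -- law then makes the points of least norm a Cauchy sequence.
  have hdist : ∀ i j, i ≤ j → ‖x j - x i‖ ^ 2 ≤ 2 * (‖x j‖ ^ 2 - ‖x i‖ ^ 2) := by
    intro i j hij
    have hmid : (1 / 2 : ℝ) • x i + (1 / 2 : ℝ) • x j ∈ C i :=
      hconv i (hx i) (hanti hij (hx j)) (by norm_num) (by norm_num) (by norm_num)
    have h1 := hxmin i _ hmid
    have h2 : ‖(1 / 2 : ℝ) • x i + (1 / 2 : ℝ) • x j‖ = ‖x j + x i‖ / 2 := by
      rw [← smul_add, norm_smul, add_comm]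
      norm_num
      ring
    rw [h2] at h1
    have h3 := parallelogram_law_with_norm ℝ (x j) (x i)
    nlinarith [norm_nonneg (x i), norm_nonneg (x j + x i)]
  have hcauchy : CauchySeq x := by
    rw [Metric.cauchySeq_iff']
    intro ε hε
    have h1 : ∀ᶠ n in atTop, L - ε ^ 2 / 4 < ‖x n‖ ^ 2 :=
      hlim.eventually (lt_mem_nhds (by have : 0 < ε ^ 2 := by positivity
                                       linarith))
    obtain ⟨N, hN⟩ := h1.exists
    refine ⟨N, fun n hn => ?_⟩
    have h2 := hdist N n hn
    have h3 : ‖x n‖ ^ 2 ≤ L := le_ciSup hbdd n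
    rw [dist_eq_norm]
    refine lt_of_pow_lt_pow_left₀ 2 hε.le ?_
    nlinarith [sq_pos_of_pos hε]
  obtain ⟨y, hy⟩ := cauchySeq_tendsto_of_complete hcauchy
  refine ⟨y, Set.mem_iInter.2 fun n => ?_⟩
  exact (hcl n).mem_of_tendsto hy
    (eventually_atTop.2 ⟨n, fun k hk => hanti hk (hx k)⟩)

/-- A minimax principle in the plane. -/
theorem slope_le_of_minimax {k : ℝ × ℝ → ℝ} (hk : ConvexOn ℝ Set.univ k)
    (hscale : ∀ t : ℝ, 1 ≤ t → ∀ z, t ^ 2 * k z ≤ k (t • z)) {a b d : ℝ} {h : ℝ × ℝ → ℝ}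
    (hdef : ∀ x y, h (x, y) = (a * x ^ 2 + 2 * b * x * y + d * y ^ 2) / 2 - k (x, y))
    (hmax : ∀ t, 0 ≤ t → h (t, 0) ≤ h (1, 0))
    (huniq : ∀ t, 0 ≤ t → h (t, 0) = h (1, 0) → t = 1) (hpos : 0 < h (1, 0))
    (hneg : ∃ T > 0, h (T, 0) < 0) {s₀ : ℝ} (hs₀ : 0 < s₀)
    (hmin : ∀ s, 0 < s → s < s₀ → ∀ η > 0, ∃ t, 0 ≤ t ∧ h (1, 0) - η ≤ h (t, t * s))
    {ε : ℝ} (hε : 0 < ε) : (k (1, 0) - k (1, -ε)) / ε ≤ b := by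
  have hkc : Continuous k := by
    have := hk.continuousOn isOpen_univ
    rwa [continuousOn_univ] at this
  have hhc : Continuous h := by
    have : h = fun z => (a * z.1 ^ 2 + 2 * b * z.1 * z.2 + d * z.2 ^ 2) / 2 - k z := by
      ext ⟨x, y⟩
      exact hdef x y
    rw [this]
    fun_prop
  have hhs : ∀ t : ℝ, 1 ≤ t → ∀ x y, h (t * x, t * y) ≤ t ^ 2 * h (x, y) := by
    intro t ht x y
    have := hscale t ht (x, y)
    simp only [Prod.smul_mk, smul_eq_mul] at this
    rw [hdef, hdef]
    nlinarith
  obtain ⟨T, hT, hhT⟩ := hneg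
  let l : Filter ℝ := 𝓝[>] 0
  have hl0 : Tendsto (fun s : ℝ => s) l (𝓝 0) := nhdsWithin_le_nhds
  -- Near maximizers on the ray through (1, s). The defect s² still vanishes after division by s.
  have hex : ∀ s : ℝ, ∃ t, 0 < s → s < s₀ → 0 ≤ t ∧ h (1, 0) - s ^ 2 ≤ h (t, t * s) := by
    intro s
    by_cases hs : 0 < s ∧ s < s₀
    · obtain ⟨t, ht⟩ := hmin s hs.1 hs.2 (s ^ 2) (by have := hs.1; positivity)
      exact ⟨t, fun _ _ => ht⟩
    · exact ⟨0, fun h1 h2 => (hs ⟨h1, h2⟩).elim⟩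
  choose t ht using hex
  have hl : ∀ᶠ s in l, 0 < s ∧ s < s₀ := Ioo_mem_nhdsGT hs₀
  -- For small s, h is negative at T(1, s) and by `hhs` stays nonpositive further out, whereas the
  -- near maximal value is positive.
  have hbound : ∀ᶠ s in l, t s ∈ Set.Icc 0 T := by
    have h1 : ∀ᶠ s in l, h (T, T * s) < 0 := by
      have : Tendsto (fun s : ℝ => h (T, T * s)) l (𝓝 (h (T, 0))) := by
        have hc : Continuous fun s : ℝ => h (T, T * s) := by fun_prop
        simpa using (hc.tendsto 0).mono_left nhdsWithin_le_nhds
      exact this.eventually (gt_mem_nhds hhT)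
    have h2 : ∀ᶠ s in l, s ^ 2 < h (1, 0) := by
      have : Tendsto (fun s : ℝ => s ^ 2) l (𝓝 0) := by simpa using hl0.pow 2
      exact this.eventually (gt_mem_nhds hpos)
    filter_upwards [h1, h2, hl] with s hs1 hs2 hs
    obtain ⟨ht0, hts⟩ := ht s hs.1 hs.2
    refine ⟨ht0, le_of_not_gt fun hgt => ?_⟩
    have h3 := hhs (t s / T) ((one_le_div hT).2 hgt.le) T (T * s)
    have e1 : t s / T * T = t s := by field_simp
    have e2 : t s / T * (T * s) = t s * s := by field_simp
    rw [e1, e2] at h3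
    have h4 : (t s / T) ^ 2 * h (T, T * s) ≤ 0 :=
      mul_nonpos_of_nonneg_of_nonpos (sq_nonneg _) hs1.le
    linarith
  -- Every cluster point of t(s) maximizes h on the ray through (1, 0), and that maximizer is
  -- unique.
  have hlim : Tendsto t l (𝓝 1) := by
    refine isCompact_Icc.tendsto_nhds_of_unique_mapClusterPt hbound fun x hx hcl => ?_
    obtain ⟨U, hU, hUx⟩ := mapClusterPt_iff_ultrafilter.1 hcl
    have h1 : Tendsto (fun s => h (t s, t s * s)) U (𝓝 (h (x, x * 0))) :=
      (hhc.tendsto _).comp (hUx.prodMk_nhds (hUx.mul (hl0.mono_left hU)))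
    have h2 : Tendsto (fun s : ℝ => h (1, 0) - s ^ 2) U (𝓝 (h (1, 0) - 0 ^ 2)) :=
      ((hl0.mono_left hU).pow 2).const_sub _
    have h3 := le_of_tendsto_of_tendsto h2 h1
      (by filter_upwards [hU hl] with s hs using (ht s hs.1 hs.2).2)
    simp only [mul_zero, ne_eq, OfNat.ofNat_ne_zero, not_false_eq_true, zero_pow, sub_zero] at h3
    exact huniq x hx.1 (le_antisymm (hmax x hx.1) h3)
  -- From h(t, 0) ≤ h(1, 0) ≤ h(t, ts) + s² one gets k(t, ts) − k(t, 0) ≤ s(bt² + ½dt²s + s).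
  -- Convexity of k in the second variable bounds the left difference quotient at (t, 0) by this
  -- right one.
  have hfin : ∀ᶠ s in l, t s * ((k (t s, 0) - k (t s, -ε)) / ε)
      ≤ b * t s ^ 2 + d * t s ^ 2 * s / 2 + s := by
    filter_upwards [hl, hbound] with s hs htb
    obtain ⟨ht0, hts⟩ := ht s hs.1 hs.2
    have hs0 := hs.1
    set τ := t s
    have hden : 0 < τ * s + ε := by positivity
    have hconv := hk.2 (Set.mem_univ (τ, -ε)) (Set.mem_univ (τ, τ * s))
      (show 0 ≤ τ * s / (τ * s + ε) by positivity) (show 0 ≤ ε / (τ * s + ε) by positivity)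
      (by field_simp)
    have e : (τ * s / (τ * s + ε)) • (τ, -ε) + (ε / (τ * s + ε)) • (τ, τ * s) = (τ, (0 : ℝ)) := by
      ext
      · simp only [Prod.smul_mk, smul_eq_mul, Prod.mk_add_mk]
        field_simp
      · simp only [Prod.smul_mk, smul_eq_mul, Prod.mk_add_mk]
        field_simp
        ring
    rw [e] at hconv
    simp only [smul_eq_mul] at hconv
    have hconv' : (τ * s + ε) * k (τ, 0) ≤ τ * s * k (τ, -ε) + ε * k (τ, τ * s) := by
      have := mul_le_mul_of_nonneg_left hconv hden.le
      have e2 : (τ * s + ε) * (τ * s / (τ * s + ε) * k (τ, -ε) + ε / (τ * s + ε) * k (τ, τ * s))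
          = τ * s * k (τ, -ε) + ε * k (τ, τ * s) := by field_simp
      rwa [e2] at this
    have h1 := hmax τ ht0
    rw [hdef τ (τ * s)] at hts
    rw [hdef τ 0] at h1
    have h2 : s * (τ * ((k (τ, 0) - k (τ, -ε)) / ε)) ≤ k (τ, τ * s) - k (τ, 0) := by
      rw [mul_div_assoc', mul_div_assoc', div_le_iff₀ hε]
      linarith
    have h3 : s * (τ * ((k (τ, 0) - k (τ, -ε)) / ε))
        ≤ s * (b * τ ^ 2 + d * τ ^ 2 * s / 2 + s) := by nlinarith
    exact le_of_mul_le_mul_left h3 hs0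
  have hL : Tendsto (fun s => t s * ((k (t s, 0) - k (t s, -ε)) / ε)) l
      (𝓝 (1 * ((k (1, 0) - k (1, -ε)) / ε))) :=
    hlim.mul ((((hkc.tendsto _).comp (hlim.prodMk_nhds tendsto_const_nhds)).sub
      ((hkc.tendsto _).comp (hlim.prodMk_nhds tendsto_const_nhds))).div_const _)
  have hR : Tendsto (fun s => b * t s ^ 2 + d * t s ^ 2 * s / 2 + s) l
      (𝓝 (b * 1 ^ 2 + d * 1 ^ 2 * 0 / 2 + 0)) :=
    (((hlim.pow 2).const_mul b).add ((((hlim.pow 2).const_mul d).mul hl0).div_const 2)).add hl0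
  have := le_of_tendsto_of_tendsto hL hR hfin
  simpa using this

/-! ### Extended quadratic forms -/

/-- `N` is a lower semicontinuous quadratic form with values in `[0, ∞]`, and `b` is the polar form
of `N` on the subspace where `N` is finite. -/
structure IsQuadForm {H : Type*} [NormedAddCommGroup H] [InnerProductSpace ℝ H]
    (N : H → ℝ≥0∞) (b : H → H → ℝ) : Prop where
  lsc : LowerSemicontinuous N
  map_zero : N 0 = 0
  lt_top : ∀ {u v : H}, N u < ∞ → N v < ∞ → ∀ s t : ℝ, N (s • u + t • v) < ∞
  expand : ∀ {u v : H}, N u < ∞ → N v < ∞ → ∀ s t : ℝ,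
    (N (s • u + t • v)).toReal = s ^ 2 * (N u).toReal + 2 * s * t * b u v + t ^ 2 * (N v).toReal

namespace IsQuadForm

variable {H : Type*} [NormedAddCommGroup H] [InnerProductSpace ℝ H] {N : H → ℝ≥0∞}
  {b : H → H → ℝ}

theorem smul_lt_top (h : IsQuadForm N b) {u : H} (hu : N u < ∞) (s : ℝ) : N (s • u) < ∞ := by
  simpa using h.lt_top hu hu s 0

theorem add_lt_top (h : IsQuadForm N b) {u v : H} (hu : N u < ∞) (hv : N v < ∞) :
    N (u + v) < ∞ := by
  simpa using h.lt_top hu hv 1 1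

theorem toReal_smul (h : IsQuadForm N b) {u : H} (hu : N u < ∞) (s : ℝ) :
    (N (s • u)).toReal = s ^ 2 * (N u).toReal := by
  simpa using h.expand hu hu s 0

theorem toReal_add_smul (h : IsQuadForm N b) {u v : H} (hu : N u < ∞) (hv : N v < ∞) (t : ℝ) :
    (N (u + t • v)).toReal = (N u).toReal + 2 * t * b u v + t ^ 2 * (N v).toReal := by
  simpa using h.expand hu hv 1 t

theorem inner_self (h : IsQuadForm N b) {u : H} (hu : N u < ∞) : b u u = (N u).toReal := by
  have h1 := h.expand hu hu 1 1
  rw [← add_smul, h.toReal_smul hu] at h1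
  linarith

theorem sq_inner_le (h : IsQuadForm N b) {u v : H} (hu : N u < ∞) (hv : N v < ∞) :
    b u v ^ 2 ≤ (N u).toReal * (N v).toReal := by
  have h1 : ∀ t : ℝ, 0 ≤ (N v).toReal * (t * t) + 2 * b u v * t + (N u).toReal := fun t => by
    have := h.toReal_add_smul hu hv t
    have h0 : 0 ≤ (N (u + t • v)).toReal := ENNReal.toReal_nonneg
    linarith
  have := discrim_le_zero h1
  unfold discrim at this
  linarith

/-- The defect in the inequality is exactly st·N(u − v). -/
theorem toReal_convex (h : IsQuadForm N b) {u v : H} (hu : N u < ∞) (hv : N v < ∞) {s t : ℝ}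
    (hs : 0 ≤ s) (ht : 0 ≤ t) (hst : s + t = 1) :
    (N (s • u + t • v)).toReal ≤ s * (N u).toReal + t * (N v).toReal := by
  have h1 := h.expand hu hv s t
  have h2 := h.expand hu hv 1 (-1)
  have h3 : 0 ≤ (N ((1 : ℝ) • u + (-1 : ℝ) • v)).toReal := ENNReal.toReal_nonneg
  have hs' : s = 1 - t := by linarith
  subst hs'
  nlinarith [mul_nonneg (mul_nonneg hs ht) (h2 ▸ h3)]

end IsQuadForm

/-! ### Strongly indefinite forms on `L²` -/

section Bound

variable {Ω : Type*} [MeasurableSpace Ω] {m : Measure Ω} [IsFiniteMeasure m]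

/-- A form that is compact with respect to `L^p` controls the `L²` norm. -/
theorem norm_sq_le_of_compact {p : ℝ} (hp : 2 < p) {N : Lp ℝ 2 m → ℝ≥0∞}
    {b : Lp ℝ 2 m → Lp ℝ 2 m → ℝ} (h : IsQuadForm N b) (P : Lp ℝ 2 m →L[ℝ] Lp ℝ 2 m)
    (hc : ∀ (u : ℕ → Lp ℝ 2 m) (C : ℝ), (∀ n, N (u n) ≤ ENNReal.ofReal C) →
      ∃ (g : Ω → ℝ) (σ : ℕ → ℕ), MemLp g (ENNReal.ofReal p) m ∧ StrictMono σ ∧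
        Tendsto (fun n => eLpNorm (fun z => P (u (σ n)) z - g z) (ENNReal.ofReal p) m)
          atTop (𝓝 0)) :
    ∃ C > 0, ∀ u, N u < ∞ → ‖P u‖ ^ 2 ≤ C * (N u).toReal := by
  by_contra! hcon
  -- Rescaled counterexamples have bounded form but unbounded L² norm, although a subsequence is
  -- bounded in L^p and p > 2 on a finite measure space.
  have hex : ∀ n : ℕ, ∃ v, N v ≤ ENNReal.ofReal 1 ∧ ‖P v‖ ^ 2 = n + 1 := by
    intro n
    obtain ⟨u, hu, hlt⟩ := hcon (n + 1) (by positivity)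
    have h0 : 0 ≤ (N u).toReal := ENNReal.toReal_nonneg
    have hr : 0 < ‖P u‖ ^ 2 := lt_of_le_of_lt (by positivity) hlt
    have hr' : 0 < ‖P u‖ := by
      rcases (norm_nonneg (P u)).eq_or_lt with h | h
      · rw [← h] at hr; simp at hr
      · exact h
    have hsq : (Real.sqrt (n + 1) / ‖P u‖) ^ 2 = (n + 1) / ‖P u‖ ^ 2 := by
      rw [div_pow, Real.sq_sqrt (by positivity)]
    refine ⟨(Real.sqrt (n + 1) / ‖P u‖) • u, ?_, ?_⟩
    · rw [← ENNReal.ofReal_toReal (h.smul_lt_top hu _).ne]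
      apply ENNReal.ofReal_le_ofReal
      rw [h.toReal_smul hu, hsq, div_mul_eq_mul_div, div_le_one hr]
      exact hlt.le
    · rw [map_smul, norm_smul, mul_pow, Real.norm_eq_abs, sq_abs, hsq]
      field_simp
  choose v hv hv2 using hex
  obtain ⟨g, σ, hg, hσ, hlim⟩ := hc v 1 hv
  set c : ℝ≥0∞ := m Set.univ ^ (1 / (2 : ℝ≥0∞).toReal - 1 / (ENNReal.ofReal p).toReal) with hcdef
  have hp2 : (2 : ℝ≥0∞) ≤ ENNReal.ofReal p := by
    rw [show (2 : ℝ≥0∞) = ENNReal.ofReal 2 by simp]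
    exact ENNReal.ofReal_le_ofReal hp.le
  have hp1 : (1 : ℝ≥0∞) ≤ ENNReal.ofReal p := le_trans (by norm_num) hp2
  have hcfin : c ≠ ∞ := by
    refine (ENNReal.rpow_lt_top_of_nonneg ?_ (measure_ne_top m _)).ne
    rw [ENNReal.toReal_ofReal (by linarith)]
    simp only [ENNReal.toReal_ofNat, sub_nonneg]
    gcongr
  have hev : ∀ᶠ n in atTop, eLpNorm (fun z => P (v (σ n)) z - g z) (ENNReal.ofReal p) m < 1 :=
    hlim.eventually (gt_mem_nhds (by norm_num))
  set B : ℝ≥0∞ := (1 + eLpNorm g (ENNReal.ofReal p) m) * c with hB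
  have hBfin : B ≠ ∞ := ENNReal.mul_ne_top (by simpa using hg.2.ne) hcfin
  have hbound : ∀ᶠ n in atTop, ((σ n : ℝ) + 1) ≤ B.toReal ^ 2 := by
    filter_upwards [hev] with n hn
    rw [← hv2 (σ n)]
    have h1 : eLpNorm (P (v (σ n))) 2 m ≤ B := by
      refine (eLpNorm_le_eLpNorm_mul_rpow_measure_univ hp2 (Lp.aestronglyMeasurable _)).trans ?_
      rw [hB]
      gcongr
      have h2 : (P (v (σ n)) : Ω → ℝ) = (fun z => P (v (σ n)) z - g z) + g := by
        ext z; simp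
      rw [h2]
      refine (eLpNorm_add_le ((Lp.aestronglyMeasurable _).sub hg.1) hg.1 hp1).trans ?_
      gcongr
      exact hn.le
    have h3 : ‖P (v (σ n))‖ ≤ B.toReal := by
      rw [Lp.norm_def]
      exact ENNReal.toReal_mono hBfin h1
    gcongr
  obtain ⟨k, hk⟩ := exists_nat_gt (B.toReal ^ 2)
  obtain ⟨n, hn1, hn2⟩ := (hbound.and (eventually_ge_atTop k)).exists
  have : (n : ℝ) ≤ σ n := by exact_mod_cast hσ.id_le n
  have : (k : ℝ) ≤ n := by exact_mod_cast hn2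
  linarith

end Bound

/-- An orthogonal splitting of `L²(m)` into three parts, with a positive quadratic form on each
of the first two, both compact with respect to `L^p(m)`, and with a measure `ν ≤ c m` that controls
the third part. -/
structure IndefiniteForm {Ω : Type*} [MeasurableSpace Ω] (m ν : Measure Ω) (p : ℝ) where
  posProj : Lp ℝ 2 m →L[ℝ] Lp ℝ 2 m
  negProj : Lp ℝ 2 m →L[ℝ] Lp ℝ 2 m
  kerProj : Lp ℝ 2 m →L[ℝ] Lp ℝ 2 m
  posForm : Lp ℝ 2 m → ℝ≥0∞
  negForm : Lp ℝ 2 m → ℝ≥0∞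
  posInner : Lp ℝ 2 m → Lp ℝ 2 m → ℝ
  negInner : Lp ℝ 2 m → Lp ℝ 2 m → ℝ
  sum_proj : ∀ u, posProj u + negProj u + kerProj u = u
  pos_neg : ∀ u, posProj (negProj u) = 0
  pos_ker : ∀ u, posProj (kerProj u) = 0
  neg_pos : ∀ u, negProj (posProj u) = 0
  neg_ker : ∀ u, negProj (kerProj u) = 0
  ker_pos : ∀ u, kerProj (posProj u) = 0
  ker_neg : ∀ u, kerProj (negProj u) = 0
  posQuad : IsQuadForm posForm posInner
  negQuad : IsQuadForm negForm negInner
  posForm_proj : ∀ u, posForm (posProj u) = posForm u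
  negForm_proj : ∀ u, negForm (negProj u) = negForm u
  memLp_pos : ∀ u, posForm u < ∞ → MemLp (posProj u) (ENNReal.ofReal p) m
  memLp_neg : ∀ u, negForm u < ∞ → MemLp (negProj u) (ENNReal.ofReal p) m
  pos_compact : ∀ (u : ℕ → Lp ℝ 2 m) (C : ℝ), (∀ n, posForm (u n) ≤ ENNReal.ofReal C) →
    ∃ (g : Ω → ℝ) (σ : ℕ → ℕ), MemLp g (ENNReal.ofReal p) m ∧ StrictMono σ ∧
      Tendsto (fun n => eLpNorm (fun z => posProj (u (σ n)) z - g z) (ENNReal.ofReal p) m)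
        atTop (𝓝 0)
  neg_compact : ∀ (u : ℕ → Lp ℝ 2 m) (C : ℝ), (∀ n, negForm (u n) ≤ ENNReal.ofReal C) →
    ∃ (g : Ω → ℝ) (σ : ℕ → ℕ), MemLp g (ENNReal.ofReal p) m ∧ StrictMono σ ∧
      Tendsto (fun n => eLpNorm (fun z => negProj (u (σ n)) z - g z) (ENNReal.ofReal p) m)
        atTop (𝓝 0)
  le_smul : ∃ c : NNReal, ν ≤ c • m
  control : ∃ C > 0, ∀ u, kerProj u = u → ‖u‖ ^ 2 ≤ C * ∫ z, (u z) ^ 2 ∂ν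

/-! ### The energy space and integrability of the potential. -/

namespace IndefiniteForm

variable {Ω : Type*} [MeasurableSpace Ω] {m ν : Measure Ω} [IsFiniteMeasure m]
  [IsFiniteMeasure ν] {p : ℝ} (S : IndefiniteForm m ν p)

theorem absolutelyContinuous (S : IndefiniteForm m ν p) : ν ≪ m := by
  obtain ⟨c, hc⟩ := S.le_smul
  exact (Measure.absolutelyContinuous_of_le hc).trans Measure.smul_absolutelyContinuous

theorem memLp_of_memLp (S : IndefiniteForm m ν p) {r : ℝ≥0∞} {g : Ω → ℝ} (hg : MemLp g r m) : MemLp g r ν := by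
  obtain ⟨c, hc⟩ := S.le_smul
  exact (hg.smul_measure (c := (c : ℝ≥0∞)) ENNReal.coe_ne_top).mono_measure hc

theorem coeFn_lincomb (S : IndefiniteForm m ν p) (u v : Lp ℝ 2 m) (s t : ℝ) :
    ⇑(s • u + t • v) =ᵐ[ν] fun z => s * u z + t * v z := by
  refine S.absolutelyContinuous.ae_le ?_
  filter_upwards [Lp.coeFn_add (s • u) (t • v), Lp.coeFn_smul s u, Lp.coeFn_smul t v]
    with z h1 h2 h3
  rw [h1, Pi.add_apply, h2, h3]
  rfl

theorem pos_pos (u : Lp ℝ 2 m) : S.posProj (S.posProj u) = S.posProj u := by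
  conv_rhs => rw [← S.sum_proj u, map_add, map_add, S.pos_neg, S.pos_ker]
  simp

theorem neg_neg (u : Lp ℝ 2 m) : S.negProj (S.negProj u) = S.negProj u := by
  conv_rhs => rw [← S.sum_proj u, map_add, map_add, S.neg_pos, S.neg_ker]
  simp

theorem ker_ker (u : Lp ℝ 2 m) : S.kerProj (S.kerProj u) = S.kerProj u := by
  conv_rhs => rw [← S.sum_proj u, map_add, map_add, S.ker_pos, S.ker_neg]
  simp

theorem posForm_eq_zero {u : Lp ℝ 2 m} (h : S.posProj u = 0) : S.posForm u = 0 := by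
  rw [← S.posForm_proj, h, S.posQuad.map_zero]

theorem negForm_eq_zero {u : Lp ℝ 2 m} (h : S.negProj u = 0) : S.negForm u = 0 := by
  rw [← S.negForm_proj, h, S.negQuad.map_zero]

/-- The energy space. -/
def space : Submodule ℝ (Lp ℝ 2 m) where
  carrier := {u | S.posForm u < ∞ ∧ S.negForm u < ∞ ∧ MemLp u (ENNReal.ofReal p) ν}
  zero_mem' := ⟨by simp [S.posQuad.map_zero], by simp [S.negQuad.map_zero],
    MemLp.zero.ae_eq (S.absolutelyContinuous.ae_eq (Lp.coeFn_zero ℝ 2 m)).symm⟩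
  add_mem' := fun {u v} hu hv => ⟨S.posQuad.add_lt_top hu.1 hv.1, S.negQuad.add_lt_top hu.2.1 hv.2.1,
    (hu.2.2.add hv.2.2).ae_eq (S.absolutelyContinuous.ae_eq (Lp.coeFn_add u v)).symm⟩
  smul_mem' := fun c u hu => ⟨S.posQuad.smul_lt_top hu.1 c, S.negQuad.smul_lt_top hu.2.1 c,
    (hu.2.2.const_smul c).ae_eq (S.absolutelyContinuous.ae_eq (Lp.coeFn_smul c u)).symm⟩

/-- The value of the positive form as a real number. -/
def np (u : Lp ℝ 2 m) : ℝ := (S.posForm u).toReal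

/-- The value of the negative form as a real number. -/
def nm (u : Lp ℝ 2 m) : ℝ := (S.negForm u).toReal

theorem np_nonneg (u : Lp ℝ 2 m) : 0 ≤ S.np u := ENNReal.toReal_nonneg

theorem nm_nonneg (u : Lp ℝ 2 m) : 0 ≤ S.nm u := ENNReal.toReal_nonneg

theorem np_proj (u : Lp ℝ 2 m) : S.np (S.posProj u) = S.np u := by rw [np, S.posForm_proj, np]

theorem nm_proj (u : Lp ℝ 2 m) : S.nm (S.negProj u) = S.nm u := by rw [nm, S.negForm_proj, nm]

theorem posProj_mem {u : Lp ℝ 2 m} (hu : S.posForm u < ∞) : S.posProj u ∈ S.space :=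
  ⟨by rwa [S.posForm_proj], by simp [S.negForm_eq_zero (S.neg_pos u)],
    S.memLp_of_memLp (S.memLp_pos u hu)⟩

theorem negProj_mem {u : Lp ℝ 2 m} (hu : S.negForm u < ∞) : S.negProj u ∈ S.space :=
  ⟨by simp [S.posForm_eq_zero (S.pos_neg u)], by rwa [S.negForm_proj],
    S.memLp_of_memLp (S.memLp_neg u hu)⟩

theorem kerProj_mem {u : Lp ℝ 2 m} (hu : u ∈ S.space) : S.kerProj u ∈ S.space := by
  have h : S.kerProj u = u - S.posProj u - S.negProj u := by
    rw [eq_sub_iff_add_eq, eq_sub_iff_add_eq]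
    conv_rhs => rw [← S.sum_proj u]
    abel
  rw [h]
  exact S.space.sub_mem (S.space.sub_mem hu (S.posProj_mem hu.1)) (S.negProj_mem hu.2.1)

/-! #### The potential -/

section Potential

variable {f : ℝ → ℝ}

theorem aestronglyMeasurable (S : IndefiniteForm m ν p) (u : Lp ℝ 2 m) : AEStronglyMeasurable u ν :=
  (Lp.aestronglyMeasurable u).mono_ac S.absolutelyContinuous

theorem integrable_abs_rpow (hp : 2 < p) {g : Ω → ℝ} (hg : MemLp g (ENNReal.ofReal p) ν) :
    Integrable (fun z => |g z| ^ p) ν := by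
  have := hg.integrable_norm_rpow (by simp; linarith) ENNReal.ofReal_ne_top
  rwa [ENNReal.toReal_ofReal (by linarith)] at this

theorem memLp_two (S : IndefiniteForm m ν p) (u : Lp ℝ 2 m) : MemLp u 2 ν := S.memLp_of_memLp (Lp.memLp u)

theorem integrable (S : IndefiniteForm m ν p) (u : Lp ℝ 2 m) : Integrable u ν :=
  (S.memLp_two u).integrable (by norm_num)

theorem integrable_primitive (hp : 2 < p) (hf : Continuous f) (hMC : MonotonicityCondition p f)
    {g : Ω → ℝ} (hg : MemLp g (ENNReal.ofReal p) ν) :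
    Integrable (fun z => primitive f (g z)) ν := by
  obtain ⟨C, hC, h⟩ := hMC.primitive_le hf hp
  have hg1 : Integrable g ν := hg.integrable (by
    rw [show (1 : ℝ≥0∞) = ENNReal.ofReal 1 by simp]
    exact ENNReal.ofReal_le_ofReal (by linarith))
  refine ((hg1.abs.add (integrable_abs_rpow hp hg)).const_mul C).mono'
    ((continuous_primitive hf).comp_aestronglyMeasurable hg.1) (Eventually.of_forall fun z => ?_)
  rw [Real.norm_of_nonneg (hMC.primitive_nonneg _)]
  exact h _

theorem integrable_mul (hp : 2 < p) (hf : Continuous f) (hMC : MonotonicityCondition p f)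
    {g v : Ω → ℝ} (hg : MemLp g (ENNReal.ofReal p) ν) (hv : MemLp v (ENNReal.ofReal p) ν) :
    Integrable (fun z => f (g z) * v z) ν := by
  obtain ⟨C, hC, h⟩ := hMC.abs_mul_le hp
  have hv1 : Integrable v ν := hv.integrable (by
    rw [show (1 : ℝ≥0∞) = ENNReal.ofReal 1 by simp]
    exact ENNReal.ofReal_le_ofReal (by linarith))
  have h2 := integrable_abs_rpow hp (hg.norm.add hv.norm)
  refine ((hv1.abs.add h2).const_mul C).mono'
    ((hf.comp_aestronglyMeasurable hg.1).mul hv.1) (Eventually.of_forall fun z => ?_)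
  refine (h _ _).trans (le_of_eq ?_)
  simp only [Pi.add_apply, Real.norm_eq_abs]
  rw [abs_of_nonneg (add_nonneg (abs_nonneg (g z)) (abs_nonneg (v z)))]

theorem hasDerivAt_integral_primitive (hp : 2 < p) (hf : Continuous f)
    (hMC : MonotonicityCondition p f) {g v : Ω → ℝ} (hg : MemLp g (ENNReal.ofReal p) ν)
    (hv : MemLp v (ENNReal.ofReal p) ν) :
    HasDerivAt (fun s : ℝ => ∫ z, primitive f (g z + s * v z) ∂ν) (∫ z, f (g z) * v z ∂ν) 0 := by
  obtain ⟨C, hC, h⟩ := hMC.abs_mul_le hp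
  have hv1 : Integrable v ν := hv.integrable (by
    rw [show (1 : ℝ≥0∞) = ENNReal.ofReal 1 by simp]
    exact ENNReal.ofReal_le_ofReal (by linarith))
  have h2 := integrable_abs_rpow hp (hg.norm.add (hv.norm.add hv.norm))
  have key := hasDerivAt_integral_of_dominated_loc_of_deriv_le (μ := ν) (𝕜 := ℝ) (x₀ := (0 : ℝ))
    (s := Metric.ball 0 1) (F := fun s z => primitive f (g z + s * v z))
    (F' := fun s z => f (g z + s * v z) * v z)
    (bound := fun z => C * (|v z| + |‖g z‖ + (‖v z‖ + ‖v z‖)| ^ p))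
    (Metric.ball_mem_nhds _ one_pos) ?_ ?_ ?_ ?_ ?_ ?_
  · simpa using key.2
  · refine Eventually.of_forall fun s => ?_
    exact (continuous_primitive hf).comp_aestronglyMeasurable (hg.1.add (hv.1.const_mul s))
  · simpa using integrable_primitive hp hf hMC hg
  · simpa using! (hf.comp_aestronglyMeasurable hg.1).mul hv.1
  · refine Eventually.of_forall fun z s hs => ?_
    refine (h _ _).trans ?_
    have hs' : |s| < 1 := by simpa using hs
    have h3 : |g z + s * v z| ≤ |g z| + |v z| := by
      refine (abs_add_le _ _).trans ?_
      rw [abs_mul]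
      nlinarith [abs_nonneg (v z)]
    simp only [Real.norm_eq_abs]
    rw [abs_of_nonneg (by positivity : (0 : ℝ) ≤ |g z| + (|v z| + |v z|))]
    refine mul_le_mul_of_nonneg_left (add_le_add le_rfl ?_) hC.le
    exact Real.rpow_le_rpow (by positivity) (by linarith) (by linarith)
  · exact (hv1.abs.add h2).const_mul C
  · refine Eventually.of_forall fun z s _ => ?_
    have h4 : HasDerivAt (fun s : ℝ => g z + s * v z) (v z) s := by
      simpa using ((hasDerivAt_id s).mul_const (v z)).const_add (g z)
    exact (hasDerivAt_primitive hf _).comp s h4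

end Potential

end IndefiniteForm

/-- Fatou's lemma along an a.e. convergent subsequence; no growth condition on φ enters. -/
theorem isClosed_lintegral_le {Ω : Type*} [MeasurableSpace Ω] {m ν : Measure Ω}
    (hν : ν ≪ m) {φ : ℝ → ℝ} (hφ : Continuous φ) (r : ℝ≥0∞) :
    IsClosed {u : Lp ℝ 2 m | ∫⁻ z, ENNReal.ofReal (φ (u z)) ∂ν ≤ r} := by
  refine IsSeqClosed.isClosed fun u v hu huv => ?_
  have h1 : TendstoInMeasure m (fun n => ⇑(u n)) atTop v := tendstoInMeasure_of_tendsto_Lp huv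
  obtain ⟨σ, -, hσ⟩ := h1.exists_seq_tendsto_ae
  have h2 : ∀ᵐ z ∂ν, Tendsto (fun n => ENNReal.ofReal (φ (u (σ n) z))) atTop
      (𝓝 (ENNReal.ofReal (φ (v z)))) := by
    filter_upwards [hν.ae_le hσ] with z hz
    exact ((ENNReal.continuous_ofReal.comp hφ).tendsto _).comp hz
  have h3 : ∀ n, AEMeasurable (fun z => ENNReal.ofReal (φ (u (σ n) z))) ν := fun n =>
    ENNReal.measurable_ofReal.comp_aemeasurable (hφ.measurable.comp_aemeasurable
      ((Lp.aestronglyMeasurable (u (σ n))).mono_ac hν).aemeasurable)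
  calc ∫⁻ z, ENNReal.ofReal (φ (v z)) ∂ν
      = ∫⁻ z, liminf (fun n => ENNReal.ofReal (φ (u (σ n) z))) atTop ∂ν :=
        lintegral_congr_ae (by filter_upwards [h2] with z hz using hz.liminf_eq.symm)
    _ ≤ liminf (fun n => ∫⁻ z, ENNReal.ofReal (φ (u (σ n) z)) ∂ν) atTop :=
        lintegral_liminf_le' h3
    _ ≤ r := liminf_le_of_le (by isBoundedDefault) fun b hb => by
        obtain ⟨n, hn⟩ := hb.exists
        exact hn.trans (hu (σ n))

/-! ### The convex part of the energy and its minimization over fibres. -/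

namespace IndefiniteForm

variable {Ω : Type*} [MeasurableSpace Ω] {m ν : Measure Ω} [IsFiniteMeasure m]
  [IsFiniteMeasure ν] {p : ℝ} (S : IndefiniteForm m ν p) (f : ℝ → ℝ)

/-- The potential `∫ F(u) dν`. -/
def pot (_ : IndefiniteForm m ν p) (f : ℝ → ℝ) (u : Lp ℝ 2 m) : ℝ := ∫ z, primitive f (u z) ∂ν

/-- The convex part of the energy. -/
def cost (u : Lp ℝ 2 m) : ℝ := S.nm u / 2 + S.pot f u

/-- The convex part of the energy, as an extended number. -/
def costE (u : Lp ℝ 2 m) : ℝ≥0∞ := S.negForm u / 2 + ∫⁻ z, ENNReal.ofReal (primitive f (u z)) ∂ν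

/-- The energy functional. -/
def phi (u : Lp ℝ 2 m) : ℝ := S.np u / 2 - S.cost f u

variable {f} (hp : 2 < p) (hf : Continuous f) (hMC : MonotonicityCondition p f)

theorem pot_nonneg (hMC : MonotonicityCondition p f) (u : Lp ℝ 2 m) : 0 ≤ S.pot f u :=
  integral_nonneg fun _ => hMC.primitive_nonneg _

theorem cost_nonneg (hMC : MonotonicityCondition p f) (u : Lp ℝ 2 m) : 0 ≤ S.cost f u :=
  add_nonneg (div_nonneg (S.nm_nonneg u) two_pos.le) (S.pot_nonneg hMC u)

include hp hf hMC in
theorem costE_eq {u : Lp ℝ 2 m} (hu : u ∈ S.space) :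
    S.costE f u = ENNReal.ofReal (S.cost f u) := by
  rw [costE, cost, ENNReal.ofReal_add (div_nonneg (S.nm_nonneg u) two_pos.le)
    (S.pot_nonneg hMC u), nm, ENNReal.ofReal_div_of_pos two_pos, ENNReal.ofReal_toReal hu.2.1.ne,
    pot, ofReal_integral_eq_lintegral_ofReal (integrable_primitive hp hf hMC hu.2.2)
      (Eventually.of_forall fun _ => hMC.primitive_nonneg _)]
  simp

include hf in
theorem lowerSemicontinuous_costE : LowerSemicontinuous (S.costE f) := by
  unfold costE
  refine LowerSemicontinuous.add ?_ ?_
  · have h : Continuous fun x : ℝ≥0∞ => x / 2 := ENNReal.continuous_div_const 2 (by norm_num)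
    exact h.comp_lowerSemicontinuous S.negQuad.lsc fun x y hxy => ENNReal.div_le_div_right hxy 2
  · exact lowerSemicontinuous_iff_isClosed_preimage.2 fun r =>
      isClosed_lintegral_le S.absolutelyContinuous (continuous_primitive hf) r

include hp hf hMC in
-- The bound F(s) ≥ c|s|^p turns a finite potential into membership in L^p(ν). Limits taken in L²
-- thereby stay in the energy space.
theorem mem_space_of_costE {u : Lp ℝ 2 m} (h1 : S.posForm u < ∞) (h2 : S.costE f u < ∞) :
    u ∈ S.space := by
  rw [costE, ENNReal.add_lt_top] at h2
  refine ⟨h1, ?_, ?_⟩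
  · by_contra h
    rw [not_lt_top_iff.1 h, ENNReal.top_div_of_ne_top (by norm_num)] at h2
    exact lt_irrefl _ h2.1
  · obtain ⟨c, hc, hlow⟩ := hMC.lower
    refine ⟨S.aestronglyMeasurable u, ?_⟩
    have hp0 : ENNReal.ofReal p ≠ 0 := by simp; linarith
    rw [eLpNorm_lt_top_iff_lintegral_rpow_enorm_lt_top hp0 ENNReal.ofReal_ne_top,
      ENNReal.toReal_ofReal (by linarith)]
    have h3 : ∀ z, ‖u z‖ₑ ^ p ≤ ENNReal.ofReal (1 / c) * ENNReal.ofReal (primitive f (u z)) := by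
      intro z
      rw [Real.enorm_eq_ofReal_abs, ENNReal.ofReal_rpow_of_nonneg (abs_nonneg _) (by linarith),
        ← ENNReal.ofReal_mul (by positivity)]
      apply ENNReal.ofReal_le_ofReal
      rw [div_mul_eq_mul_div, one_mul, le_div_iff₀ hc, mul_comm]
      exact hlow _
    refine (lintegral_mono h3).trans_lt ?_
    rw [lintegral_const_mul' _ _ ENNReal.ofReal_ne_top]
    exact ENNReal.mul_lt_top ENNReal.ofReal_lt_top h2.2

theorem pot_lincomb {u v : Lp ℝ 2 m} (s t : ℝ) :
    S.pot f (s • u + t • v) = ∫ z, primitive f (s * u z + t * v z) ∂ν := by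
  refine integral_congr_ae ?_
  filter_upwards [S.coeFn_lincomb u v s t] with z hz
  rw [hz]

include hp hf hMC in
theorem pot_convex {u v : Lp ℝ 2 m} (hu : u ∈ S.space) (hv : v ∈ S.space) {s t : ℝ}
    (hs : 0 ≤ s) (ht : 0 ≤ t) (hst : s + t = 1) :
    S.pot f (s • u + t • v) ≤ s * S.pot f u + t * S.pot f v := by
  have hi := integrable_primitive hp hf hMC
    (S.space.add_mem (S.space.smul_mem s hu) (S.space.smul_mem t hv)).2.2
  have hi' := hi.congr (by
    filter_upwards [S.coeFn_lincomb u v s t] with z hz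
    rw [hz])
  have h1 := (integrable_primitive hp hf hMC hu.2.2).const_mul s
  have h2 := (integrable_primitive hp hf hMC hv.2.2).const_mul t
  rw [pot_lincomb, pot, pot, ← integral_const_mul, ← integral_const_mul, ← integral_add h1 h2]
  exact integral_mono hi' (h1.add h2) fun z =>
    (hMC.convexOn_primitive hf).2 (Set.mem_univ _) (Set.mem_univ _) hs ht hst

include hp hf hMC in
theorem cost_convex {u v : Lp ℝ 2 m} (hu : u ∈ S.space) (hv : v ∈ S.space) {s t : ℝ}
    (hs : 0 ≤ s) (ht : 0 ≤ t) (hst : s + t = 1) :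
    S.cost f (s • u + t • v) ≤ s * S.cost f u + t * S.cost f v := by
  have h1 := S.pot_convex hp hf hMC hu hv hs ht hst
  have h2 := S.negQuad.toReal_convex hu.2.1 hv.2.1 hs ht hst
  simp only [cost, nm]
  linarith

include hp hf hMC in
theorem cost_smul_ge {u : Lp ℝ 2 m} (hu : u ∈ S.space) {t : ℝ} (ht : 1 ≤ t) :
    t ^ 2 * S.cost f u ≤ S.cost f (t • u) := by
  have h1 : t ^ 2 * S.pot f u ≤ S.pot f (t • u) := by
    rw [pot, pot, ← integral_const_mul]
    refine integral_mono_ae ((integrable_primitive hp hf hMC hu.2.2).const_mul _)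
      (integrable_primitive hp hf hMC (S.space.smul_mem t hu).2.2) ?_
    filter_upwards [S.absolutelyContinuous.ae_le (Lp.coeFn_smul t u)] with z hz
    rw [hz]
    exact hMC.primitive_mul_ge hf _ ht
  have h2 := S.negQuad.toReal_smul hu.2.1 t
  simp only [cost, nm]
  rw [h2]
  linarith

include hp hMC in
-- Coercivity on a fibre. The compact form bounds the negative part. The potential bounds u in
-- L²(ν), hence also the kernel part u − w − u⁻ in L²(ν), and `control` lifts that bound to L²(m).
theorem norm_le_of_cost_le (w : Lp ℝ 2 m) (a : ℝ) (hf : Continuous f) :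
    ∃ R, ∀ u ∈ S.space, S.posProj u = w → S.cost f u ≤ a → ‖u‖ ≤ R := by
  obtain ⟨C₁, hC₁, h1⟩ := norm_sq_le_of_compact hp S.negQuad S.negProj S.neg_compact
  obtain ⟨C₂, hC₂, h2⟩ := S.control
  obtain ⟨c, hc, hlow⟩ := hMC.lower
  obtain ⟨d, hd⟩ := S.le_smul
  have hsq : ∀ u : Lp ℝ 2 m, ∫ z, (u z) ^ 2 ∂ν ≤ d * ‖u‖ ^ 2 := by
    intro u
    have hi : Integrable (fun z => (u z) ^ 2) m := (Lp.memLp u).integrable_sq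
    have h3 : ‖u‖ ^ 2 = ∫ z, (u z) ^ 2 ∂m := by
      rw [← real_inner_self_eq_norm_sq, L2.inner_def]
      refine integral_congr_ae (Eventually.of_forall fun z => ?_)
      simp only [real_inner_self_eq_norm_sq, Real.norm_eq_abs, sq_abs]
    rw [h3]
    calc ∫ z, (u z) ^ 2 ∂ν ≤ ∫ z, (u z) ^ 2 ∂(d • m) :=
          integral_mono_measure hd (Eventually.of_forall fun z => sq_nonneg _)
            (hi.smul_measure_nnreal)
      _ = d * ∫ z, (u z) ^ 2 ∂m := by
          rw [integral_smul_nnreal_measure]; rfl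
  have hi2 : ∀ u : Lp ℝ 2 m, Integrable (fun z => (u z) ^ 2) ν := fun u =>
    (S.memLp_two u).integrable_sq
  set B₁ : ℝ := C₁ * (2 * a)
  set B₂ : ℝ := ν.real Set.univ + a / c
  set B₃ : ℝ := C₂ * (3 * (B₂ + d * ‖w‖ ^ 2 + d * B₁))
  refine ⟨‖w‖ + Real.sqrt B₁ + Real.sqrt B₃, fun u hu hw hcost => ?_⟩
  have hpot := S.pot_nonneg hMC u
  have hnm := S.nm_nonneg u
  have e1 : ‖S.negProj u‖ ^ 2 ≤ B₁ := by
    refine (h1 u hu.2.1).trans (mul_le_mul_of_nonneg_left ?_ hC₁.le)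
    change S.nm u ≤ _
    unfold cost at hcost
    linarith
  have e2 : ∫ z, (u z) ^ 2 ∂ν ≤ B₂ := by
    have hi := (integrable_primitive hp hf hMC hu.2.2).const_mul (1 / c)
    have h3 : ∫ z, (u z) ^ 2 ∂ν ≤ ∫ z, (1 + (1 / c) * primitive f (u z)) ∂ν := by
      refine integral_mono (hi2 u) ((integrable_const _).add hi) fun z => ?_
      have h4 : |u z| ^ p ≤ 1 / c * primitive f (u z) := by
        rw [div_mul_eq_mul_div, one_mul, le_div_iff₀ hc, mul_comm]
        exact hlow _
      have h5 : (u z) ^ 2 ≤ 1 + |u z| ^ p := by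
        rw [← sq_abs]
        rcases le_or_gt |u z| 1 with h6 | h6
        · have := Real.rpow_nonneg (abs_nonneg (u z)) p
          nlinarith [abs_nonneg (u z)]
        · have := Real.rpow_le_rpow_of_exponent_le h6.le hp.le
          rw [Real.rpow_two] at this
          linarith
      dsimp only
      linarith
    rw [integral_add (integrable_const _) hi, integral_const, integral_const_mul] at h3
    refine h3.trans ?_
    have h6 : S.pot f u ≤ a := by
      unfold cost at hcost
      linarith
    simp only [smul_eq_mul, mul_one, B₂]
    rw [div_mul_eq_mul_div, one_mul]
    gcongr
    exact h6
  have e3 : ‖S.kerProj u‖ ^ 2 ≤ B₃ := by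
    refine (h2 _ (S.ker_ker u)).trans (mul_le_mul_of_nonneg_left ?_ hC₂.le)
    have h3 : ∫ z, (S.kerProj u z) ^ 2 ∂ν
        ≤ ∫ z, 3 * ((u z) ^ 2 + (w z) ^ 2 + (S.negProj u z) ^ 2) ∂ν := by
      refine integral_mono_ae (hi2 _) ((((hi2 u).add (hi2 w)).add (hi2 _)).const_mul 3) ?_
      have h4 : S.kerProj u = (u - w) - S.negProj u := by
        rw [eq_sub_iff_add_eq, eq_sub_iff_add_eq, ← hw]
        conv_rhs => rw [← S.sum_proj u]
        abel
      have h5 : ⇑((u - w) - S.negProj u) =ᵐ[ν] ⇑(u - w) - ⇑(S.negProj u) :=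
        S.absolutelyContinuous.ae_eq (Lp.coeFn_sub _ _)
      have h6 : ⇑(u - w) =ᵐ[ν] ⇑u - ⇑w := S.absolutelyContinuous.ae_eq (Lp.coeFn_sub _ _)
      filter_upwards [h5, h6] with z h5 h6
      rw [h4, h5, Pi.sub_apply, h6, Pi.sub_apply]
      nlinarith [sq_nonneg (u z + w z), sq_nonneg (u z + S.negProj u z),
        sq_nonneg (w z - S.negProj u z)]
    have hi3 : Integrable (fun z => (u z) ^ 2 + (w z) ^ 2) ν := (hi2 u).add (hi2 w)
    rw [integral_const_mul, integral_add hi3 (hi2 _), integral_add (hi2 u) (hi2 w)] at h3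
    refine h3.trans ?_
    have h7 := hsq w
    have h8 := (hsq (S.negProj u)).trans (mul_le_mul_of_nonneg_left e1 d.2)
    have : (∫ z, (u z) ^ 2 ∂ν) + (∫ z, (w z) ^ 2 ∂ν) + ∫ z, (S.negProj u z) ^ 2 ∂ν
        ≤ B₂ + d * ‖w‖ ^ 2 + d * B₁ := add_le_add (add_le_add e2 h7) h8
    linarith
  have e4 := S.sum_proj u
  rw [← e4, hw]
  refine (norm_add_le _ _).trans (add_le_add ((norm_add_le _ _).trans ?_) ?_)
  · gcongr
    exact Real.le_sqrt_of_sq_le e1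
  · exact Real.le_sqrt_of_sq_le e3

include hf in
-- The dilation t serves `exists_null_of_psi_nonneg`; minimization on a fibre uses t = 1.
theorem isClosed_sublevel (w : Lp ℝ 2 m) (t : ℝ) (r : ℝ≥0∞) :
    IsClosed {u | S.posProj u = w ∧ S.costE f (t • u) ≤ r} := by
  refine (isClosed_eq S.posProj.continuous continuous_const).inter ?_
  have h := lowerSemicontinuous_iff_isClosed_preimage.1 (S.lowerSemicontinuous_costE hf) r
  exact h.preimage (continuous_const_smul t)

include hp hf hMC in
theorem convex_sublevel {w : Lp ℝ 2 m} (hw : S.posForm w < ∞) (t r : ℝ) (hr : 0 ≤ r) :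
    Convex ℝ {u | S.posProj u = w ∧ S.costE f (t • u) ≤ ENNReal.ofReal r} := by
  rintro u ⟨hu1, hu2⟩ v ⟨hv1, hv2⟩ a b ha hb hab
  have key : ∀ u, S.posProj u = w → S.costE f (t • u) ≤ ENNReal.ofReal r →
      t • u ∈ S.space := fun u h1 h2 =>
    S.mem_space_of_costE hp hf hMC (S.posQuad.smul_lt_top (by rwa [← S.posForm_proj, h1]) t)
      (h2.trans_lt ENNReal.ofReal_lt_top)
  have hu := key u hu1 hu2
  have hv := key v hv1 hv2
  refine ⟨by rw [map_add, map_smul, map_smul, hu1, hv1, ← add_smul, hab, one_smul], ?_⟩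
  rw [S.costE_eq hp hf hMC hu, ENNReal.ofReal_le_ofReal_iff hr] at hu2
  rw [S.costE_eq hp hf hMC hv, ENNReal.ofReal_le_ofReal_iff hr] at hv2
  have e : t • (a • u + b • v) = a • t • u + b • t • v := by
    rw [smul_add, smul_comm t a, smul_comm t b]
  rw [e, S.costE_eq hp hf hMC (S.space.add_mem (S.space.smul_mem a hu) (S.space.smul_mem b hv))]
  apply ENNReal.ofReal_le_ofReal
  have := S.cost_convex hp hf hMC hu hv ha hb hab
  nlinarith [mul_le_mul_of_nonneg_left hu2 ha, mul_le_mul_of_nonneg_left hv2 hb]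

/-- The positive part of the energy space. -/
def posSpace : Submodule ℝ (Lp ℝ 2 m) where
  carrier := {w | w ∈ S.space ∧ S.posProj w = w}
  zero_mem' := ⟨S.space.zero_mem, map_zero _⟩
  add_mem' := fun hu hv => ⟨S.space.add_mem hu.1 hv.1, by rw [map_add, hu.2, hv.2]⟩
  smul_mem' := fun c _ hu => ⟨S.space.smul_mem c hu.1, by rw [map_smul, hu.2]⟩

theorem posProj_mem_posSpace {u : Lp ℝ 2 m} (hu : S.posForm u < ∞) : S.posProj u ∈ S.posSpace :=
  ⟨S.posProj_mem hu, S.pos_pos u⟩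

theorem np_eq_of_posProj {u w : Lp ℝ 2 m} (h : S.posProj u = w) : S.np u = S.np w := by
  rw [← h, S.np_proj]

/-- The minimal cost over an affine subspace parallel to the nonpositive part. -/
def minCost (f : ℝ → ℝ) (w : Lp ℝ 2 m) : ℝ := sInf (S.cost f '' {u | u ∈ S.space ∧ S.posProj u = w})

theorem minCost_le (hMC : MonotonicityCondition p f) {u : Lp ℝ 2 m} (hu : u ∈ S.space) :
    S.minCost f (S.posProj u) ≤ S.cost f u :=
  csInf_le ⟨0, by rintro _ ⟨v, -, rfl⟩; exact S.cost_nonneg hMC v⟩ ⟨u, ⟨hu, rfl⟩, rfl⟩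

theorem minCost_nonneg (hMC : MonotonicityCondition p f) (w : Lp ℝ 2 m) : 0 ≤ S.minCost f w :=
  Real.sInf_nonneg (by rintro _ ⟨v, -, rfl⟩; exact S.cost_nonneg hMC v)

include hp hf hMC in
-- Sublevel sets in the fibre with levels decreasing to the infimum are closed, convex and bounded
-- in L², so they have a common point.
theorem exists_minimizer {w : Lp ℝ 2 m} (hw : w ∈ S.posSpace) :
    ∃ u ∈ S.space, S.posProj u = w ∧ S.cost f u = S.minCost f w := by
  set k := S.minCost f w with hk
  have hk0 : 0 ≤ k := S.minCost_nonneg hMC w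
  let C : ℕ → Set (Lp ℝ 2 m) := fun n =>
    {u | S.posProj u = w ∧ S.costE f ((1 : ℝ) • u) ≤ ENNReal.ofReal (k + 1 / (n + 1))}
  have hmem : ∀ n, ∀ u ∈ C n, u ∈ S.space ∧ S.cost f u ≤ k + 1 / (n + 1) := by
    rintro n u ⟨h1, h2⟩
    rw [one_smul] at h2
    have hu := S.mem_space_of_costE hp hf hMC (u := u)
      (by rw [← S.posForm_proj, h1]; exact hw.1.1) (h2.trans_lt ENNReal.ofReal_lt_top)
    refine ⟨hu, ?_⟩
    rwa [S.costE_eq hp hf hMC hu, ENNReal.ofReal_le_ofReal_iff (by positivity)] at h2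
  obtain ⟨R, hR⟩ := S.norm_le_of_cost_le hp hMC w (k + 1 / ((0 : ℕ) + 1)) hf
  obtain ⟨u, hu⟩ := nonempty_iInter_of_convex (C := C) (R := R)
    (fun i j hij u hu => ⟨hu.1, hu.2.trans (ENNReal.ofReal_le_ofReal (by gcongr))⟩)
    (fun n => by
      have hne : (S.cost f '' {u | u ∈ S.space ∧ S.posProj u = w}).Nonempty :=
        ⟨_, w, ⟨hw.1, hw.2⟩, rfl⟩
      obtain ⟨_, ⟨u, ⟨hu1, hu2⟩, rfl⟩, hlt⟩ := exists_lt_of_csInf_lt hne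
        (show sInf (S.cost f '' {u | u ∈ S.space ∧ S.posProj u = w}) < k + 1 / ((n : ℝ) + 1) by
          rw [hk, minCost]
          have : (0 : ℝ) < 1 / ((n : ℝ) + 1) := by positivity
          linarith)
      refine ⟨u, hu2, ?_⟩
      rw [one_smul, S.costE_eq hp hf hMC hu1]
      exact ENNReal.ofReal_le_ofReal hlt.le)
    (fun n => S.isClosed_sublevel hf w 1 _)
    (fun n => S.convex_sublevel hp hf hMC hw.1.1 1 _ (by positivity))
    (fun u hu => hR u (hmem 0 u hu).1 hu.1 (hmem 0 u hu).2)
  rw [Set.mem_iInter] at hu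
  have hu0 := hmem 0 u (hu 0)
  refine ⟨u, hu0.1, (hu 0).1, le_antisymm ?_ ?_⟩
  · have hlim : Tendsto (fun n : ℕ => k + 1 / ((n : ℝ) + 1)) atTop (𝓝 (k + 0)) :=
      tendsto_one_div_add_atTop_nhds_zero_nat.const_add k
    rw [add_zero] at hlim
    exact ge_of_tendsto hlim (Eventually.of_forall fun n => (hmem n u (hu n)).2)
  · rw [hk, ← (hu 0).1]
    exact S.minCost_le hMC hu0.1

include hp hf hMC in
-- Partial minimization preserves convexity: combine the minimizers of the two fibres.
theorem minCost_convex {u v : Lp ℝ 2 m} (hu : u ∈ S.posSpace) (hv : v ∈ S.posSpace) {s t : ℝ}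
    (hs : 0 ≤ s) (ht : 0 ≤ t) (hst : s + t = 1) :
    S.minCost f (s • u + t • v) ≤ s * S.minCost f u + t * S.minCost f v := by
  obtain ⟨u', hu1, hu2, hu3⟩ := S.exists_minimizer hp hf hMC hu
  obtain ⟨v', hv1, hv2, hv3⟩ := S.exists_minimizer hp hf hMC hv
  rw [← hu3, ← hv3]
  refine le_trans ?_ (S.cost_convex hp hf hMC hu1 hv1 hs ht hst)
  have := S.minCost_le hMC (S.space.add_mem (S.space.smul_mem s hu1) (S.space.smul_mem t hv1))
  rwa [map_add, map_smul, map_smul, hu2, hv2] at this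

include hp hf hMC in
theorem minCost_smul_ge {w : Lp ℝ 2 m} (hw : w ∈ S.posSpace) {t : ℝ} (ht : 1 ≤ t) :
    t ^ 2 * S.minCost f w ≤ S.minCost f (t • w) := by
  obtain ⟨u, hu1, hu2, hu3⟩ := S.exists_minimizer hp hf hMC (S.posSpace.smul_mem t hw)
  have ht0 : t ≠ 0 := by linarith
  rw [← hu3]
  have h1 := S.cost_smul_ge hp hf hMC (S.space.smul_mem t⁻¹ hu1) ht
  rw [smul_inv_smul₀ ht0] at h1
  refine le_trans ?_ h1
  gcongr
  have := S.minCost_le hMC (S.space.smul_mem t⁻¹ hu1)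
  rwa [map_smul, hu2, inv_smul_smul₀ ht0] at this

theorem nm_eq_zero {w : Lp ℝ 2 m} (hw : S.posProj w = w) : S.nm w = 0 := by
  rw [nm, S.negForm_eq_zero (by rw [← hw, S.neg_pos])]
  rfl

theorem minCost_le_pot (hMC : MonotonicityCondition p f) {w : Lp ℝ 2 m} (hw : w ∈ S.posSpace) :
    S.minCost f w ≤ S.pot f w := by
  have := S.minCost_le hMC hw.1
  rw [hw.2, cost, S.nm_eq_zero hw.2] at this
  linarith

theorem pot_zero : S.pot f 0 = 0 := by
  have : S.pot f 0 = ∫ z, (0 : ℝ) ∂ν := by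
    refine integral_congr_ae ?_
    filter_upwards [S.absolutelyContinuous.ae_eq (Lp.coeFn_zero ℝ 2 m)] with z hz
    rw [hz]
    exact primitive_zero f
  simpa using this

theorem minCost_zero (hMC : MonotonicityCondition p f) : S.minCost f 0 = 0 :=
  le_antisymm ((S.minCost_le_pot hMC S.posSpace.zero_mem).trans S.pot_zero.le)
    (S.minCost_nonneg hMC 0)

end IndefiniteForm

/-! ### The reduced functional, its suprema along rays, and the minimax level. -/

namespace IndefiniteForm

variable {Ω : Type*} [MeasurableSpace Ω] {m ν : Measure Ω} [IsFiniteMeasure m]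
  [IsFiniteMeasure ν] {p : ℝ} (S : IndefiniteForm m ν p) (f : ℝ → ℝ)

/-- The energy, maximized over an affine subspace parallel to the nonpositive part. -/
def psi (w : Lp ℝ 2 m) : ℝ := S.np w / 2 - S.minCost f w

/-- The supremum of the energy over the half space spanned by `w` and the nonpositive part. -/
def rayMax (w : Lp ℝ 2 m) : ℝ≥0∞ := ⨆ t : NNReal, ENNReal.ofReal (S.psi f ((t : ℝ) • w))

variable {f} (hp : 2 < p) (hf : Continuous f) (hMC : MonotonicityCondition p f)

theorem np_smul {u : Lp ℝ 2 m} (hu : u ∈ S.space) (t : ℝ) : S.np (t • u) = t ^ 2 * S.np u :=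
  S.posQuad.toReal_smul hu.1 t

theorem ofReal_psi_le_rayMax (w : Lp ℝ 2 m) {t : ℝ} (ht : 0 ≤ t) :
    ENNReal.ofReal (S.psi f (t • w)) ≤ S.rayMax f w :=
  le_iSup (fun t : NNReal => ENNReal.ofReal (S.psi f ((t : ℝ) • w))) ⟨t, ht⟩

theorem phi_le_psi (hMC : MonotonicityCondition p f) {u : Lp ℝ 2 m} (hu : u ∈ S.space) :
    S.phi f u ≤ S.psi f (S.posProj u) := by
  have := S.minCost_le hMC hu
  rw [phi, psi, S.np_proj]
  linarith

include hp hf hMC in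
theorem psi_smul_le {w : Lp ℝ 2 m} (hw : w ∈ S.posSpace) {t : ℝ} (ht : 1 ≤ t) :
    S.psi f (t • w) ≤ t ^ 2 * S.psi f w := by
  have := S.minCost_smul_ge hp hf hMC hw ht
  rw [psi, psi, S.np_smul hw.1]
  linarith

theorem pot_smul (u : Lp ℝ 2 m) (t : ℝ) : S.pot f (t • u) = ∫ z, primitive f (t * u z) ∂ν := by
  refine integral_congr_ae ?_
  filter_upwards [S.absolutelyContinuous.ae_eq (Lp.coeFn_smul t u)] with z hz
  rw [hz]
  rfl

include hp hf hMC in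
-- F(tw)/t² tends to 0 pointwise and is dominated by F(w) for 0 < t < 1, so the quadratic term wins
-- for small t.
theorem exists_psi_pos {w : Lp ℝ 2 m} (hw : w ∈ S.posSpace) (h : 0 < S.np w) :
    ∃ t : ℝ, 0 < t ∧ 0 < S.psi f (t • w) := by
  have hlim : Tendsto (fun t : ℝ => ∫ z, primitive f (t * w z) / t ^ 2 ∂ν) (𝓝[>] 0)
      (𝓝 (∫ _, (0 : ℝ) ∂ν)) := by
    refine tendsto_integral_filter_of_dominated_convergence (fun z => primitive f (w z)) ?_ ?_
      (integrable_primitive hp hf hMC hw.1.2.2) ?_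
    · refine Eventually.of_forall fun t => ?_
      exact (((continuous_primitive hf).comp (continuous_const_mul t)).div_const
        (t ^ 2)).comp_aestronglyMeasurable (S.aestronglyMeasurable w)
    · filter_upwards [Ioo_mem_nhdsGT one_pos] with t ht
      refine Eventually.of_forall fun z => ?_
      rw [Real.norm_of_nonneg (div_nonneg (hMC.primitive_nonneg _) (sq_nonneg t)),
        div_le_iff₀ (pow_pos ht.1 2)]
      have := hMC.primitive_mul_ge hf (t * w z) (one_le_inv_iff₀.2 ⟨ht.1, ht.2.le⟩)
      rw [inv_mul_cancel_left₀ ht.1.ne', inv_pow, inv_mul_le_iff₀ (pow_pos ht.1 2)] at this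
      linarith
    · exact Eventually.of_forall fun z => hMC.tendsto_primitive_mul_div_sq hf (w z)
  rw [integral_zero] at hlim
  have hev : ∀ᶠ t : ℝ in 𝓝[>] 0, ∫ z, primitive f (t * w z) / t ^ 2 ∂ν < S.np w / 2 :=
    hlim.eventually (gt_mem_nhds (half_pos h))
  obtain ⟨t, ht, ht0⟩ := (hev.and self_mem_nhdsWithin).exists
  have ht0 : 0 < t := ht0
  refine ⟨t, ht0, ?_⟩
  have h1 := S.minCost_le_pot hMC (S.posSpace.smul_mem t hw)
  rw [integral_div, ← S.pot_smul, div_lt_iff₀ (by positivity)] at ht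
  rw [psi, S.np_smul hw.1]
  linarith

include hp hf hMC in
-- Nonnegativity of ψ at (n+1)w says that some u over w has C((n+1)u) ≤ ½(n+1)²‖w‖₊². By the scaling
-- C(tu) ≥ t²C(u) for t ≥ 1 these conditions get stronger with n, so the resulting convex sets share
-- a point z. A potential growing at least like (n+1)^p ∫|z|^p dν cannot stay of order n² unless z
-- vanishes ν-a.e.
theorem exists_null_of_psi_nonneg {w : Lp ℝ 2 m} (hw : w ∈ S.posSpace)
    (h : ∀ n : ℕ, 0 ≤ S.psi f (((n : ℝ) + 1) • w)) :
    ∃ z ∈ S.space, S.posProj z = w ∧ S.nm z ≤ S.np w ∧ z =ᵐ[ν] 0 := by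
  have hnp := S.np_nonneg w
  let r : ℕ → ℝ := fun n => ((n : ℝ) + 1) ^ 2 * (S.np w / 2)
  have hr : ∀ n, 0 ≤ r n := fun n => by positivity
  let C : ℕ → Set (Lp ℝ 2 m) := fun n =>
    {u | S.posProj u = w ∧ S.costE f (((n : ℝ) + 1) • u) ≤ ENNReal.ofReal (r n)}
  have hmem : ∀ n, ∀ u ∈ C n, u ∈ S.space ∧ S.cost f (((n : ℝ) + 1) • u) ≤ r n := by
    rintro n u ⟨h1, h2⟩
    have hn : ((n : ℝ) + 1) ≠ 0 := by positivity
    have hu := S.mem_space_of_costE hp hf hMC (u := ((n : ℝ) + 1) • u)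
      (S.posQuad.smul_lt_top (by rw [← S.posForm_proj, h1]; exact hw.1.1) _)
      (h2.trans_lt ENNReal.ofReal_lt_top)
    refine ⟨?_, ?_⟩
    · have := S.space.smul_mem ((n : ℝ) + 1)⁻¹ hu
      rwa [inv_smul_smul₀ hn] at this
    · rwa [S.costE_eq hp hf hMC hu, ENNReal.ofReal_le_ofReal_iff (hr n)] at h2
  have hmem' : ∀ (n : ℕ) (u : Lp ℝ 2 m), u ∈ S.space → S.posProj u = w → S.cost f (((n : ℝ) + 1) • u) ≤ r n →
      u ∈ C n := by
    intro n u h1 h2 h3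
    refine ⟨h2, ?_⟩
    rw [S.costE_eq hp hf hMC (S.space.smul_mem _ h1)]
    exact ENNReal.ofReal_le_ofReal h3
  have hanti : Antitone C := by
    refine antitone_nat_of_succ_le fun n u hu => ?_
    obtain ⟨h1, h2⟩ := hmem (n + 1) u hu
    refine hmem' n u h1 hu.1 ?_
    have hn : (0 : ℝ) < (n : ℝ) + 1 := by positivity
    set τ : ℝ := ((n : ℝ) + 1 + 1) / ((n : ℝ) + 1) with hτ
    have h3 := S.cost_smul_ge hp hf hMC (S.space.smul_mem ((n : ℝ) + 1) h1) (t := τ)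
      ((one_le_div hn).2 (by linarith))
    have e : τ * ((n : ℝ) + 1) = ((n + 1 : ℕ) : ℝ) + 1 := by
      rw [hτ]
      push_cast
      field_simp
    rw [smul_smul, e] at h3
    have h4 := h3.trans h2
    have e2 : r (n + 1) = τ ^ 2 * r n := by
      simp only [r]
      rw [← e]
      ring
    rw [e2] at h4
    exact le_of_mul_le_mul_left h4 (by positivity)
  obtain ⟨R, hR⟩ := S.norm_le_of_cost_le hp hMC w (r 0) hf
  obtain ⟨z, hz⟩ := nonempty_iInter_of_convex (C := C) (R := R) hanti
    (fun n => by
      obtain ⟨u, hu1, hu2, hu3⟩ := S.exists_minimizer hp hf hMC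
        (S.posSpace.smul_mem ((n : ℝ) + 1) hw)
      have hn : ((n : ℝ) + 1) ≠ 0 := by positivity
      refine ⟨((n : ℝ) + 1)⁻¹ • u, hmem' n _ (S.space.smul_mem _ hu1) ?_ ?_⟩
      · rw [map_smul, hu2, inv_smul_smul₀ hn]
      · rw [smul_inv_smul₀ hn, hu3]
        have := h n
        rw [psi, S.np_smul hw.1] at this
        simp only [r]
        linarith)
    (fun n => S.isClosed_sublevel hf w _ _)
    (fun n => S.convex_sublevel hp hf hMC hw.1.1 _ _ (hr n))
    (fun u hu => by
      have h1 := hmem 0 u hu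
      simp only [CharP.cast_eq_zero, zero_add, one_smul] at h1
      exact hR u h1.1 hu.1 h1.2)
  rw [Set.mem_iInter] at hz
  have hzs := (hmem 0 z (hz 0)).1
  have hcost : ∀ n : ℕ, S.cost f (((n : ℝ) + 1) • z) ≤ r n := fun n => (hmem n z (hz n)).2
  refine ⟨z, hzs, (hz 0).1, ?_, ?_⟩
  · have h1 := hcost 0
    simp only [CharP.cast_eq_zero, zero_add, one_smul, r, cost] at h1
    have := S.pot_nonneg hMC z
    linarith
  · obtain ⟨c, hc, hlow⟩ := hMC.lower
    set I : ℝ := ∫ z', |z z'| ^ p ∂ν with hI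
    have hI0 : 0 ≤ I := integral_nonneg fun _ => by positivity
    have hint := integrable_abs_rpow hp hzs.2.2
    have h1 : ∀ n : ℕ, ((n : ℝ) + 1) ^ (p - 2) * (c * I) ≤ S.np w / 2 := by
      intro n
      have hn : (0 : ℝ) < (n : ℝ) + 1 := by positivity
      have h2 := hcost n
      have h3 := S.nm_nonneg (((n : ℝ) + 1) • z)
      have h4 : c * ((n : ℝ) + 1) ^ p * I ≤ S.pot f (((n : ℝ) + 1) • z) := by
        rw [hI, ← integral_const_mul, S.pot_smul]
        refine integral_mono_ae (hint.const_mul _) ?_ (Eventually.of_forall fun x => ?_)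
        · refine (integrable_primitive hp hf hMC (S.space.smul_mem ((n : ℝ) + 1) hzs).2.2).congr ?_
          filter_upwards [S.absolutelyContinuous.ae_eq (Lp.coeFn_smul ((n : ℝ) + 1) z)] with x hx
          rw [hx]
          rfl
        · refine le_trans (le_of_eq ?_) (hlow _)
          dsimp only
          rw [abs_mul, abs_of_pos hn, Real.mul_rpow hn.le (abs_nonneg _), mul_assoc]
      have h5 : c * ((n : ℝ) + 1) ^ p * I ≤ r n := by
        unfold cost at h2
        linarith
      have h6 : ((n : ℝ) + 1) ^ p = ((n : ℝ) + 1) ^ 2 * ((n : ℝ) + 1) ^ (p - 2) := by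
        rw [← Real.rpow_natCast, ← Real.rpow_add hn]
        congr 1
        push_cast
        ring
      rw [h6] at h5
      simp only [r] at h5
      refine le_of_mul_le_mul_left ?_ (by positivity : (0 : ℝ) < ((n : ℝ) + 1) ^ 2)
      linarith
    have hI' : I = 0 := by
      by_contra hne
      have hpos : 0 < c * I := mul_pos hc (lt_of_le_of_ne hI0 (Ne.symm hne))
      have hlim : Tendsto (fun n : ℕ => ((n : ℝ) + 1) ^ (p - 2) * (c * I)) atTop atTop := by
        refine Tendsto.atTop_mul_const hpos ?_
        exact (tendsto_rpow_atTop (by linarith)).comp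
          (tendsto_atTop_add_const_right _ _ tendsto_natCast_atTop_atTop)
      obtain ⟨n, hn⟩ := (hlim.eventually (eventually_gt_atTop (S.np w / 2))).exists
      linarith [h1 n]
    have h7 := (integral_eq_zero_iff_of_nonneg (fun _ => by positivity) hint).1 hI'
    filter_upwards [h7] with x hx
    have hx : |z x| ^ p = 0 := hx
    rw [Real.rpow_eq_zero (abs_nonneg _) (by linarith)] at hx
    exact abs_eq_zero.1 hx

/-- Test with tz − z⁻: its positive part is tw, its negative part is (t−1)z⁻, and its potential does
not depend on t because z = 0 ν-a.e. The quadratic terms leave at least ½(t² − (t−1)²)‖w‖₊², which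
grows linearly in t. -/
theorem rayMax_eq_top {w z : Lp ℝ 2 m} (hMC : MonotonicityCondition p f) (h : 0 < S.np w)
    (hz : z ∈ S.space) (hzw : S.posProj z = w) (hle : S.nm z ≤ S.np w) (h0 : z =ᵐ[ν] 0) :
    S.rayMax f w = ∞ := by
  have hneg := S.negProj_mem hz.2.1
  set G := ∫ x, primitive f (-(S.negProj z x)) ∂ν
  have key : ∀ t : ℝ, (t - 1 / 2) * S.np w - G ≤ S.psi f (t • w) := by
    intro t
    have hmem : t • z - S.negProj z ∈ S.space := S.space.sub_mem (S.space.smul_mem t hz) hneg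
    have h1 := S.phi_le_psi hMC hmem
    have e1 : S.posProj (t • z - S.negProj z) = t • w := by
      rw [map_sub, map_smul, hzw, S.pos_neg, sub_zero]
    have e2 : S.negProj (t • z - S.negProj z) = (t - 1) • S.negProj z := by
      rw [map_sub, map_smul, S.neg_neg, sub_smul, one_smul]
    have e3 : S.nm (t • z - S.negProj z) = (t - 1) ^ 2 * S.nm z := by
      rw [← S.nm_proj, e2, nm, S.negQuad.toReal_smul hneg.2.1, ← nm, S.nm_proj]
    have e4 : S.np (t • z - S.negProj z) = t ^ 2 * S.np w := by
      rw [← S.np_proj, e1, ← hzw, np, S.posQuad.toReal_smul (S.posProj_mem hz.1).1, np]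
    have e5 : S.pot f (t • z - S.negProj z) = G := by
      refine integral_congr_ae ?_
      have h2 : ⇑(t • z - S.negProj z) =ᵐ[ν] ⇑(t • z) - ⇑(S.negProj z) :=
        S.absolutelyContinuous.ae_eq (Lp.coeFn_sub _ _)
      have h3 : ⇑(t • z) =ᵐ[ν] t • ⇑z := S.absolutelyContinuous.ae_eq (Lp.coeFn_smul _ _)
      filter_upwards [h0, h2, h3] with x h0 h2 h3
      rw [h2, Pi.sub_apply, h3, Pi.smul_apply, h0]
      simp
    rw [phi, cost, e1, e3, e4, e5] at h1
    nlinarith [mul_le_mul_of_nonneg_left hle (sq_nonneg (t - 1))]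
  refine ENNReal.eq_top_of_forall_nnreal_le fun r => ?_
  have hGr : 0 ≤ max 0 ((r + G) / S.np w + 1 / 2) := le_max_left _ _
  refine le_trans ?_ (S.ofReal_psi_le_rayMax w hGr)
  rw [← ENNReal.ofReal_coe_nnreal]
  refine ENNReal.ofReal_le_ofReal (le_trans ?_ (key _))
  have h5 : (r + G) / S.np w ≤ max 0 ((r + G) / S.np w + 1 / 2) - 1 / 2 := by
    have := le_max_right 0 ((r + G) / S.np w + 1 / 2)
    linarith
  rw [div_le_iff₀ h] at h5
  linarith

include hp hf hMC in
theorem exists_psi_neg {w : Lp ℝ 2 m} (hw : w ∈ S.posSpace) (h : 0 < S.np w)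
    (hfin : S.rayMax f w < ∞) : ∃ T : ℝ, 0 < T ∧ S.psi f (T • w) < 0 := by
  by_contra! hcon
  obtain ⟨z, h1, h2, h3, h4⟩ := S.exists_null_of_psi_nonneg hp hf hMC hw
    fun n => hcon ((n : ℝ) + 1) (by positivity)
  exact hfin.ne (S.rayMax_eq_top hMC h h1 h2 h3 h4)

include hp hf hMC in
theorem psi_neg_of_ge {w : Lp ℝ 2 m} (hw : w ∈ S.posSpace) {T t : ℝ} (hT : 0 < T)
    (h : S.psi f (T • w) < 0) (ht : T ≤ t) : S.psi f (t • w) < 0 := by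
  have h1 := S.psi_smul_le hp hf hMC (S.posSpace.smul_mem T hw) ((one_le_div hT).2 ht)
  rw [smul_smul, div_mul_cancel₀ _ hT.ne'] at h1
  have : 0 < (t / T) ^ 2 := by
    have : 0 < t := hT.trans_le ht
    positivity
  nlinarith

include hp hf hMC in
-- Beyond T the functional ψ stays negative by scaling; up to T it is at most ½T²‖w‖₊².
theorem rayMax_lt_top {w : Lp ℝ 2 m} (hw : w ∈ S.posSpace) {T : ℝ} (hT : 0 < T)
    (h : S.psi f (T • w) < 0) : S.rayMax f w < ∞ := by
  refine lt_of_le_of_lt (b := ENNReal.ofReal (T ^ 2 * S.np w / 2)) (iSup_le fun t => ?_)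
    ENNReal.ofReal_lt_top
  apply ENNReal.ofReal_le_ofReal
  have h0 := S.np_nonneg w
  rcases le_total (t : ℝ) T with h1 | h1
  · have h2 := S.minCost_nonneg hMC ((t : ℝ) • w)
    rw [psi, S.np_smul hw.1]
    have h3 : (t : ℝ) ^ 2 ≤ T ^ 2 := by gcongr
    nlinarith
  · have := S.psi_neg_of_ge hp hf hMC hw hT h h1
    have h4 : 0 ≤ T ^ 2 * S.np w / 2 := by positivity
    linarith

include hp hf hMC in
theorem convexOn_minCost_plane {w v : Lp ℝ 2 m} (hw : w ∈ S.posSpace) (hv : v ∈ S.posSpace) :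
    ConvexOn ℝ Set.univ (fun x : ℝ × ℝ => S.minCost f (x.1 • w + x.2 • v)) := by
  refine ⟨convex_univ, fun x _ y _ a b ha hb hab => ?_⟩
  have h := S.minCost_convex hp hf hMC
    (S.posSpace.add_mem (S.posSpace.smul_mem x.1 hw) (S.posSpace.smul_mem x.2 hv))
    (S.posSpace.add_mem (S.posSpace.smul_mem y.1 hw) (S.posSpace.smul_mem y.2 hv)) ha hb hab
  have e : (a • x + b • y).1 • w + (a • x + b • y).2 • v
      = a • (x.1 • w + x.2 • v) + b • (y.1 • w + y.2 • v) := by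
    simp only [Prod.fst_add, Prod.snd_add, Prod.smul_fst, Prod.smul_snd, smul_eq_mul, add_smul,
      smul_add, mul_smul]
    abel
  simp only [e, smul_eq_mul]
  exact h

include hp hf hMC in
-- Finite convex functions on the plane are continuous; here the second spanning vector is 0.
theorem continuous_minCost_ray {w : Lp ℝ 2 m} (hw : w ∈ S.posSpace) :
    Continuous fun t : ℝ => S.minCost f (t • w) := by
  have h := (S.convexOn_minCost_plane hp hf hMC hw S.posSpace.zero_mem).continuousOn isOpen_univ
  rw [continuousOn_univ] at h
  have h2 : Continuous fun t : ℝ => ((t, 0) : ℝ × ℝ) := by fun_prop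
  simpa [Function.comp_def] using h.comp h2

include hp hf hMC in
theorem exists_ray_max {w : Lp ℝ 2 m} (hw : w ∈ S.posSpace) (h : 0 < S.np w)
    (hfin : S.rayMax f w < ∞) :
    ∃ t : ℝ, 0 < t ∧ 0 < S.psi f (t • w) ∧ ∀ s : ℝ, 0 ≤ s → S.psi f (s • w) ≤ S.psi f (t • w) := by
  obtain ⟨T, hT, hneg⟩ := S.exists_psi_neg hp hf hMC hw h hfin
  obtain ⟨t₀, ht₀, hpos⟩ := S.exists_psi_pos hp hf hMC hw h
  have hc : Continuous fun t : ℝ => S.psi f (t • w) := by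
    have h1 := S.continuous_minCost_ray hp hf hMC hw
    unfold psi
    simp only [S.np_smul hw.1]
    fun_prop
  obtain ⟨t, ht, hmax⟩ := isCompact_Icc.exists_isMaxOn (Set.nonempty_Icc.2 hT.le)
    hc.continuousOn
  have ht₀T : t₀ ≤ T := by
    by_contra! hlt
    linarith [S.psi_neg_of_ge hp hf hMC hw hT hneg hlt.le]
  have h1 : 0 < S.psi f (t • w) := hpos.trans_le (hmax ⟨ht₀.le, ht₀T⟩)
  refine ⟨t, ?_, h1, fun s hs => ?_⟩
  · rcases ht.1.eq_or_lt with h2 | h2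
    · rw [← h2, zero_smul, psi, S.minCost_zero hMC, np, S.posQuad.map_zero] at h1
      simp at h1
    · exact h2
  · rcases le_total s T with h2 | h2
    · exact hmax ⟨hs, h2⟩
    · linarith [S.psi_neg_of_ge hp hf hMC hw hT hneg h2]

include hp hf hMC in
theorem tendsto_pot_zero {v : ℕ → Lp ℝ 2 m} (hv : ∀ n, v n ∈ S.space)
    (h : Tendsto (fun n => eLpNorm (v n) (ENNReal.ofReal p) m) atTop (𝓝 0)) :
    Tendsto (fun n => S.pot f (v n)) atTop (𝓝 0) := by
  obtain ⟨C, hC, hup⟩ := hMC.primitive_le hf hp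
  obtain ⟨d, hd⟩ := S.le_smul
  have hp1 : (1 : ℝ≥0∞) ≤ ENNReal.ofReal p := by
    rw [show (1 : ℝ≥0∞) = ENNReal.ofReal 1 by simp]
    exact ENNReal.ofReal_le_ofReal (by linarith)
  have hp0 : ENNReal.ofReal p ≠ 0 := by simp; linarith
  have hν : Tendsto (fun n => eLpNorm (v n) (ENNReal.ofReal p) ν) atTop (𝓝 0) := by
    have h1 : Tendsto (fun n => ((d : ℝ≥0∞) ^ (1 / (ENNReal.ofReal p).toReal)) *
        eLpNorm (v n) (ENNReal.ofReal p) m) atTop (𝓝 0) := by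
      have := ENNReal.Tendsto.const_mul (a := (d : ℝ≥0∞) ^ (1 / (ENNReal.ofReal p).toReal)) h
        (Or.inr (ENNReal.rpow_ne_top_of_nonneg (by positivity) ENNReal.coe_ne_top))
      simpa using this
    refine tendsto_of_tendsto_of_tendsto_of_le_of_le tendsto_const_nhds h1
      (fun _ => zero_le) fun n => ?_
    refine (eLpNorm_mono_measure _ hd).trans (le_of_eq ?_)
    have : d • m = (d : ℝ≥0∞) • m := rfl
    rw [this, eLpNorm_smul_measure_of_ne_top ENNReal.ofReal_ne_top]
    simp
  have hν1 : Tendsto (fun n => eLpNorm (v n) 1 ν) atTop (𝓝 0) := by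
    set c : ℝ≥0∞ := ν Set.univ ^ (1 / (1 : ℝ≥0∞).toReal - 1 / (ENNReal.ofReal p).toReal)
    have hcfin : c ≠ ∞ := by
      refine (ENNReal.rpow_lt_top_of_nonneg ?_ (measure_ne_top ν _)).ne
      rw [ENNReal.toReal_ofReal (by linarith)]
      simp only [ENNReal.toReal_one, sub_nonneg]
      gcongr
      linarith
    have h1 : Tendsto (fun n => eLpNorm (v n) (ENNReal.ofReal p) ν * c) atTop (𝓝 0) := by
      simpa using ENNReal.Tendsto.mul_const (b := c) hν (Or.inr hcfin)
    exact tendsto_of_tendsto_of_tendsto_of_le_of_le tendsto_const_nhds h1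
      (fun _ => zero_le) fun n =>
        eLpNorm_le_eLpNorm_mul_rpow_measure_univ hp1 (S.aestronglyMeasurable _)
  have hr : Tendsto (fun n => C * ((eLpNorm (v n) 1 ν).toReal
      + (eLpNorm (v n) (ENNReal.ofReal p) ν).toReal ^ p)) atTop (𝓝 0) := by
    have h1 := (ENNReal.tendsto_toReal (by simp : (0 : ℝ≥0∞) ≠ ∞)).comp hν1
    have h2 := (ENNReal.tendsto_toReal (by simp : (0 : ℝ≥0∞) ≠ ∞)).comp hν
    have h3 := (h1.add (h2.rpow_const (p := p) (Or.inr (by linarith)))).const_mul C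
    simp only [ENNReal.toReal_zero, Real.zero_rpow (by linarith : p ≠ 0), add_zero,
      mul_zero] at h3
    exact h3
  refine squeeze_zero (fun n => S.pot_nonneg hMC _) (fun n => ?_) hr
  have hi1 := (S.integrable (v n)).abs
  have hi2 := integrable_abs_rpow hp (hv n).2.2
  have h1 : S.pot f (v n) ≤ ∫ z, C * (|v n z| + |v n z| ^ p) ∂ν :=
    integral_mono (integrable_primitive hp hf hMC (hv n).2.2) ((hi1.add hi2).const_mul C)
      fun z => hup _
  rw [integral_const_mul, integral_add hi1 hi2] at h1
  refine h1.trans (le_of_eq ?_)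
  congr 2
  · rw [eLpNorm_one_eq_lintegral_enorm, ← integral_norm_eq_lintegral_enorm
      (S.aestronglyMeasurable _)]
    rfl
  · rw [(hv n).2.2.eLpNorm_eq_integral_rpow_norm hp0 ENNReal.ofReal_ne_top,
      ENNReal.toReal_ofReal (by positivity), ENNReal.toReal_ofReal (by linarith),
      ← Real.rpow_mul (integral_nonneg fun _ => by positivity),
      inv_mul_cancel₀ (by linarith), Real.rpow_one]
    rfl

include hp hf hMC in
-- Upper semicontinuity without convergence in the form norm. Write v = (1−ε)·(1−ε)⁻¹w + ε·ε⁻¹(v−w).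
-- Convexity leaves the minimal cost of ε⁻¹(v−w), which is at most its potential and tends to 0 for
-- fixed ε, because a positive element carries no negative form.
theorem eventually_minCost_le {w : Lp ℝ 2 m} {v : ℕ → Lp ℝ 2 m} (hw : w ∈ S.posSpace)
    (hv : ∀ n, v n ∈ S.posSpace)
    (h : Tendsto (fun n => eLpNorm (v n - w : Lp ℝ 2 m) (ENNReal.ofReal p) m) atTop (𝓝 0))
    {δ : ℝ} (hδ : 0 < δ) : ∀ᶠ n in atTop, S.minCost f (v n) ≤ S.minCost f w + δ := by
  have h1 : Tendsto (fun ε : ℝ => S.minCost f ((1 - ε)⁻¹ • w)) (𝓝[>] 0)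
      (𝓝 (S.minCost f w)) := by
    have h2 : Tendsto (fun ε : ℝ => (1 - ε)⁻¹) (𝓝[>] 0) (𝓝 1) := by
      have : ContinuousAt (fun ε : ℝ => (1 - ε)⁻¹) 0 := by
        apply ContinuousAt.inv₀ (by fun_prop)
        norm_num
      simpa [ContinuousAt] using this.tendsto.mono_left nhdsWithin_le_nhds
    simpa [Function.comp_def] using ((S.continuous_minCost_ray hp hf hMC hw).tendsto 1).comp h2
  have hev : ∀ᶠ ε : ℝ in 𝓝[>] 0, S.minCost f ((1 - ε)⁻¹ • w) < S.minCost f w + δ / 2 :=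
    h1.eventually (gt_mem_nhds (by linarith))
  obtain ⟨ε, hε1, hε0, hε2⟩ := (hev.and (Ioo_mem_nhdsGT one_pos)).exists
  have hmem : ∀ n, ε⁻¹ • (v n - w) ∈ S.posSpace := fun n =>
    S.posSpace.smul_mem _ (S.posSpace.sub_mem (hv n) hw)
  have h3 : Tendsto (fun n => S.pot f (ε⁻¹ • (v n - w))) atTop (𝓝 0) := by
    refine S.tendsto_pot_zero hp hf hMC (fun n => (hmem n).1) ?_
    have h4 := ENNReal.Tendsto.const_mul (a := ‖ε⁻¹‖ₑ) h (Or.inr (by simp))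
    rw [mul_zero] at h4
    refine h4.congr fun n => ?_
    rw [← eLpNorm_const_smul]
    exact eLpNorm_congr_ae (Lp.coeFn_smul _ _).symm
  filter_upwards [h3.eventually (gt_mem_nhds (half_pos hδ))] with n hn
  have h5 := S.minCost_convex hp hf hMC (S.posSpace.smul_mem (1 - ε)⁻¹ hw) (hmem n)
    (sub_nonneg.2 hε2.le) hε0.le (by ring)
  rw [smul_inv_smul₀ (by linarith), smul_inv_smul₀ hε0.ne', add_sub_cancel] at h5
  have h6 := S.minCost_le_pot hMC (hmem n)
  have h7 := S.minCost_nonneg hMC ((1 - ε)⁻¹ • w)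
  have h8 := S.pot_nonneg hMC (ε⁻¹ • (v n - w))
  nlinarith

theorem rayMax_smul_le (w : Lp ℝ 2 m) {c : ℝ} (hc : 0 ≤ c) :
    S.rayMax f (c • w) ≤ S.rayMax f w := by
  refine iSup_le fun t => ?_
  rw [smul_smul]
  exact S.ofReal_psi_le_rayMax w (mul_nonneg t.2 hc)

include hp in
theorem eq_zero_of_np {w : Lp ℝ 2 m} (hw : w ∈ S.posSpace) (h : S.np w = 0) : w = 0 := by
  obtain ⟨C, hC, h1⟩ := norm_sq_le_of_compact hp S.posQuad S.posProj S.pos_compact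
  have h2 := h1 w hw.1.1
  change _ ≤ C * S.np w at h2
  rw [h, hw.2, mul_zero] at h2
  exact norm_eq_zero.1 (pow_eq_zero_iff (two_ne_zero) |>.1 (le_antisymm h2 (sq_nonneg _)))

include hp hf hMC in
/-- The minimax level is attained. -/
theorem exists_minimax {w₀ : Lp ℝ 2 m} (hw₀ : w₀ ∈ S.posSpace) (hnp₀ : 0 < S.np w₀)
    (hfin₀ : S.rayMax f w₀ < ∞) :
    ∃ w ∈ S.posSpace, 0 < S.np w ∧ S.rayMax f w < ∞ ∧
      ∀ v ∈ S.posSpace, 0 < S.np v → S.rayMax f w ≤ S.rayMax f v := by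
  set X : Set (Lp ℝ 2 m) := {w | w ∈ S.posSpace ∧ S.np w = 1} with hX
  have hnorm : ∀ v ∈ S.posSpace, 0 < S.np v → ∃ v' ∈ X, S.rayMax f v' ≤ S.rayMax f v := by
    intro v hv h
    refine ⟨(Real.sqrt (S.np v))⁻¹ • v, ⟨S.posSpace.smul_mem _ hv, ?_⟩,
      S.rayMax_smul_le v (by positivity)⟩
    rw [S.np_smul hv.1, inv_pow, Real.sq_sqrt h.le, inv_mul_cancel₀ h.ne']
  obtain ⟨w₁, hw₁, hle₁⟩ := hnorm w₀ hw₀ hnp₀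
  set I := sInf (S.rayMax f '' X) with hI
  have hIfin : I < ∞ := lt_of_le_of_lt (sInf_le ⟨w₁, hw₁, rfl⟩) (hle₁.trans_lt hfin₀)
  obtain ⟨y, -, hylim, hymem⟩ := exists_seq_tendsto_sInf
    (⟨_, w₁, hw₁, rfl⟩ : (S.rayMax f '' X).Nonempty) (OrderBot.bddBelow _)
  choose u hu huy using hymem
  have huE : ∀ n, S.posForm (u n) ≤ ENNReal.ofReal 1 := fun n => by
    rw [← (hu n).2, np, ENNReal.ofReal_toReal (hu n).1.1.1.ne]
  obtain ⟨g, σ, hg, hσ, hlim⟩ := S.pos_compact u 1 huE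
  have hp2 : (2 : ℝ≥0∞) ≤ ENNReal.ofReal p := by
    rw [show (2 : ℝ≥0∞) = ENNReal.ofReal 2 by simp]
    exact ENNReal.ofReal_le_ofReal hp.le
  have hg2 : MemLp g 2 m := hg.mono_exponent hp2
  set w : Lp ℝ 2 m := hg2.toLp g with hwdef
  have hdiff : ∀ n, ⇑(u (σ n) - w) =ᵐ[m] fun z => S.posProj (u (σ n)) z - g z := by
    intro n
    rw [(hu (σ n)).1.2]
    filter_upwards [Lp.coeFn_sub (u (σ n)) w, hg2.coeFn_toLp] with z h1 h2
    rw [h1, Pi.sub_apply, h2]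
  have hlim' : Tendsto (fun n => eLpNorm (u (σ n) - w : Lp ℝ 2 m) (ENNReal.ofReal p) m) atTop
      (𝓝 0) := hlim.congr fun n => (eLpNorm_congr_ae (hdiff n)).symm
  have hconv : Tendsto (fun n => u (σ n)) atTop (𝓝 w) := by
    rw [Lp.tendsto_Lp_iff_tendsto_eLpNorm']
    set c : ℝ≥0∞ := m Set.univ ^ (1 / (2 : ℝ≥0∞).toReal - 1 / (ENNReal.ofReal p).toReal)
    have hcfin : c ≠ ∞ := by
      refine (ENNReal.rpow_lt_top_of_nonneg ?_ (measure_ne_top m _)).ne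
      rw [ENNReal.toReal_ofReal (by linarith)]
      simp only [ENNReal.toReal_ofNat, sub_nonneg]
      gcongr
    have h1 := ENNReal.Tendsto.mul_const (b := c) hlim' (Or.inr hcfin)
    rw [zero_mul] at h1
    refine tendsto_of_tendsto_of_tendsto_of_le_of_le tendsto_const_nhds h1
      (fun _ => zero_le) fun n => ?_
    rw [← eLpNorm_congr_ae (Lp.coeFn_sub (u (σ n)) w)]
    exact eLpNorm_le_eLpNorm_mul_rpow_measure_univ hp2 (Lp.aestronglyMeasurable _)
  have hwpos : S.posProj w = w := by
    refine tendsto_nhds_unique ((S.posProj.continuous.tendsto w).comp hconv) ?_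
    simpa [Function.comp_def, fun n => (hu (σ n)).1.2] using hconv
  have hwform : S.posForm w ≤ ENNReal.ofReal 1 :=
    (lowerSemicontinuous_iff_isClosed_preimage.1 S.posQuad.lsc _).mem_of_tendsto hconv
      (Eventually.of_forall fun n => huE (σ n))
  have hw : w ∈ S.posSpace := by
    have := S.posProj_mem_posSpace (hwform.trans_lt ENNReal.ofReal_lt_top)
    rwa [hwpos] at this
  have hnp1 : S.np w ≤ 1 := ENNReal.toReal_le_of_le_ofReal one_pos.le hwform
  -- The quadratic term comes from the normalized sequence, not from w, whose form may have dropped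
  -- below 1. This stronger bound is what excludes w = 0 below.
  have hbound : ∀ t : NNReal, ENNReal.ofReal ((t : ℝ) ^ 2 / 2 - S.minCost f ((t : ℝ) • w)) ≤ I := by
    intro t
    have h1 : Tendsto (fun n => S.rayMax f (u (σ n))) atTop (𝓝 I) := by
      simp only [huy]
      exact hylim.comp hσ.tendsto_atTop
    have h2 : ∀ δ > 0, ENNReal.ofReal ((t : ℝ) ^ 2 / 2 - S.minCost f ((t : ℝ) • w) - δ) ≤ I := by
      intro δ hδ
      refine ge_of_tendsto h1 ?_
      have h3 : Tendsto (fun n => eLpNorm ((t : ℝ) • u (σ n) - (t : ℝ) • w : Lp ℝ 2 m)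
          (ENNReal.ofReal p) m) atTop (𝓝 0) := by
        have h4 := ENNReal.Tendsto.const_mul (a := ‖(t : ℝ)‖ₑ) hlim' (Or.inr (by simp))
        rw [mul_zero] at h4
        refine h4.congr fun n => ?_
        rw [← eLpNorm_const_smul, ← smul_sub]
        exact eLpNorm_congr_ae (Lp.coeFn_smul _ _).symm
      filter_upwards [S.eventually_minCost_le hp hf hMC (S.posSpace.smul_mem (t : ℝ) hw)
        (fun n => S.posSpace.smul_mem (t : ℝ) (hu (σ n)).1) h3 hδ] with n hn
      refine le_trans (ENNReal.ofReal_le_ofReal ?_) (S.ofReal_psi_le_rayMax (u (σ n)) t.2)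
      rw [psi, S.np_smul (hu (σ n)).1.1, (hu (σ n)).2]
      simp only [NNReal.val_eq_coe]
      linarith
    have h5 : Tendsto (fun δ : ℝ =>
        ENNReal.ofReal ((t : ℝ) ^ 2 / 2 - S.minCost f ((t : ℝ) • w) - δ)) (𝓝[>] 0)
        (𝓝 (ENNReal.ofReal ((t : ℝ) ^ 2 / 2 - S.minCost f ((t : ℝ) • w)))) := by
      have hc : Continuous fun δ : ℝ =>
        ENNReal.ofReal ((t : ℝ) ^ 2 / 2 - S.minCost f ((t : ℝ) • w) - δ) :=
        ENNReal.continuous_ofReal.comp (by fun_prop)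
      simpa using (hc.tendsto 0).mono_left nhdsWithin_le_nhds
    exact le_of_tendsto h5 (by filter_upwards [self_mem_nhdsWithin] with δ hδ using h2 δ hδ)
  have hwI : S.rayMax f w ≤ I := by
    refine iSup_le fun t => (ENNReal.ofReal_le_ofReal ?_).trans (hbound t)
    rw [psi, S.np_smul hw.1]
    nlinarith [sq_nonneg (t : ℝ)]
  refine ⟨w, hw, ?_, hwI.trans_lt hIfin, fun v hv h => ?_⟩
  -- If w = 0, then `hbound` reads t²/2 ≤ I for every t, and t = r + 1 gives r ≤ I for every r.
  · refine lt_of_le_of_ne (S.np_nonneg w) fun h => ?_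
    have hw0 := S.eq_zero_of_np hp hw h.symm
    refine hIfin.ne (ENNReal.eq_top_of_forall_nnreal_le fun r => ?_)
    have h1 := hbound (r + 1)
    rw [show ((r + 1 : NNReal) : ℝ) • w = 0 by rw [hw0, smul_zero]] at h1
    rw [S.minCost_zero hMC, sub_zero] at h1
    refine le_trans ?_ h1
    rw [← ENNReal.ofReal_coe_nnreal]
    refine ENNReal.ofReal_le_ofReal ?_
    push_cast
    nlinarith [r.2, sq_nonneg (r : ℝ)]
  · obtain ⟨v', hv', hle⟩ := hnorm v hv h
    exact hwI.trans ((sInf_le (Set.mem_image_of_mem _ hv')).trans hle)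

end IndefiniteForm

/-! ### Weak solutions, criticality of the minimax point, and least energy. -/

namespace IndefiniteForm

variable {Ω : Type*} [MeasurableSpace Ω] {m ν : Measure Ω} [IsFiniteMeasure m]
  [IsFiniteMeasure ν] {p : ℝ} (S : IndefiniteForm m ν p) (f : ℝ → ℝ)

/-- Weak solutions of the equation associated with the indefinite form and the nonlinearity `f`. -/
def IsWeak (u : Lp ℝ 2 m) : Prop :=
  u ∈ S.space ∧ ∀ v ∈ S.space, S.posInner u v - S.negInner u v = ∫ z, f (u z) * v z ∂ν

variable {f} (hp : 2 < p) (hf : Continuous f) (hMC : MonotonicityCondition p f)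

theorem np_congr {u v : Lp ℝ 2 m} (h : S.posProj u = S.posProj v) : S.np u = S.np v := by
  rw [← S.np_proj, h, S.np_proj]

theorem nm_congr {u v : Lp ℝ 2 m} (h : S.negProj u = S.negProj v) : S.nm u = S.nm v := by
  rw [← S.nm_proj, h, S.nm_proj]

/-- The polar form is recovered from the quadratic form by polarization, and the latter sees only
the positive projection. -/
theorem posInner_congr {u v u' v' : Lp ℝ 2 m} (hu : S.posForm u < ∞) (hv : S.posForm v < ∞)
    (hu' : S.posProj u = S.posProj u') (hv' : S.posProj v = S.posProj v') :
    S.posInner u v = S.posInner u' v' := by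
  have h1 := S.posQuad.expand hu hv 1 1
  have h2 := S.posQuad.expand (u := u') (v := v') (by rwa [← S.posForm_proj, ← hu', S.posForm_proj])
    (by rwa [← S.posForm_proj, ← hv', S.posForm_proj]) 1 1
  have e1 := S.np_congr hu'
  have e2 := S.np_congr hv'
  have e3 := S.np_congr (u := (1 : ℝ) • u + (1 : ℝ) • v) (v := (1 : ℝ) • u' + (1 : ℝ) • v')
    (by simp [hu', hv'])
  simp only [np] at e1 e2 e3
  linarith

theorem negInner_congr {u v u' v' : Lp ℝ 2 m} (hu : S.negForm u < ∞) (hv : S.negForm v < ∞)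
    (hu' : S.negProj u = S.negProj u') (hv' : S.negProj v = S.negProj v') :
    S.negInner u v = S.negInner u' v' := by
  have h1 := S.negQuad.expand hu hv 1 1
  have h2 := S.negQuad.expand (u := u') (v := v') (by rwa [← S.negForm_proj, ← hu', S.negForm_proj])
    (by rwa [← S.negForm_proj, ← hv', S.negForm_proj]) 1 1
  have e1 := S.nm_congr hu'
  have e2 := S.nm_congr hv'
  have e3 := S.nm_congr (u := (1 : ℝ) • u + (1 : ℝ) • v) (v := (1 : ℝ) • u' + (1 : ℝ) • v')
    (by simp [hu', hv'])
  simp only [nm] at e1 e2 e3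
  linarith

theorem posInner_eq_zero {u v : Lp ℝ 2 m} (hu : S.posForm u < ∞) (hv : S.posForm v < ∞)
    (h : S.posProj v = 0) : S.posInner u v = 0 := by
  have h1 := S.posQuad.sq_inner_le hu hv
  rw [S.posForm_eq_zero h, ENNReal.toReal_zero, mul_zero] at h1
  exact pow_eq_zero_iff (two_ne_zero) |>.1 (le_antisymm h1 (sq_nonneg _))

include hp hf hMC in
/-- A critical point maximizes the energy on its half space. -/
theorem phi_le_of_critical {u y : Lp ℝ 2 m} (hu : u ∈ S.space) (hy : y ∈ S.space)
    (h1 : S.np u - S.nm u = ∫ z, f (u z) * u z ∂ν)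
    (h2 : ∀ v ∈ S.space, S.posProj v = 0 → -S.negInner u v = ∫ z, f (u z) * v z ∂ν)
    {τ : ℝ} (hτ : 0 ≤ τ) (hproj : S.posProj y = τ • S.posProj u) :
    S.phi f y ≤ S.phi f u ∧ (S.phi f y = S.phi f u →
      S.nm (y - τ • u) = 0 ∧ y =ᵐ[ν] u) := by
  set v := y - τ • u with hv
  have hvs : v ∈ S.space := S.space.sub_mem hy (S.space.smul_mem τ hu)
  have hv0 : S.posProj v = 0 := by rw [hv, map_sub, map_smul, hproj, sub_self]
  have hy' : y = τ • u + (1 : ℝ) • v := by rw [hv, one_smul]; abel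
  have e1 : S.np y = τ ^ 2 * S.np u := by
    rw [← S.np_proj, hproj, ← map_smul, S.np_proj, S.np_smul hu]
  have e2 : S.nm y = τ ^ 2 * S.nm u + 2 * τ * S.negInner u v + S.nm v := by
    have := S.negQuad.expand hu.2.1 hvs.2.1 τ 1
    rw [← hy'] at this
    simp only [nm]
    linarith
  have hi1 := integrable_mul hp hf hMC hu.2.2 hu.2.2
  have hi2 := integrable_mul hp hf hMC hu.2.2 hvs.2.2
  have hi3 := integrable_primitive hp hf hMC hu.2.2
  have hi4 := integrable_primitive hp hf hMC hy.2.2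
  -- D is the gap in `primitive_ge`, rewritten through y = τu + v so that criticality evaluates its
  -- integral. This gives Φ(y) − Φ(u) = −½‖v⁻‖₋² − ∫D dν.
  set D : Ω → ℝ := fun z => primitive f (y z) - primitive f (u z)
    - ((τ ^ 2 - 1) / 2 * (f (u z) * u z) + τ * (f (u z) * v z)) with hD
  have hDi : Integrable D ν := (hi4.sub hi3).sub ((hi1.const_mul _).add (hi2.const_mul _))
  have hDint : ∫ z, D z ∂ν = S.pot f y - S.pot f u
      - ((τ ^ 2 - 1) / 2 * (S.np u - S.nm u) + τ * (-S.negInner u v)) := by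
    rw [h1, h2 v hvs hv0, ← integral_const_mul, ← integral_const_mul,
      ← integral_add (hi1.const_mul _) (hi2.const_mul _), pot, pot, ← integral_sub hi4 hi3]
    exact integral_sub (hi4.sub hi3) ((hi1.const_mul _).add (hi2.const_mul _))
  have hae : ∀ᵐ z ∂ν, D z = primitive f (y z)
      - (primitive f (u z) + f (u z) * (τ * y z - (1 + τ ^ 2) / 2 * u z)) := by
    have := S.coeFn_lincomb u v τ 1
    rw [← hy'] at this
    filter_upwards [this] with z hz
    rw [hD]
    dsimp only
    rw [hz]
    ring
  have hDnn : 0 ≤ᵐ[ν] D := by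
    filter_upwards [hae] with z hz
    rw [hz]
    exact sub_nonneg.2 (hMC.primitive_ge hf (u z) (y z) hτ)
  have hI0 : 0 ≤ ∫ z, D z ∂ν := integral_nonneg_of_ae hDnn
  have hnv := S.nm_nonneg v
  have key : S.phi f y - S.phi f u = -(S.nm v / 2) - ∫ z, D z ∂ν := by
    rw [hDint, phi, phi, cost, cost, e1, e2]
    ring
  refine ⟨by linarith, fun heq => ⟨by linarith, ?_⟩⟩
  have hz := (integral_eq_zero_iff_of_nonneg_ae hDnn hDi).1 (by linarith)
  filter_upwards [hz, hae] with z h3 h4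
  by_contra hne
  have := hMC.primitive_gt hf hτ hne
  rw [h3] at h4
  simp only [Pi.zero_apply] at h4
  linarith

include hp hf hMC in
theorem hasDerivAt_pot {u v : Lp ℝ 2 m} (hu : u ∈ S.space) (hv : v ∈ S.space) :
    HasDerivAt (fun s : ℝ => S.pot f (u + s • v)) (∫ z, f (u z) * v z ∂ν) 0 := by
  have h := hasDerivAt_integral_primitive hp hf hMC hu.2.2 hv.2.2
  have e : (fun s : ℝ => S.pot f (u + s • v))
      = fun s : ℝ => ∫ z, primitive f (u z + s * v z) ∂ν := by
    ext s
    have := S.pot_lincomb (f := f) (u := u) (v := v) 1 s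
    simpa using this
  rwa [e]

include hp hf hMC in
theorem critical_of_minimizer {u : Lp ℝ 2 m} (hu : u ∈ S.space)
    (hmin : ∀ v ∈ S.space, S.posProj v = S.posProj u → S.cost f u ≤ S.cost f v)
    {v : Lp ℝ 2 m} (hv : v ∈ S.space) (hv0 : S.posProj v = 0) :
    -S.negInner u v = ∫ z, f (u z) * v z ∂ν := by
  have h1 : ∀ s : ℝ, S.cost f (u + s • v)
      = (S.nm u + 2 * s * S.negInner u v + s ^ 2 * S.nm v) / 2 + S.pot f (u + s • v) := by
    intro s
    rw [cost, nm, S.negQuad.toReal_add_smul hu.2.1 hv.2.1]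
    rfl
  have h2 : HasDerivAt (fun s : ℝ => S.cost f (u + s • v))
      (S.negInner u v + ∫ z, f (u z) * v z ∂ν) 0 := by
    simp only [h1]
    refine HasDerivAt.add ?_ (S.hasDerivAt_pot hp hf hMC hu hv)
    have := ((((hasDerivAt_id (0 : ℝ)).const_mul 2).mul_const (S.negInner u v)).const_add
      (S.nm u)).add (((hasDerivAt_id (0 : ℝ)).pow 2).mul_const (S.nm v))
    refine (this.div_const 2).congr_deriv ?_
    simp
  have h3 : IsLocalMin (fun s : ℝ => S.cost f (u + s • v)) 0 := by
    refine Eventually.of_forall fun s => ?_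
    simp only [zero_smul, add_zero]
    exact hmin _ (S.space.add_mem hu (S.space.smul_mem s hv)) (by simp [hv0])
  have := h3.hasDerivAt_eq_zero h2
  linarith

include hp hf hMC in
-- Along the ray through u the energy lies below ψ and touches it at u. A maximum of ψ is therefore
-- a maximum of Φ on that ray, and only Φ has to be differentiated.
theorem critical_of_ray_max {u : Lp ℝ 2 m} (hu : u ∈ S.space)
    (hcost : S.cost f u = S.minCost f (S.posProj u))
    (hmax : ∀ t : ℝ, 0 ≤ t → S.psi f (t • S.posProj u) ≤ S.psi f (S.posProj u)) :
    S.np u - S.nm u = ∫ z, f (u z) * u z ∂ν := by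
  have h1 : ∀ s : ℝ, S.phi f (u + s • u)
      = (1 + s) ^ 2 * (S.np u / 2 - S.nm u / 2) - S.pot f (u + s • u) := by
    intro s
    have e : u + s • u = (1 + s) • u := by rw [add_smul, one_smul]
    rw [phi, cost, e, S.np_smul hu, nm, S.negQuad.toReal_smul hu.2.1, ← nm]
    ring
  have h2 : HasDerivAt (fun s : ℝ => S.phi f (u + s • u))
      ((S.np u - S.nm u) - ∫ z, f (u z) * u z ∂ν) 0 := by
    simp only [h1]
    refine HasDerivAt.sub ?_ (S.hasDerivAt_pot hp hf hMC hu hu)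
    have := (((hasDerivAt_id (0 : ℝ)).const_add 1).pow 2).mul_const (S.np u / 2 - S.nm u / 2)
    refine this.congr_deriv ?_
    simp
    ring
  have h3 : IsLocalMax (fun s : ℝ => S.phi f (u + s • u)) 0 := by
    have : ∀ᶠ s : ℝ in 𝓝 0, -1 < s := lt_mem_nhds (by norm_num)
    filter_upwards [this] with s hs
    simp only [zero_smul, add_zero]
    have e : u + s • u = (1 + s) • u := by rw [add_smul, one_smul]
    have h4 := S.phi_le_psi hMC (S.space.smul_mem (1 + s) hu)
    rw [map_smul] at h4
    rw [e]
    refine h4.trans ((hmax _ (by linarith)).trans (le_of_eq ?_))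
    rw [psi, phi, hcost, S.np_proj]
  have := h3.hasDerivAt_eq_zero h2
  linarith

include hp hf hMC in
-- One inequality suffices, as −φ is also admissible. The planar minimax principle, applied to
-- `minCost` in the plane of u⁺ and φ, bounds its backward difference quotients at u⁺. These
-- dominate the ones of the potential at u, because u − εφ lies over u⁺ − εφ and has the same
-- negative part as u. Then ε → 0.
theorem critical_pos {u φ : Lp ℝ 2 m} (hu : u ∈ S.space) (hφ : φ ∈ S.posSpace)
    (hcost : S.cost f u = S.minCost f (S.posProj u)) (hnp : 0 < S.np u)
    (hpos : 0 < S.psi f (S.posProj u))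
    (hmax : ∀ t : ℝ, 0 ≤ t → S.psi f (t • S.posProj u) ≤ S.psi f (S.posProj u))
    (hfin : S.rayMax f (S.posProj u) < ∞)
    (hmin : ∀ v ∈ S.posSpace, 0 < S.np v → S.rayMax f (S.posProj u) ≤ S.rayMax f v) :
    ∫ z, f (u z) * φ z ∂ν ≤ S.posInner u φ := by
  set w := S.posProj u with hwdef
  have hw : w ∈ S.posSpace := S.posProj_mem_posSpace hu.1
  have hnpw : S.np w = S.np u := S.np_proj u
  have hb : S.posInner w φ = S.posInner u φ :=
    S.posInner_congr hw.1.1 hφ.1.1 (S.pos_pos u) rfl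
  have hphi : S.phi f u = S.psi f w := by rw [psi, phi, hcost, S.np_proj]
  have hcrit1 := S.critical_of_ray_max hp hf hMC hu hcost hmax
  have hcrit2 := fun (v : Lp ℝ 2 m) (hv : v ∈ S.space) (hv0 : S.posProj v = 0) =>
    S.critical_of_minimizer hp hf hMC hu (fun v hv h => by
      rw [hcost, hwdef, ← h]
      exact S.minCost_le hMC hv) hv hv0
  have hlin : ∀ x y : ℝ, x • w + y • φ ∈ S.posSpace := fun x y =>
    S.posSpace.add_mem (S.posSpace.smul_mem x hw) (S.posSpace.smul_mem y hφ)
  have hnplin : ∀ x y : ℝ, S.np (x • w + y • φ)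
      = S.np w * x ^ 2 + 2 * S.posInner w φ * x * y + S.np φ * y ^ 2 := by
    intro x y
    rw [np, S.posQuad.expand hw.1.1 hφ.1.1]
    simp only [np]
    ring
  have hslope : ∀ ε : ℝ, 0 < ε →
      (S.minCost f w - S.minCost f (w - ε • φ)) / ε ≤ S.posInner w φ := by
    intro ε hε
    -- For small s the perturbed direction is nonzero, hence a competitor for the minimax level.
    have hs₀ : ∃ s₀ : ℝ, 0 < s₀ ∧ ∀ s : ℝ, 0 < s → s < s₀ → 0 < S.np (w + s • φ) := by
      have hc : Continuous fun s : ℝ => S.np w * 1 ^ 2 + 2 * S.posInner w φ * 1 * s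
          + S.np φ * s ^ 2 := by fun_prop
      have h0 : ∀ᶠ s : ℝ in 𝓝 0, 0 < S.np w * 1 ^ 2 + 2 * S.posInner w φ * 1 * s
          + S.np φ * s ^ 2 := (hc.tendsto 0).eventually (lt_mem_nhds (by simpa [hnpw] using hnp))
      obtain ⟨s₀, hs₀, h⟩ := Metric.eventually_nhds_iff.1 h0
      refine ⟨s₀, hs₀, fun s h1 h2 => ?_⟩
      have := h (y := s) (by rwa [Real.dist_0_eq_abs, abs_of_pos h1])
      rw [← hnplin, one_smul] at this
      exact this
    obtain ⟨s₀, hs₀, hs₀'⟩ := hs₀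
    obtain ⟨T, hT, hTneg⟩ := S.exists_psi_neg hp hf hMC hw (hnpw ▸ hnp) hfin
    have := slope_le_of_minimax (k := fun x : ℝ × ℝ => S.minCost f (x.1 • w + x.2 • φ))
      (h := fun x : ℝ × ℝ => S.psi f (x.1 • w + x.2 • φ)) (a := S.np w) (b := S.posInner w φ)
      (d := S.np φ) (S.convexOn_minCost_plane hp hf hMC hw hφ) ?_ ?_ ?_ ?_ ?_ ?_ hs₀ ?_ hε
    · simpa [sub_eq_add_neg] using this
    · intro t ht z
      have h := S.minCost_smul_ge hp hf hMC (hlin z.1 z.2) ht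
      simp only [Prod.smul_fst, Prod.smul_snd, smul_eq_mul]
      rwa [smul_add, smul_smul, smul_smul] at h
    · intro x y
      simp only [psi]
      rw [hnplin]
    · intro t ht
      simpa using hmax t ht
    -- Uniqueness of the maximum on the ray: the equality case gives y = u ν-a.e. and forms scaled
    -- by t². With equal potentials and energies, (t²−1)(‖u⁺‖₊² − ‖u⁻‖₋²) = 0, and the second factor
    -- equals 2Φ(u) plus twice the potential, which is positive.
    · intro t ht heq
      simp only [one_smul, zero_smul, add_zero] at heq
      obtain ⟨y, hy1, hy2, hy3⟩ := S.exists_minimizer hp hf hMC (S.posSpace.smul_mem t hw)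
      have hphiy : S.phi f y = S.psi f (t • w) := by
        rw [psi, phi, hy3, S.np_eq_of_posProj hy2]
      obtain ⟨h3, h4⟩ := (S.phi_le_of_critical hp hf hMC hu hy1 hcrit1 hcrit2 ht hy2).2
        (by rw [hphiy, heq, hphi])
      have hvs : y - t • u ∈ S.space := S.space.sub_mem hy1 (S.space.smul_mem t hu)
      have h5 : S.negInner u (y - t • u) = 0 := by
        have h := S.negQuad.sq_inner_le hu.2.1 hvs.2.1
        change _ ≤ _ * S.nm (y - t • u) at h
        rw [h3, mul_zero] at h
        exact pow_eq_zero_iff (two_ne_zero) |>.1 (le_antisymm h (sq_nonneg _))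
      have h6 : S.nm y = t ^ 2 * S.nm u := by
        have h := S.negQuad.expand hu.2.1 hvs.2.1 t 1
        rw [one_smul, add_sub_cancel, h5] at h
        change S.nm y = _ * S.nm u + _ + _ * S.nm (y - t • u) at h
        rw [h3] at h
        linarith
      have h7 : S.np y = t ^ 2 * S.np u := by
        rw [S.np_eq_of_posProj hy2, S.np_smul hw.1, hnpw]
      have h8 : S.pot f y = S.pot f u := by
        refine integral_congr_ae ?_
        filter_upwards [h4] with z hz
        rw [hz]
      have h9 : S.phi f y = S.phi f u := by rw [hphiy, heq, hphi]
      have h10 := S.pot_nonneg hMC u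
      rw [← hphi] at hpos
      have h11 : S.phi f u = (S.np u - S.nm u) / 2 - S.pot f u := by rw [phi, cost]; ring
      have h12 : S.phi f y = t ^ 2 * ((S.np u - S.nm u) / 2) - S.pot f u := by
        rw [phi, cost, h6, h7, h8]; ring
      have h13 : (t - 1) * ((t + 1) * ((S.np u - S.nm u) / 2)) = 0 := by nlinarith
      rcases mul_eq_zero.1 h13 with h14 | h14
      · linarith
      · have : 0 < (t + 1) * ((S.np u - S.nm u) / 2) := by
          refine mul_pos (by linarith) ?_
          linarith
        linarith
    · simpa using hpos
    · exact ⟨T, hT, by simpa using hTneg⟩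
    -- Minimality of the level at w gives rayMax(w + sφ) ≥ rayMax(w) ≥ ψ(w) > ψ(w) − η, so some
    -- point of the perturbed ray exceeds ψ(w) − η.
    · intro s hs1 hs2 η hη
      have h1 := hmin (w + s • φ) (by simpa using hlin 1 s) (hs₀' s hs1 hs2)
      have h2 : ENNReal.ofReal (S.psi f w - η) < ENNReal.ofReal (S.psi f w) :=
        (ENNReal.ofReal_lt_ofReal_iff hpos).2 (by linarith)
      have h3 := S.ofReal_psi_le_rayMax (f := f) w (t := 1) zero_le_one
      rw [one_smul] at h3
      obtain ⟨t, ht⟩ := lt_iSup_iff.1 (h2.trans_le (h3.trans h1))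
      refine ⟨t, t.2, ?_⟩
      have h4 : S.psi f w - η ≤ S.psi f ((t : ℝ) • (w + s • φ)) := by
        by_contra! hlt
        exact absurd (ENNReal.ofReal_le_ofReal hlt.le) (not_le.2 ht)
      rw [smul_add, smul_smul] at h4
      simpa using h4
  have hpot : ∀ ε : ℝ, 0 < ε →
      (S.pot f u - S.pot f (u + (-ε) • φ)) / ε ≤ S.posInner w φ := by
    intro ε hε
    refine le_trans ?_ (hslope ε hε)
    gcongr ?_ / ε
    have hmem : u + (-ε) • φ ∈ S.space := S.space.add_mem hu (S.space.smul_mem _ hφ.1)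
    have h1 := S.minCost_le hMC hmem
    have e1 : S.posProj (u + (-ε) • φ) = w - ε • φ := by
      rw [map_add, map_smul, hφ.2, neg_smul, sub_eq_add_neg]
    have e2 : S.nm (u + (-ε) • φ) = S.nm u := by
      refine S.nm_congr ?_
      have h : S.negProj φ = 0 := by rw [← hφ.2, S.neg_pos]
      rw [map_add, map_smul, h, smul_zero, add_zero]
    rw [e1, cost, e2] at h1
    rw [← hcost, cost]
    linarith
  rw [← hb]
  have hd := S.hasDerivAt_pot hp hf hMC hu hφ.1
  have h1 : Tendsto (fun ε : ℝ => (-ε)⁻¹ • (S.pot f (u + (0 + -ε) • φ) - S.pot f (u + (0 : ℝ) • φ)))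
      (𝓝[>] 0) (𝓝 (∫ z, f (u z) * φ z ∂ν)) := by
    have h2 : Tendsto (fun ε : ℝ => -ε) (𝓝[>] 0) (𝓝[≠] 0) := by
      apply tendsto_nhdsWithin_iff.2 ⟨?_, ?_⟩
      · simpa using (continuous_neg.tendsto (0 : ℝ)).mono_left nhdsWithin_le_nhds
      · filter_upwards [self_mem_nhdsWithin] with x hx
        have hx : 0 < x := hx
        simpa using hx.ne'
    exact (hasDerivAt_iff_tendsto_slope_zero.1 hd).comp h2
  refine le_of_tendsto h1 ?_
  filter_upwards [self_mem_nhdsWithin] with ε hε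
  have hε : 0 < ε := hε
  refine le_trans (le_of_eq ?_) (hpot ε hε)
  simp only [zero_add, zero_smul, add_zero, smul_eq_mul]
  field_simp
  ring

include hp hf hMC in
-- If ‖u⁺‖₊ = 0, testing with u gives −‖u⁻‖₋² = ∫f(u)u dν ≥ 0, so both sides vanish. Then u = 0
-- ν-a.e. and only its kernel part remains, which `control` kills.
theorem np_pos_of_isWeak {u : Lp ℝ 2 m} (hu : S.IsWeak f u) (hne : u ≠ 0) : 0 < S.np u := by
  refine lt_of_le_of_ne (S.np_nonneg u) fun h0 => hne ?_
  have h1 := hu.2 u hu.1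
  rw [S.posQuad.inner_self hu.1.1, S.negQuad.inner_self hu.1.2.1] at h1
  change S.np u - S.nm u = _ at h1
  have hi := integrable_mul hp hf hMC hu.1.2.2 hu.1.2.2
  have hnn : ∀ z, 0 ≤ f (u z) * u z := fun z =>
    le_trans (mul_nonneg two_pos.le (hMC.primitive_nonneg _)) (hMC.two_mul_primitive_le hf (u z))
  have h2 : 0 ≤ ∫ z, f (u z) * u z ∂ν := integral_nonneg hnn
  have h3 := S.nm_nonneg u
  have h4 : S.nm u = 0 := by linarith
  have h5 := (integral_eq_zero_iff_of_nonneg hnn hi).1 (by linarith)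
  obtain ⟨C₁, hC₁, hb1⟩ := norm_sq_le_of_compact hp S.posQuad S.posProj S.pos_compact
  obtain ⟨C₂, hC₂, hb2⟩ := norm_sq_le_of_compact hp S.negQuad S.negProj S.neg_compact
  have h6 := hb1 u hu.1.1
  have h7 := hb2 u hu.1.2.1
  change _ ≤ _ * S.np u at h6
  change _ ≤ _ * S.nm u at h7
  rw [← h0, mul_zero] at h6
  rw [h4, mul_zero] at h7
  have h8 : S.posProj u = 0 :=
    norm_eq_zero.1 (pow_eq_zero_iff (two_ne_zero) |>.1 (le_antisymm h6 (sq_nonneg _)))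
  have h9 : S.negProj u = 0 :=
    norm_eq_zero.1 (pow_eq_zero_iff (two_ne_zero) |>.1 (le_antisymm h7 (sq_nonneg _)))
  have h10 : S.kerProj u = u := by
    conv_rhs => rw [← S.sum_proj u, h8, h9]
    simp
  obtain ⟨C, hC, hb⟩ := S.control
  have h11 := hb u h10
  have h12 : ∫ z, (u z) ^ 2 ∂ν = ∫ z, (0 : ℝ) ∂ν := by
    refine integral_congr_ae ?_
    filter_upwards [h5] with z hz
    by_contra hne
    have hz' : u z ≠ 0 := fun h => hne (by simp [h])
    have h13 := hMC.primitive_pos hz'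
    have h14 := hMC.two_mul_primitive_le hf (u z)
    rw [show f (u z) * u z = 0 from hz] at h14
    linarith
  rw [h12, integral_zero, mul_zero] at h11
  exact norm_eq_zero.1 (pow_eq_zero_iff (two_ne_zero) |>.1 (le_antisymm h11 (sq_nonneg _)))

include hp hf hMC in
theorem rayMax_le_of_isWeak {u : Lp ℝ 2 m} (hu : S.IsWeak f u) :
    S.rayMax f (S.posProj u) ≤ ENNReal.ofReal (S.phi f u) := by
  refine iSup_le fun t => ENNReal.ofReal_le_ofReal ?_
  have hw := S.posProj_mem_posSpace hu.1.1
  obtain ⟨y, hy1, hy2, hy3⟩ := S.exists_minimizer hp hf hMC (S.posSpace.smul_mem (t : ℝ) hw)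
  have hphiy : S.phi f y = S.psi f ((t : ℝ) • S.posProj u) := by
    rw [psi, phi, hy3, S.np_eq_of_posProj hy2]
  rw [← hphiy]
  refine (S.phi_le_of_critical hp hf hMC hu.1 hy1 ?_ (fun v hv hv0 => ?_) t.2 hy2).1
  · have h1 := hu.2 u hu.1
    rw [S.posQuad.inner_self hu.1.1, S.negQuad.inner_self hu.1.2.1] at h1
    exact h1
  · have h1 := hu.2 v hv
    rw [S.posInner_eq_zero hu.1.1 hv.1 hv0] at h1
    linarith

include hp hf hMC in
/-- Existence of a nonzero weak solution of least energy. -/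
theorem exists_groundState {w₀ : Lp ℝ 2 m} (hw₀ : w₀ ∈ S.posSpace) (hnp₀ : 0 < S.np w₀)
    (hnull : ∀ z ∈ S.space, S.posProj z = w₀ → S.nm z ≤ S.np w₀ → ¬ z =ᵐ[ν] 0) :
    ∃ u, S.IsWeak f u ∧ u ≠ 0 ∧ ∀ v, S.IsWeak f v → v ≠ 0 → S.phi f u ≤ S.phi f v := by
  have hfin₀ : S.rayMax f w₀ < ∞ := by
    have : ∃ n : ℕ, S.psi f (((n : ℝ) + 1) • w₀) < 0 := by
      by_contra! hcon
      obtain ⟨z, h1, h2, h3, h4⟩ := S.exists_null_of_psi_nonneg hp hf hMC hw₀ hcon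
      exact hnull z h1 h2 h3 h4
    obtain ⟨n, hn⟩ := this
    exact S.rayMax_lt_top hp hf hMC hw₀ (by positivity) hn
  obtain ⟨w₁, hw₁, hnp₁, hfin₁, hmin₁⟩ := S.exists_minimax hp hf hMC hw₀ hnp₀ hfin₀
  obtain ⟨t, ht, hpos, hmax⟩ := S.exists_ray_max hp hf hMC hw₁ hnp₁ hfin₁
  have hw : t • w₁ ∈ S.posSpace := S.posSpace.smul_mem t hw₁
  obtain ⟨u, hu, huw, hcost⟩ := S.exists_minimizer hp hf hMC hw
  have hle : S.rayMax f (t • w₁) ≤ S.rayMax f w₁ := S.rayMax_smul_le w₁ ht.le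
  rw [← huw] at hcost hpos hle hw hmax
  have hnp : 0 < S.np u := by
    rw [S.np_eq_of_posProj huw, S.np_smul hw₁.1]
    positivity
  have hmax' : ∀ s : ℝ, 0 ≤ s → S.psi f (s • S.posProj u) ≤ S.psi f (S.posProj u) := by
    intro s hs
    have := hmax (s * t) (mul_nonneg hs ht.le)
    rwa [mul_smul, ← huw] at this
  have hmin : ∀ v ∈ S.posSpace, 0 < S.np v → S.rayMax f (S.posProj u) ≤ S.rayMax f v :=
    fun v hv h => hle.trans (hmin₁ v hv h)
  have hfin := hle.trans_lt hfin₁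
  have hcrit : ∀ φ ∈ S.posSpace, S.posInner u φ = ∫ z, f (u z) * φ z ∂ν := by
    intro φ hφ
    have h1 := S.critical_pos hp hf hMC hu hφ hcost hnp hpos hmax' hfin hmin
    have h2 := S.critical_pos hp hf hMC hu (S.posSpace.smul_mem (-1) hφ) hcost hnp hpos hmax'
      hfin hmin
    have h3 : ∫ z, f (u z) * ((-1 : ℝ) • φ : Lp ℝ 2 m) z ∂ν = -∫ z, f (u z) * φ z ∂ν := by
      rw [← integral_neg]
      refine integral_congr_ae ?_
      filter_upwards [S.absolutelyContinuous.ae_eq (Lp.coeFn_smul (-1 : ℝ) φ)] with z hz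
      rw [hz]
      simp
    have h4 : S.posInner u ((-1 : ℝ) • φ) = -S.posInner u φ := by
      have e1 := S.posQuad.toReal_add_smul hu.1 hφ.1.1 (-1)
      have e2 := S.posQuad.toReal_add_smul hu.1 (S.posSpace.smul_mem (-1) hφ).1.1 1
      have e3 := S.posQuad.toReal_smul hφ.1.1 (-1)
      rw [one_smul] at e2
      linarith
    rw [h3, h4] at h2
    linarith
  have hweak : S.IsWeak f u := by
    refine ⟨hu, fun v hv => ?_⟩
    have hvp := S.posProj_mem_posSpace hv.1
    set v' := v - S.posProj v with hv'
    have hv's : v' ∈ S.space := S.space.sub_mem hv hvp.1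
    have hv'0 : S.posProj v' = 0 := by rw [hv', map_sub, S.pos_pos, sub_self]
    have h1 := hcrit _ hvp
    have h2 := S.critical_of_minimizer hp hf hMC hu (fun v hv h => by
      rw [hcost, ← h]
      exact S.minCost_le hMC hv) hv's hv'0
    have h3 : S.posInner u (S.posProj v) = S.posInner u v :=
      S.posInner_congr hu.1 hvp.1.1 rfl (S.pos_pos v)
    have h4 : S.negInner u v' = S.negInner u v :=
      S.negInner_congr hu.2.1 hv's.2.1 rfl (by rw [hv', map_sub, S.neg_pos, sub_zero])
    rw [← h3, ← h4, sub_eq_add_neg, h1, h2, ← integral_add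
      (integrable_mul hp hf hMC hu.2.2 hvp.1.2.2) (integrable_mul hp hf hMC hu.2.2 hv's.2.2)]
    refine integral_congr_ae ?_
    filter_upwards [S.absolutelyContinuous.ae_eq (Lp.coeFn_sub v (S.posProj v))] with z hz
    rw [hv', hz, Pi.sub_apply]
    ring
  refine ⟨u, hweak, ?_, fun v hv hne => ?_⟩
  · rintro rfl
    rw [np, S.posQuad.map_zero] at hnp
    simp at hnp
  · have hphi : S.phi f u = S.psi f (S.posProj u) := by rw [psi, phi, hcost, S.np_proj]
    have hnpv := S.np_pos_of_isWeak hp hf hMC hv hne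
    have h1 := hmin _ (S.posProj_mem_posSpace hv.1.1) (by rwa [S.np_proj])
    have h2 := S.ofReal_psi_le_rayMax (f := f) (S.posProj u) (t := 1) zero_le_one
    rw [one_smul, ← hphi] at h2
    -- Φ(u) ≤ rayMax(u⁺) ≤ rayMax(v⁺) ≤ Φ(v) as extended nonnegative numbers; Φ(u) > 0 allows the
    -- return to real numbers.
    have h3 := h2.trans (h1.trans (S.rayMax_le_of_isWeak hp hf hMC hv))
    rw [← hphi] at hpos
    by_contra! hlt
    exact absurd h3 (not_le.2 ((ENNReal.ofReal_lt_ofReal_iff hpos).2 hlt))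

end IndefiniteForm

/-! ### Spectral calculus of diagonal operators -/

section Diagonal

variable {H : Type*} [NormedAddCommGroup H] [InnerProductSpace ℝ H] [CompleteSpace H]

/-- `T` is the maximal operator that is diagonal with eigenvalues `Λ i` with respect to a total
family `b`, whose members for distinct eigenvalues are orthogonal. -/
structure IsDiagonal {ι : Type*} (b : ι → H) (Λ : ι → ℝ) (T : H →ₗ.[ℝ] H) : Prop where
  total : ∀ w, (∀ i, inner ℝ (b i) w = 0) → w = 0
  orthogonal : ∀ i j, Λ i ≠ Λ j → inner ℝ (b i) (b j) = 0
  mem_graph : ∀ v w, (v, w) ∈ T.graph ↔ ∀ i, inner ℝ (b i) w = Λ i * inner ℝ (b i) v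

/-- Each summand is a continuous nonnegative quadratic form. Semicontinuity passes to sums in [0,
∞], and the polar sum converges absolutely by Cauchy–Schwarz in each summand. -/
theorem isQuadForm_formNormSq (T : H →ₗ.[ℝ] H) (B : Set ℝ) :
    IsQuadForm (formNormSq T B) (formInner T B) := by
  have hproj : ∀ (l : ℝ) (u v : H), inner ℝ (spectralProj T {l} u) v
      = inner ℝ (spectralProj T {l} u) (spectralProj T {l} v) := by
    intro l u v
    have : CompleteSpace (spectralSubspace T {l}) := Submodule.topologicalClosure.completeSpace _
    change inner ℝ ((spectralSubspace T {l}).starProjection u) v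
      = inner ℝ ((spectralSubspace T {l}).starProjection u)
        ((spectralSubspace T {l}).starProjection v)
    rw [← Submodule.inner_starProjection_left_eq_right]
    congr 1
    exact (Submodule.starProjection_eq_self_iff.2 (Submodule.starProjection_apply_mem _ _)).symm
  have hsum : ∀ u, formNormSq T B u < ∞ →
      Summable fun l : B => |(l : ℝ)| * ‖spectralProj T {(l : ℝ)} u‖ ^ 2 := by
    intro u hu
    have := ENNReal.summable_toReal hu.ne
    refine this.congr fun l => ?_
    rw [ENNReal.toReal_ofReal (by positivity)]
  have hreal : ∀ u, (formNormSq T B u).toReal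
      = ∑' l : B, |(l : ℝ)| * ‖spectralProj T {(l : ℝ)} u‖ ^ 2 := by
    intro u
    rw [formNormSq, ENNReal.tsum_toReal_eq fun _ => ENNReal.ofReal_ne_top]
    exact tsum_congr fun l => ENNReal.toReal_ofReal (by positivity)
  have hterm : ∀ (u v : H) (s t : ℝ) (l : ℝ),
      |l| * ‖spectralProj T {l} (s • u + t • v)‖ ^ 2
        = s ^ 2 * (|l| * ‖spectralProj T {l} u‖ ^ 2)
          + 2 * s * t * (|l| * inner ℝ (spectralProj T {l} u) v)
          + t ^ 2 * (|l| * ‖spectralProj T {l} v‖ ^ 2) := by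
    intro u v s t l
    rw [hproj l u v, map_add, map_smul, map_smul, norm_add_sq_real, norm_smul, norm_smul, mul_pow,
      mul_pow, Real.norm_eq_abs, Real.norm_eq_abs, sq_abs, sq_abs, real_inner_smul_left,
      real_inner_smul_right]
    ring
  have hinner : ∀ u v, formNormSq T B u < ∞ → formNormSq T B v < ∞ →
      Summable fun l : B => |(l : ℝ)| * inner ℝ (spectralProj T {(l : ℝ)} u) v := by
    intro u v hu hv
    refine Summable.of_norm_bounded ((hsum u hu).add (hsum v hv)) fun l => ?_
    rw [hproj, norm_mul, Real.norm_eq_abs, abs_abs, Real.norm_eq_abs, ← mul_add]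
    gcongr
    refine (abs_real_inner_le_norm _ _).trans ?_
    nlinarith [sq_nonneg (‖spectralProj T {(l : ℝ)} u‖ - ‖spectralProj T {(l : ℝ)} v‖),
      sq_nonneg ‖spectralProj T {(l : ℝ)} u‖, sq_nonneg ‖spectralProj T {(l : ℝ)} v‖]
  refine ⟨?_, ?_, ?_, ?_⟩
  · refine lowerSemicontinuous_tsum fun l => Continuous.lowerSemicontinuous ?_
    exact ENNReal.continuous_ofReal.comp (by fun_prop)
  · simp [formNormSq]
  · intro u v hu hv s t
    have h := (((hsum u hu).mul_left (s ^ 2)).add ((hinner u v hu hv).mul_left (2 * s * t))).add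
      ((hsum v hv).mul_left (t ^ 2))
    rw [formNormSq]
    simp only [hterm]
    exact lt_of_le_of_ne le_top h.tsum_ofReal_ne_top
  · intro u v hu hv s t
    rw [hreal, hreal, hreal, formInner, ← tsum_mul_left, ← tsum_mul_left, ← tsum_mul_left,
      ← Summable.tsum_add ((hsum u hu).mul_left _) ((hinner u v hu hv).mul_left _),
      ← Summable.tsum_add (((hsum u hu).mul_left _).add ((hinner u v hu hv).mul_left _))
        ((hsum v hv).mul_left _)]
    exact tsum_congr fun l => hterm u v s t l

namespace IsDiagonal

variable {ι : Type*} {b : ι → H} {Λ : ι → ℝ} {T : H →ₗ.[ℝ] H} (h : IsDiagonal b Λ T)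

include h

theorem ext {u v : H} (huv : ∀ i, inner ℝ (b i) u = inner ℝ (b i) v) : u = v :=
  sub_eq_zero.1 (h.total _ fun i => by rw [inner_sub_right, huv i, sub_self])

theorem mem_eigenspace {l : ℝ} {u : H} :
    u ∈ eigenspace T l ↔ ∀ i, Λ i ≠ l → inner ℝ (b i) u = 0 := by
  have h1 : u ∈ eigenspace T l ↔ (u, l • u) ∈ T.graph := Iff.rfl
  rw [h1, h.mem_graph]
  refine forall_congr' fun i => ?_
  rw [real_inner_smul_right]
  constructor
  · intro h2 h3
    have : (l - Λ i) * inner ℝ (b i) u = 0 := by linarith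
    exact (mul_eq_zero.1 this).resolve_left (sub_ne_zero.2 (Ne.symm h3))
  · intro h2
    by_cases h3 : Λ i = l
    · rw [h3]
    · rw [h2 h3]; simp

theorem self_mem_eigenspace (i : ι) : b i ∈ eigenspace T (Λ i) :=
  h.mem_eigenspace.2 fun j hj => h.orthogonal j i hj

/-- A vector with vanishing coefficients off B has the same coefficients as its projection, and
totality identifies the two; no expansion in a basis is needed. -/
theorem mem_spectralSubspace {B : Set ℝ} {u : H} :
    u ∈ spectralSubspace T B ↔ ∀ i, Λ i ∉ B → inner ℝ (b i) u = 0 := by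
  have hle : ∀ v ∈ spectralSubspace T B, ∀ i, Λ i ∉ B → inner ℝ (b i) v = 0 := by
    intro v hv i hi
    have h1 : spectralSubspace T B ≤ (innerSL ℝ (b i)).ker := by
      refine Submodule.topologicalClosure_minimal _ (iSup₂_le fun l hl x hx => ?_)
        (ContinuousLinearMap.isClosed_ker _)
      exact h.mem_eigenspace.1 hx i fun h2 => hi (h2 ▸ hl)
    exact h1 hv
  refine ⟨fun hu => hle u hu, fun hu => ?_⟩
  have : CompleteSpace (spectralSubspace T B) := Submodule.topologicalClosure.completeSpace _
  have h2 : (spectralSubspace T B).starProjection u = u := by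
    refine h.ext fun i => ?_
    by_cases hi : Λ i ∈ B
    · have h3 : b i ∈ spectralSubspace T B :=
        Submodule.le_topologicalClosure _ (Submodule.mem_iSup_of_mem (Λ i)
          (Submodule.mem_iSup_of_mem hi (h.self_mem_eigenspace i)))
      rw [← Submodule.inner_starProjection_left_eq_right,
        Submodule.starProjection_eq_self_iff.2 h3]
    · rw [hle _ (Submodule.starProjection_apply_mem _ _) i hi, hu i hi]
  rw [← h2]
  exact Submodule.starProjection_apply_mem _ _

theorem inner_spectralProj (B : Set ℝ) (u : H) (i : ι) :
    inner ℝ (b i) (spectralProj T B u) = B.indicator (fun _ => inner ℝ (b i) u) (Λ i) := by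
  have : CompleteSpace (spectralSubspace T B) := Submodule.topologicalClosure.completeSpace _
  have hmem : spectralProj T B u ∈ spectralSubspace T B :=
    Submodule.starProjection_apply_mem _ _
  by_cases hi : Λ i ∈ B
  · rw [Set.indicator_of_mem hi]
    have h3 : b i ∈ spectralSubspace T B :=
      Submodule.le_topologicalClosure _ (Submodule.mem_iSup_of_mem (Λ i)
        (Submodule.mem_iSup_of_mem hi (h.self_mem_eigenspace i)))
    change inner ℝ (b i) ((spectralSubspace T B).starProjection u) = _
    rw [← Submodule.inner_starProjection_left_eq_right,
      Submodule.starProjection_eq_self_iff.2 h3]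
  · rw [Set.indicator_of_notMem hi]
    exact h.mem_spectralSubspace.1 hmem i hi

theorem spectralProj_spectralProj (B B' : Set ℝ) (u : H) :
    spectralProj T B (spectralProj T B' u) = spectralProj T (B ∩ B') u := by
  refine h.ext fun i => ?_
  rw [h.inner_spectralProj, h.inner_spectralProj]
  by_cases h1 : Λ i ∈ B <;> by_cases h2 : Λ i ∈ B' <;>
    simp [h1, h2, h.inner_spectralProj]

theorem spectralProj_empty (u : H) : spectralProj T ∅ u = 0 :=
  h.ext fun i => by simp [h.inner_spectralProj]

theorem spectralProj_disjoint {B B' : Set ℝ} (hB : B ∩ B' = ∅) (u : H) :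
    spectralProj T B (spectralProj T B' u) = 0 := by
  rw [h.spectralProj_spectralProj, hB, h.spectralProj_empty]

theorem sum_spectralProj (u : H) : spectralProj T (Set.Ioi 0) u + spectralProj T (Set.Iio 0) u
    + spectralProj T {0} u = u := by
  refine h.ext fun i => ?_
  simp only [inner_add_right, h.inner_spectralProj]
  rcases lt_trichotomy (Λ i) 0 with h1 | h1 | h1
  · simp [h1, h1.ne, h1.le]
  · simp [h1]
  · simp [h1, h1.ne', h1.le]

theorem formNormSq_spectralProj (B : Set ℝ) (u : H) :
    formNormSq T B (spectralProj T B u) = formNormSq T B u := by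
  refine tsum_congr fun l => ?_
  rw [h.spectralProj_spectralProj, Set.inter_eq_left.2 (Set.singleton_subset_iff.2 l.2)]

theorem spectralProj_eq_self_iff {B : Set ℝ} {u : H} :
    spectralProj T B u = u ↔ u ∈ spectralSubspace T B := by
  have : CompleteSpace (spectralSubspace T B) := Submodule.topologicalClosure.completeSpace _
  exact Submodule.starProjection_eq_self_iff

/-- Partial sums over a finite set F are projections onto the spectral subspace of F; these increase
with F and have dense union. -/
theorem hasSum_spectralProj (y : H) : HasSum (fun l : ℝ => spectralProj T {l} y) y := by
  have : ∀ F : Finset ℝ, CompleteSpace (spectralSubspace T (F : Set ℝ)) := fun F =>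
    Submodule.topologicalClosure.completeSpace _
  have h1 : ∀ F : Finset ℝ, ∑ l ∈ F, spectralProj T {l} y
      = (spectralSubspace T (F : Set ℝ)).starProjection y := by
    intro F
    refine h.ext fun i => ?_
    have h2 := h.inner_spectralProj (F : Set ℝ) y i
    refine Eq.trans ?_ h2.symm
    rw [inner_sum]
    simp only [h.inner_spectralProj]
    by_cases hi : Λ i ∈ F
    · rw [Finset.sum_eq_single_of_mem _ hi fun l _ hl => by simp [Ne.symm hl]]
      simp [hi]
    · rw [Set.indicator_of_notMem (by simpa using hi)]
      refine Finset.sum_eq_zero fun l hl => ?_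
      rw [Set.indicator_of_notMem]
      rintro rfl
      exact hi hl
  unfold HasSum
  simp only [h1]
  refine Submodule.starProjection_tendsto_self (fun F : Finset ℝ => spectralSubspace T (F : Set ℝ))
    (fun F G hFG => ?_) y ?_
  · intro x hx
    rw [h.mem_spectralSubspace] at hx ⊢
    exact fun i hi => hx i fun h3 => hi (hFG h3)
  · rw [top_le_iff, Submodule.topologicalClosure_eq_top_iff, Submodule.eq_bot_iff]
    intro w hw
    refine h.total w fun i => ?_
    refine (Submodule.mem_orthogonal _ w).1 hw (b i) (Submodule.mem_iSup_of_mem {Λ i} ?_)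
    rw [h.mem_spectralSubspace]
    intro j hj
    exact h.orthogonal j i (by simpa using hj)

theorem hasSum_inner_of_mem_graph {u w : H} (hu : (u, w) ∈ T.graph) (y : H) :
    HasSum (fun l : ℝ => l * inner ℝ (spectralProj T {l} y) u) (inner ℝ y w) := by
  have h1 := (h.hasSum_spectralProj y).mapL (innerSL ℝ w)
  have h2 : ∀ l : ℝ, innerSL ℝ w (spectralProj T {l} y)
      = l * inner ℝ (spectralProj T {l} y) u := by
    intro l
    have : CompleteSpace (spectralSubspace T {l}) := Submodule.topologicalClosure.completeSpace _
    have h3 : spectralProj T {l} w = l • spectralProj T {l} u := by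
      refine h.ext fun i => ?_
      rw [real_inner_smul_right, h.inner_spectralProj, h.inner_spectralProj]
      by_cases hi : Λ i = l
      · simp [hi, (h.mem_graph u w).1 hu i]
      · simp [hi]
    have h4 : ∀ v, inner ℝ (spectralProj T {l} y) v = inner ℝ y (spectralProj T {l} v) := fun v =>
      Submodule.inner_starProjection_left_eq_right _ _ _
    rw [innerSL_apply_apply, real_inner_comm, h4, h4, h3, real_inner_smul_right]
  simp only [h2] at h1
  rwa [innerSL_apply_apply, real_inner_comm] at h1

/-- The vector y need not have finite form norm: u lies in the domain, so the spectral series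
converges absolutely and may be split by the sign of the eigenvalue. -/
theorem inner_eq_formInner_sub {u w : H} (hu : (u, w) ∈ T.graph) (y : H) :
    inner ℝ y w = formInner T (Set.Ioi 0) y u - formInner T (Set.Iio 0) y u := by
  have h1 := h.hasSum_inner_of_mem_graph hu y
  rw [formInner, formInner,
    tsum_subtype (Set.Ioi (0 : ℝ)) (fun l : ℝ => |l| * inner ℝ (spectralProj T {l} y) u),
    tsum_subtype (Set.Iio (0 : ℝ)) (fun l : ℝ => |l| * inner ℝ (spectralProj T {l} y) u)]
  have hs : Summable fun l : ℝ => |l| * inner ℝ (spectralProj T {l} y) u := by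
    refine Summable.of_norm ?_
    have := h1.summable.norm
    simpa [abs_mul] using this
  rw [← Summable.tsum_sub (hs.indicator _) (hs.indicator _), ← h1.tsum_eq]
  refine tsum_congr fun l => ?_
  rcases lt_trichotomy l 0 with h2 | h2 | h2
  · simp [h2, h2.le, abs_of_neg h2]
  · simp [h2]
  · simp [h2, h2.le, abs_of_pos h2]

theorem formNormSq_lt_top_of_mem_graph {u w : H} (hu : (u, w) ∈ T.graph) (B : Set ℝ) :
    formNormSq T B u < ∞ := by
  have h1 := (h.hasSum_inner_of_mem_graph hu u).summable.norm.subtype B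
  rw [formNormSq]
  have h2 : ∀ l : B, |(l : ℝ)| * ‖spectralProj T {(l : ℝ)} u‖ ^ 2
      = ‖(l : ℝ) * inner ℝ (spectralProj T {(l : ℝ)} u) u‖ := by
    intro l
    have : CompleteSpace (spectralSubspace T {(l : ℝ)}) :=
      Submodule.topologicalClosure.completeSpace _
    have h3 : inner ℝ (spectralProj T {(l : ℝ)} u) u = ‖spectralProj T {(l : ℝ)} u‖ ^ 2 := by
      rw [← real_inner_self_eq_norm_sq]
      change inner ℝ ((spectralSubspace T {(l : ℝ)}).starProjection u) u = inner ℝ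
        ((spectralSubspace T {(l : ℝ)}).starProjection u)
        ((spectralSubspace T {(l : ℝ)}).starProjection u)
      rw [← Submodule.inner_starProjection_left_eq_right]
      congr 1
      exact (Submodule.starProjection_eq_self_iff.2
        (Submodule.starProjection_apply_mem _ _)).symm
    rw [h3, norm_mul, Real.norm_eq_abs, Real.norm_of_nonneg (sq_nonneg _)]
  simp only [h2]
  exact lt_of_le_of_ne le_top h1.tsum_ofReal_ne_top

end IsDiagonal

end Diagonal

/-! ### Eigenfunctions of self-adjoint operators with compact resolvent -/

section SelfAdjoint

variable {H : Type*} [NormedAddCommGroup H] [InnerProductSpace ℝ H] [CompleteSpace H]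

theorem inner_symm_of_isSelfAdjoint {A : H →ₗ.[ℝ] H} (hA : IsSelfAdjoint A) (x y : A.domain) :
    inner ℝ (A x) (y : H) = inner ℝ (x : H) (A y) := by
  have h := LinearPMap.adjoint_isFormalAdjoint hA.dense_domain
  rw [LinearPMap.isSelfAdjoint_def.1 hA] at h
  exact h x y

theorem inner_eigenspace_eq_zero {A : H →ₗ.[ℝ] H} (hA : IsSelfAdjoint A) {l l' : ℝ} (hne : l ≠ l')
    {u v : H} (hu : u ∈ eigenspace A l) (hv : v ∈ eigenspace A l') : inner ℝ u v = 0 := by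
  obtain ⟨hu1, hu2⟩ := (mem_eigenspace_iff A l u).1 hu
  obtain ⟨hv1, hv2⟩ := (mem_eigenspace_iff A l' v).1 hv
  have h := inner_symm_of_isSelfAdjoint hA ⟨u, hu1⟩ ⟨v, hv1⟩
  rw [hu2, hv2, real_inner_smul_left, real_inner_smul_right] at h
  have h1 : (l - l') * inner ℝ u v = 0 := by
    simp only at h
    linarith
  exact (mul_eq_zero.1 h1).resolve_left (sub_ne_zero.2 hne)

/-- The eigenvectors of a self-adjoint operator with compact resolvent are total. -/
theorem eq_zero_of_orthogonal_eigenspaces {A : H →ₗ.[ℝ] H} (hA : IsSelfAdjoint A)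
    (hc : HasCompactResolvent A) {v : H} (hv : ∀ l, ∀ ζ ∈ eigenspace A l, inner ℝ ζ v = 0) :
    v = 0 := by
  obtain ⟨z, R, hR, h1, h2⟩ := hc
  have hsymm : (R : H →ₗ[ℝ] H).IsSymmetric := by
    intro x y
    obtain ⟨hx, hx'⟩ := h1 x
    obtain ⟨hy, hy'⟩ := h1 y
    have h := inner_symm_of_isSelfAdjoint hA ⟨R x, hx⟩ ⟨R y, hy⟩
    change inner ℝ (R x) y = inner ℝ x (R y)
    have e1 : inner ℝ (R x) y = inner ℝ (R x) (A ⟨R y, hy⟩ - z • R y) := by rw [hy']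
    have e2 : inner ℝ x (R y) = inner ℝ (A ⟨R x, hx⟩ - z • R x) (R y) := by rw [hx']
    rw [e1, e2, inner_sub_left, inner_sub_right, real_inner_smul_left, real_inner_smul_right]
    simp only at h
    rw [h]
  have hbot := ContinuousLinearMap.orthogonalComplement_iSup_eigenspaces_eq_bot hR hsymm
  have hmem : v ∈ (⨆ μ, Module.End.eigenspace (R : H →ₗ[ℝ] H) μ)ᗮ := by
    rw [Submodule.mem_orthogonal]
    intro x hx
    have hle : (⨆ μ, Module.End.eigenspace (R : H →ₗ[ℝ] H) μ) ≤ (innerSL ℝ v).ker := by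
      refine iSup_le fun μ x hx => ?_
      have hx : R x = μ • x := Module.End.mem_eigenspace_iff.1 hx
      change inner ℝ v x = 0
      rw [real_inner_comm]
      obtain ⟨hd, hd'⟩ := h1 x
      -- R is injective, so μ = 0 forces x = 0; otherwise x is an eigenvector of A with eigenvalue z
      -- + μ⁻¹.
      rcases eq_or_ne μ 0 with rfl | hμ
      · rw [zero_smul] at hx
        have h3 : A ⟨R x, hd⟩ = 0 := by
          have : (⟨R x, hd⟩ : A.domain) = 0 := Subtype.ext hx
          rw [this, LinearPMap.map_zero]
        rw [h3, hx, smul_zero, sub_zero] at hd'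
        rw [← hd', inner_zero_left]
      · have hxd : x ∈ A.domain := by
          have := A.domain.smul_mem μ⁻¹ hd
          rwa [hx, inv_smul_smul₀ hμ] at this
        refine hv (z + μ⁻¹) x ((mem_eigenspace_iff A _ x).2 ⟨hxd, ?_⟩)
        have h3 : (⟨R x, hd⟩ : A.domain) = μ • ⟨x, hxd⟩ := Subtype.ext hx
        rw [h3, LinearPMap.map_smul, hx, sub_eq_iff_eq_add] at hd'
        have h4 : A ⟨x, hxd⟩ = μ⁻¹ • (x + z • μ • x) := by rw [← hd', inv_smul_smul₀ hμ]
        rw [h4, smul_add, smul_comm z μ, inv_smul_smul₀ hμ, add_smul, add_comm]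
    have := hle hx
    change inner ℝ v x = 0 at this
    rwa [real_inner_comm]
  have h3 : v ∈ (⊥ : Submodule ℝ H) := by rwa [← hbot]
  exact (Submodule.mem_bot ℝ).1 h3

end SelfAdjoint

/-! ### Functions on the circle -/

/-- `e₂` is the second derivative of the function `e` on the circle. -/
def IsSecondDeriv (e e₂ : C(TimeCircle, ℝ)) : Prop :=
  ∃ e₁ : ℝ → ℝ, (∀ t : ℝ, HasDerivAt (fun t : ℝ => e (t : TimeCircle)) (e₁ t) t) ∧
    ∀ t : ℝ, HasDerivAt e₁ (e₂ (t : TimeCircle)) t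

/-- Integrate the derivative of the periodic Wronskian e′g − eg′ over one period. -/
theorem integral_mul_symm {e e₂ g g₂ : C(TimeCircle, ℝ)} (he : IsSecondDeriv e e₂)
    (hg : IsSecondDeriv g g₂) : ∫ t, e₂ t * g t = ∫ t, e t * g₂ t := by
  obtain ⟨e₁, he1, he2⟩ := he
  obtain ⟨g₁, hg1, hg2⟩ := hg
  have hper : ∀ (k : C(TimeCircle, ℝ)) (k₁ : ℝ → ℝ),
      (∀ t : ℝ, HasDerivAt (fun t : ℝ => k (t : TimeCircle)) (k₁ t) t) →
      k₁ (0 + 2 * Real.pi) = k₁ 0 := by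
    intro k k₁ hk
    have h1 := (hk (0 + 2 * Real.pi)).comp_add_const (0 : ℝ) (2 * Real.pi)
    have h2 : (fun t : ℝ => k ((t + 2 * Real.pi : ℝ) : TimeCircle)) = fun t : ℝ => k (t : TimeCircle) := by
      ext t
      rw [AddCircle.coe_add_period]
    rw [h2] at h1
    exact h1.unique (hk 0)
  have hc : Continuous fun t : ℝ => (t : TimeCircle) := AddCircle.continuous_mk' _
  have hD : ∀ t : ℝ, HasDerivAt (fun t : ℝ => e₁ t * g (t : TimeCircle) - e (t : TimeCircle) * g₁ t)
      (e₂ (t : TimeCircle) * g (t : TimeCircle) - e (t : TimeCircle) * g₂ (t : TimeCircle)) t := by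
    intro t
    refine (((he2 t).mul (hg1 t)).sub ((he1 t).mul (hg2 t))).congr_deriv ?_
    ring
  have hi := intervalIntegral.integral_eq_sub_of_hasDerivAt (a := 0) (b := 0 + 2 * Real.pi)
    (fun t _ => hD t) (Continuous.intervalIntegrable (by fun_prop) _ _)
  rw [hper e e₁ he1, hper g g₁ hg1, AddCircle.coe_add_period, sub_self,
    AddCircle.intervalIntegral_preimage (2 * Real.pi) 0
      (fun t : TimeCircle => e₂ t * g t - e t * g₂ t)] at hi
  have hint : ∀ k : C(TimeCircle, ℝ), Integrable k := fun k =>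
    k.continuous.integrable_of_hasCompactSupport (HasCompactSupport.of_compactSpace _)
  have h1 := hint (e₂ * g)
  have h2 := hint (e * g₂)
  have h3 := integral_sub h1 h2
  simp only [ContinuousMap.mul_apply] at h3
  rw [h3] at hi
  linarith

theorem isSecondDeriv_circleMode (l : ℤ) :
    IsSecondDeriv (circleMode l) (-(l : ℝ) ^ 2 • circleMode l) := by
  have hlin : ∀ (a t : ℝ), HasDerivAt (fun t : ℝ => a * t) a t := fun a t => by
    simpa using (hasDerivAt_id t).const_mul a
  rcases le_or_gt 0 l with hl | hl
  · refine ⟨fun t => -Real.sin (l * t) * l, fun t => ?_, fun t => ?_⟩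
    · simp only [circleMode_of_nonneg hl]
      exact (Real.hasDerivAt_cos _).comp t (hlin l t)
    · simp only [ContinuousMap.smul_apply, circleMode_of_nonneg hl, smul_eq_mul]
      refine ((((Real.hasDerivAt_sin _).comp t (hlin l t)).neg).mul_const (l : ℝ)).congr_deriv ?_
      ring
  · refine ⟨fun t => Real.cos (-l * t) * -l, fun t => ?_, fun t => ?_⟩
    · simp only [circleMode_of_neg hl]
      exact (Real.hasDerivAt_sin _).comp t (hlin (-l) t)
    · simp only [ContinuousMap.smul_apply, circleMode_of_neg hl, smul_eq_mul]
      refine (((Real.hasDerivAt_cos _).comp t (hlin (-l) t)).mul_const (-(l : ℝ))).congr_deriv ?_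
      ring

/-- Symmetry of ∂_tt separates modes with different l². The case l' = −l is not needed, as
`IsDiagonal` only compares distinct eigenvalues. -/
theorem integral_circleMode_mul {l l' : ℤ} (h : (l : ℝ) ^ 2 ≠ (l' : ℝ) ^ 2) :
    ∫ t, circleMode l t * circleMode l' t = 0 := by
  have h1 := integral_mul_symm (isSecondDeriv_circleMode l) (isSecondDeriv_circleMode l')
  simp only [ContinuousMap.smul_apply, smul_eq_mul, mul_assoc, mul_left_comm _ (-(l' : ℝ) ^ 2)] at h1
  rw [integral_const_mul, integral_const_mul] at h1
  have h2 : ((l' : ℝ) ^ 2 - (l : ℝ) ^ 2) * ∫ t, circleMode l t * circleMode l' t = 0 := by linarith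
  exact (mul_eq_zero.1 h2).resolve_left (sub_ne_zero.2 (Ne.symm h))

/-- A closed subspace of `C(S¹)` that contains all the modes is everything. -/
theorem eq_top_of_circleMode_mem {X : Submodule ℝ C(TimeCircle, ℝ)}
    (hcl : IsClosed (X : Set C(TimeCircle, ℝ))) (hX : ∀ l, circleMode l ∈ X) : X = ⊤ := by
  let re : C(TimeCircle, ℂ) → C(TimeCircle, ℝ) := fun g => ⟨fun t => (g t).re, by fun_prop⟩
  let im : C(TimeCircle, ℂ) → C(TimeCircle, ℝ) := fun g => ⟨fun t => (g t).im, by fun_prop⟩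
  have hre : Continuous re := ContinuousMap.continuous_postcomp ⟨Complex.re, Complex.continuous_re⟩
  have him : Continuous im := ContinuousMap.continuous_postcomp ⟨Complex.im, Complex.continuous_im⟩
  -- The complexification of X is a closed complex subspace containing all Fourier monomials, hence
  -- everything.
  let Y : Submodule ℂ C(TimeCircle, ℂ) :=
    { carrier := {g | re g ∈ X ∧ im g ∈ X}
      zero_mem' := by
        refine ⟨?_, ?_⟩
        · convert! X.zero_mem
        · convert! X.zero_mem
      add_mem' := fun {a b} ha hb => ⟨X.add_mem ha.1 hb.1, X.add_mem ha.2 hb.2⟩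
      smul_mem' := fun c g hg => by
        refine ⟨?_, ?_⟩
        · have h : re (c • g) = c.re • re g - c.im • im g := by
            ext t
            simp [re, im]
          rw [h]
          exact X.sub_mem (X.smul_mem _ hg.1) (X.smul_mem _ hg.2)
        · have h : im (c • g) = c.re • im g + c.im • re g := by
            ext t
            simp [re, im]
          rw [h]
          exact X.add_mem (X.smul_mem _ hg.2) (X.smul_mem _ hg.1) }
  have hYcl : IsClosed (Y : Set C(TimeCircle, ℂ)) := (hcl.preimage hre).inter (hcl.preimage him)
  have hnn : ∀ l : ℤ, 0 ≤ l → re (fourier l) ∈ X ∧ im (fourier l) ∈ X := by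
    intro l hl
    refine ⟨?_, ?_⟩
    · have h : re (fourier l) = circleMode l := by
        ext t
        simp [re, circleMode, hl]
      rw [h]
      exact hX l
    · rcases hl.eq_or_lt with rfl | hl
      · have h : im (fourier 0) = 0 := by
          ext t
          simp [im]
        rw [h]
        exact X.zero_mem
      · have h : im (fourier l) = circleMode (-l) := by
          ext t
          simp [im, circleMode, not_le.2 hl]
        rw [h]
        exact hX _
  have hY : ∀ l, (fourier l : C(TimeCircle, ℂ)) ∈ Y := by
    intro l
    rcases le_total 0 l with hl | hl
    · exact hnn l hl
    · obtain ⟨h1, h2⟩ := hnn (-l) (by omega)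
      refine ⟨?_, ?_⟩
      · have h : re (fourier l) = re (fourier (-l)) := by
          ext t
          simp only [re, ContinuousMap.coe_mk, fourier_neg, Complex.conj_re]
        rw [h]
        exact h1
      · have h : im (fourier l) = -im (fourier (-l)) := by
          ext t
          simp only [im, ContinuousMap.coe_mk, ContinuousMap.neg_apply, fourier_neg,
            Complex.conj_im, neg_neg]
        rw [h]
        exact X.neg_mem h2
  have htop : Y = ⊤ := by
    rw [← top_le_iff, ← span_fourier_closure_eq_top]
    refine Submodule.topologicalClosure_minimal _ (Submodule.span_le.2 ?_) hYcl
    rintro _ ⟨l, rfl⟩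
    exact hY l
  rw [eq_top_iff]
  intro e _
  have h1 : (⟨fun t => (e t : ℂ), by fun_prop⟩ : C(TimeCircle, ℂ)) ∈ Y := htop ▸ Submodule.mem_top
  convert! h1.1

/-! ### Tensor products -/

section Tensor

variable {M : Type*} [MetricSpace M] [MeasurableSpace M] [BorelSpace M]
variable (μ : Measure M) [IsFiniteMeasure μ]

theorem coeFn_tensor (φ : L2M μ) (e : C(TimeCircle, ℝ)) :
    ⇑(tensor μ φ e) =ᵐ[prodMeasure μ] fun z => φ z.1 * e z.2 :=
  (memLp_tensor μ φ e).coeFn_toLp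

theorem inner_tensor (φ : L2M μ) (e : C(TimeCircle, ℝ)) (W : L2MS μ) :
    inner ℝ (tensor μ φ e) W = ∫ z, φ z.1 * e z.2 * W z ∂(prodMeasure μ) := by
  rw [L2.inner_def]
  refine integral_congr_ae ?_
  filter_upwards [coeFn_tensor μ φ e] with z hz
  rw [hz]
  simp [mul_comm]

theorem inner_tensor_tensor (φ φ' : L2M μ) (e e' : C(TimeCircle, ℝ)) :
    inner ℝ (tensor μ φ e) (tensor μ φ' e') = inner ℝ φ φ' * ∫ t, e t * e' t := by
  have h1 : inner ℝ φ φ' = ∫ x, φ x * φ' x ∂μ := by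
    rw [L2.inner_def]
    refine integral_congr_ae (Eventually.of_forall fun x => ?_)
    simp [mul_comm]
  rw [inner_tensor, h1, ← integral_prod_mul]
  refine integral_congr_ae ?_
  filter_upwards [coeFn_tensor μ φ' e'] with z hz
  rw [hz]
  ring

theorem tensor_add_left (φ φ' : L2M μ) (e : C(TimeCircle, ℝ)) :
    tensor μ (φ + φ') e = tensor μ φ e + tensor μ φ' e := by
  refine Lp.ext ?_
  have h : ∀ᵐ z ∂(prodMeasure μ), (φ + φ' : L2M μ) z.1 = φ z.1 + φ' z.1 :=
    Measure.quasiMeasurePreserving_fst.ae (Lp.coeFn_add φ φ')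
  filter_upwards [coeFn_tensor μ (φ + φ') e, coeFn_tensor μ φ e, coeFn_tensor μ φ' e,
    Lp.coeFn_add (tensor μ φ e) (tensor μ φ' e), h] with z h1 h2 h3 h4 h5
  rw [h4, Pi.add_apply, h1, h2, h3, h5, add_mul]

theorem tensor_smul_left (c : ℝ) (φ : L2M μ) (e : C(TimeCircle, ℝ)) :
    tensor μ (c • φ) e = c • tensor μ φ e := by
  refine Lp.ext ?_
  have h : ∀ᵐ z ∂(prodMeasure μ), (c • φ : L2M μ) z.1 = c • φ z.1 :=
    Measure.quasiMeasurePreserving_fst.ae (Lp.coeFn_smul c φ)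
  filter_upwards [coeFn_tensor μ (c • φ) e, coeFn_tensor μ φ e,
    Lp.coeFn_smul c (tensor μ φ e), h] with z h1 h2 h4 h5
  rw [h4, Pi.smul_apply, h1, h2, h5, smul_mul_assoc]

theorem norm_tensor (φ : L2M μ) (e : C(TimeCircle, ℝ)) :
    ‖tensor μ φ e‖ = Real.sqrt (∫ t, e t * e t) * ‖φ‖ := by
  have h := inner_tensor_tensor μ φ φ e e
  rw [real_inner_self_eq_norm_sq, real_inner_self_eq_norm_sq] at h
  rw [← Real.sqrt_sq (norm_nonneg (tensor μ φ e)), h, mul_comm, Real.sqrt_mul' _ (sq_nonneg _),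
    Real.sqrt_sq (norm_nonneg _)]

/-- The map `φ ↦ φ ⊗ e` as a continuous linear map. -/
def tensorLeft (e : C(TimeCircle, ℝ)) : L2M μ →L[ℝ] L2MS μ :=
  LinearMap.mkContinuous
    { toFun := fun φ => tensor μ φ e
      map_add' := fun φ φ' => tensor_add_left μ φ φ' e
      map_smul' := fun c φ => tensor_smul_left μ c φ e }
    (Real.sqrt (∫ t, e t * e t)) fun φ => (norm_tensor μ φ e).le

theorem integrable_tensor_mul (φ : L2M μ) (e : C(TimeCircle, ℝ)) (W : L2MS μ) :
    Integrable (fun z => φ z.1 * e z.2 * W z) (prodMeasure μ) :=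
  (memLp_tensor μ φ e).integrable_mul (Lp.memLp W)

/-- The functional `e ↦ ⟨φ ⊗ e, W⟩` on continuous functions. -/
def tensorFunctional (φ : L2M μ) (W : L2MS μ) : C(TimeCircle, ℝ) →ₗ[ℝ] ℝ where
  toFun e := ∫ z, φ z.1 * e z.2 * W z ∂(prodMeasure μ)
  map_add' e e' := by
    rw [← integral_add (integrable_tensor_mul μ φ e W) (integrable_tensor_mul μ φ e' W)]
    refine integral_congr_ae (Eventually.of_forall fun z => ?_)
    simp only [ContinuousMap.add_apply]
    ring
  map_smul' c e := by
    rw [RingHom.id_apply, smul_eq_mul, ← integral_const_mul]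
    refine integral_congr_ae (Eventually.of_forall fun z => ?_)
    simp only [ContinuousMap.smul_apply, smul_eq_mul]
    ring

theorem continuous_tensorFunctional (φ : L2M μ) (W : L2MS μ) :
    Continuous (tensorFunctional μ φ W) := by
  have hi : Integrable (fun z => |φ z.1 * W z|) (prodMeasure μ) := by
    have := (integrable_tensor_mul μ φ 1 W).abs
    simpa using this
  refine (LinearMap.mkContinuous (tensorFunctional μ φ W)
    (∫ z, |φ z.1 * W z| ∂(prodMeasure μ)) fun e => ?_).continuous
  rw [mul_comm _ ‖e‖, ← integral_const_mul]
  refine norm_integral_le_of_norm_le (hi.const_mul _) (Eventually.of_forall fun z => ?_)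
  have h : φ z.1 * e z.2 * W z = e z.2 * (φ z.1 * W z) := by ring
  rw [h, norm_mul, Real.norm_eq_abs (φ z.1 * W z)]
  gcongr
  exact e.norm_coe_le_norm _

variable [CompactSpace M]

/-- Functions in `L²(M × S¹)` that are orthogonal to all tensor products vanish. -/
theorem eq_zero_of_orthogonal_tensor {W : L2MS μ}
    (hW : ∀ (φ : L2M μ) (e : C(TimeCircle, ℝ)), inner ℝ (tensor μ φ e) W = 0) : W = 0 := by
  let τ : C(M × TimeCircle, ℝ) →L[ℝ] L2MS μ := ContinuousMap.toLp 2 (prodMeasure μ) ℝ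
  let Y : Submodule ℝ C(M × TimeCircle, ℝ) := ((innerSL ℝ W).comp τ).ker
  have hYcl : IsClosed (Y : Set C(M × TimeCircle, ℝ)) := ContinuousLinearMap.isClosed_ker _
  let s : Set C(M × TimeCircle, ℝ) := {k | ∃ (g : C(M, ℝ)) (e : C(TimeCircle, ℝ)),
    k = (g.comp ContinuousMap.fst) * (e.comp ContinuousMap.snd)}
  have hsY : s ⊆ Y := by
    rintro _ ⟨g, e, rfl⟩
    have hg : MemLp g 2 μ :=
      (Lp.memLp (ContinuousMap.toLp 2 μ ℝ g)).ae_eq (ContinuousMap.coeFn_toLp μ g)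
    have h : τ ((g.comp ContinuousMap.fst) * (e.comp ContinuousMap.snd))
        = tensor μ (hg.toLp g) e := by
      refine Lp.ext ?_
      have h1 : ∀ᵐ z ∂(prodMeasure μ), (hg.toLp g : L2M μ) z.1 = g z.1 :=
        Measure.quasiMeasurePreserving_fst.ae hg.coeFn_toLp
      filter_upwards [ContinuousMap.coeFn_toLp (p := 2) (𝕜 := ℝ) (prodMeasure μ)
        ((g.comp ContinuousMap.fst) * (e.comp ContinuousMap.snd)),
        coeFn_tensor μ (hg.toLp g) e, h1] with z h2 h3 h4
      rw [h2, h3, h4]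
      rfl
    change inner ℝ W (τ _) = 0
    rw [h, real_inner_comm, hW]
  -- Elementary products are closed under multiplication, so the algebra they generate is their
  -- linear span; Stone–Weierstrass then combines with linearity of the orthogonality condition.
  have hclos : ∀ k ∈ Submonoid.closure s, k ∈ s := by
    intro k hk
    induction hk using Submonoid.closure_induction with
    | mem k hk => exact hk
    | one => exact ⟨1, 1, by ext z; simp⟩
    | mul a b _ _ ha hb =>
      obtain ⟨g, e, rfl⟩ := ha
      obtain ⟨g', e', rfl⟩ := hb
      refine ⟨g * g', e * e', ?_⟩
      ext z
      simp only [ContinuousMap.mul_apply, ContinuousMap.comp_apply]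
      ring
  have hsep : (Algebra.adjoin ℝ s).SeparatesPoints := by
    intro z z' hne
    by_cases h1 : z.1 = z'.1
    · have h2 : z.2 ≠ z'.2 := fun h2 => hne (Prod.ext h1 h2)
      refine ⟨_, ⟨_, Algebra.subset_adjoin ⟨1, ⟨fun t => dist t z.2, by fun_prop⟩, rfl⟩, rfl⟩, ?_⟩
      simpa using Ne.symm h2
    · refine ⟨_, ⟨_, Algebra.subset_adjoin ⟨⟨fun x => dist x z.1, by fun_prop⟩, 1, rfl⟩, rfl⟩, ?_⟩
      simpa using Ne.symm h1
  have htop := ContinuousMap.subalgebra_topologicalClosure_eq_top_of_separatesPoints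
    (Algebra.adjoin ℝ s) hsep
  have hspan : (Algebra.adjoin ℝ s : Set C(M × TimeCircle, ℝ)) ⊆ Y := by
    intro k hk
    have h1 : k ∈ Subalgebra.toSubmodule (Algebra.adjoin ℝ s) := hk
    rw [Algebra.adjoin_eq_span_of_subset ℝ (fun k hk => Submodule.subset_span (hclos k hk))] at h1
    exact Submodule.span_le.2 hsY h1
  have hall : ∀ k, inner ℝ W (τ k) = 0 := by
    intro k
    have h1 : k ∈ (Algebra.adjoin ℝ s).topologicalClosure := htop ▸ Algebra.mem_top
    exact closure_minimal hspan hYcl h1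
  have hdense : DenseRange τ := ContinuousMap.toLp_denseRange ℝ (prodMeasure μ) ℝ (by norm_num)
  refine hdense.induction_on (p := fun V => inner ℝ W V = 0) W ?_ hall |> inner_self_eq_zero.1
  exact isClosed_eq (by fun_prop) continuous_const

/-- The tensor products of eigenfunctions of `A` with the modes on the circle are total. -/
theorem eq_zero_of_orthogonal_modes {A : L2M μ →ₗ.[ℝ] L2M μ} (hA : IsSelfAdjoint A)
    (hc : HasCompactResolvent A) {W : L2MS μ}
    (hW : ∀ l, ∀ ζ ∈ eigenspace A l, ∀ k, inner ℝ (tensor μ ζ (circleMode k)) W = 0) : W = 0 := by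
  -- The factor on M is freed first, by totality of the eigenvectors of A, then the factor on the
  -- circle, by density of trigonometric polynomials.
  have h1 : ∀ (φ : L2M μ) (k : ℤ), inner ℝ (tensor μ φ (circleMode k)) W = 0 := by
    intro φ k
    let X : Submodule ℝ (L2M μ) := ((innerSL ℝ W).comp (tensorLeft μ (circleMode k))).ker
    have hXcl : IsClosed (X : Set (L2M μ)) := ContinuousLinearMap.isClosed_ker _
    have hmem : ∀ φ, φ ∈ X ↔ inner ℝ (tensor μ φ (circleMode k)) W = 0 := fun φ => by
      rw [real_inner_comm]
      rfl
    have : CompleteSpace X := hXcl.completeSpace_coe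
    have hX : X = ⊤ := by
      rw [← Submodule.orthogonal_eq_bot_iff, Submodule.eq_bot_iff]
      intro φ hφ
      refine eq_zero_of_orthogonal_eigenspaces hA hc fun l ζ hζ => ?_
      exact (Submodule.mem_orthogonal _ φ).1 hφ ζ ((hmem ζ).2 (hW l ζ hζ k))
    exact (hmem φ).1 (hX ▸ Submodule.mem_top)
  refine eq_zero_of_orthogonal_tensor μ fun φ e => ?_
  let Z : Submodule ℝ C(TimeCircle, ℝ) := LinearMap.ker (tensorFunctional μ φ W)
  have hZ : Z = ⊤ := by
    refine eq_top_of_circleMode_mem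
      (isClosed_singleton.preimage (continuous_tensorFunctional μ φ W)) fun k => ?_
    change tensorFunctional μ φ W (circleMode k) = 0
    rw [← h1 φ k, inner_tensor]
    rfl
  have h2 : e ∈ Z := hZ ▸ Submodule.mem_top
  rw [inner_tensor]
  exact h2

/-- The index set runs over all eigenvectors, zero and repetitions included, which avoids choosing a
basis. Totality also makes `waveGraph` single valued, so it is the graph of `waveOperator`. -/
theorem isDiagonal_waveOperator {A : L2M μ →ₗ.[ℝ] L2M μ} (hA : IsSelfAdjoint A)
    (hc : HasCompactResolvent A) :
    IsDiagonal (fun i : (Σ l : ℝ, eigenspace A l × ℤ) =>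
        tensor μ (i.2.1 : L2M μ) (circleMode i.2.2))
      (fun i => i.1 - (i.2.2 : ℝ) ^ 2) (waveOperator μ A) where
  total W hW := eq_zero_of_orthogonal_modes μ hA hc fun l ζ hζ k => hW ⟨l, ⟨ζ, hζ⟩, k⟩
  orthogonal := by
    rintro ⟨l, ζ, k⟩ ⟨l', ζ', k'⟩ hne
    simp only at hne ⊢
    rw [inner_tensor_tensor]
    by_cases h : l = l'
    · subst h
      rw [integral_circleMode_mul fun h => hne (by rw [h]), mul_zero]
    · rw [inner_eigenspace_eq_zero hA h ζ.2 ζ'.2, zero_mul]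
  mem_graph v w := by
    rw [waveOperator, Submodule.toLinearPMap_graph_eq]
    · constructor
      · rintro h ⟨l, ζ, k⟩
        exact h l ζ ζ.2 k
      · intro h l ζ hζ k
        exact h ⟨l, ⟨ζ, hζ⟩, k⟩
    · intro x hx hx0
      refine eq_zero_of_orthogonal_modes μ hA hc fun l ζ hζ k => ?_
      rw [hx l ζ hζ k, hx0, inner_zero_right, mul_zero]

end Tensor

/-! ### Localized test functions -/

theorem exists_continuousMap_of_periodic {k : ℝ → ℝ} (hk : Continuous k)
    (hper : Function.Periodic k (2 * Real.pi)) :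
    ∃ K : C(TimeCircle, ℝ), ∀ t : ℝ, K (t : TimeCircle) = k t := by
  have hc : Continuous (hper.lift : TimeCircle → ℝ) := by
    refine (QuotientAddGroup.isQuotientMap_mk _).continuous_iff.2 ?_
    convert! hk
  exact ⟨⟨hper.lift, hc⟩, fun t => hper.lift_coe t⟩

theorem periodic_deriv {k : ℝ → ℝ} {c : ℝ} (hper : Function.Periodic k c) :
    Function.Periodic (deriv k) c := by
  intro t
  rw [← deriv_comp_add_const]
  congr 1
  ext s
  exact hper s

/-- A nonzero twice differentiable function supported in a given open subset of the circle. -/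
theorem exists_bump_circle {I : Set TimeCircle} (hI : IsOpen I) (hne : I.Nonempty) :
    ∃ e e₂ : C(TimeCircle, ℝ), IsSecondDeriv e e₂ ∧ (∀ t ∉ I, e t = 0 ∧ e₂ t = 0) ∧
      ∃ t, e t ≠ 0 := by
  obtain ⟨t', ht'⟩ := hne
  obtain ⟨t₀, rfl⟩ := QuotientAddGroup.mk_surjective t'
  have hpre : IsOpen ((fun t : ℝ => (t : TimeCircle)) ⁻¹' I) :=
    hI.preimage (AddCircle.continuous_mk' _)
  obtain ⟨δ', hδ', hball⟩ := Metric.isOpen_iff.1 hpre t₀ ht'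
  set δ := min (δ' / 2) (Real.pi / 2) with hδdef
  have hδ : 0 < δ := lt_min (by linarith) (by have := Real.pi_pos; linarith)
  have hδπ : δ < Real.pi := lt_of_le_of_lt (min_le_right _ _) (by have := Real.pi_pos; linarith)
  have hin : ∀ t : ℝ, |t - t₀| ≤ δ → (t : TimeCircle) ∈ I := fun t ht =>
    hball (by
      rw [Metric.mem_ball, Real.dist_eq]
      exact lt_of_le_of_lt (ht.trans (min_le_left _ _)) (by linarith))
  -- Composing with the cosine makes the bump periodic; its argument is positive exactly within
  -- distance δ of t₀ modulo 2π.
  let k : ℝ → ℝ := fun t => expNegInvGlue (Real.cos (t - t₀) - Real.cos δ)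
  have hk : ContDiff ℝ 2 k := expNegInvGlue.contDiff.comp (by fun_prop)
  have hkd : ContDiff ℝ 1 (deriv k) := by
    have h2 : ContDiff ℝ (1 + 1) k := by simpa [one_add_one_eq_two] using hk
    exact (contDiff_succ_iff_deriv.1 h2).2.2
  have hkdd : Continuous (deriv (deriv k)) := hkd.continuous_deriv le_rfl
  have hper : Function.Periodic k (2 * Real.pi) := by
    intro t
    simp only [k]
    rw [add_sub_right_comm, Real.cos_add_two_pi]
  obtain ⟨e, he⟩ := exists_continuousMap_of_periodic hk.continuous hper
  obtain ⟨e₂, he₂⟩ := exists_continuousMap_of_periodic hkdd (periodic_deriv (periodic_deriv hper))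
  refine ⟨e, e₂, ⟨deriv k, fun t => ?_, fun t => ?_⟩, fun t ht => ?_, (t₀ : TimeCircle), ?_⟩
  · simp only [he]
    exact (hk.differentiable (by norm_num) t).hasDerivAt
  · rw [he₂]
    exact (hkd.differentiable (by norm_num) t).hasDerivAt
  · have hs : t ∈ (fun s : ℝ => (s : TimeCircle)) ''
        Set.Ico (t₀ - Real.pi) (t₀ - Real.pi + 2 * Real.pi) := by
      rw [AddCircle.coe_image_Ico_eq]
      exact Set.mem_univ t
    obtain ⟨s, hs, rfl⟩ := hs
    have h1 : δ < |s - t₀| := by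
      by_contra! hle
      exact ht (hin s hle)
    have h2 : |s - t₀| ≤ Real.pi := by
      rw [abs_le]
      constructor <;> linarith [hs.1, hs.2]
    have h3 : Real.cos (s - t₀) < Real.cos δ := by
      rw [← Real.cos_abs (s - t₀)]
      exact Real.cos_lt_cos_of_nonneg_of_le_pi hδ.le h2 h1
    have h4 : k =ᶠ[𝓝 s] fun _ => 0 := by
      have hc : Continuous fun t : ℝ => Real.cos (t - t₀) := by fun_prop
      filter_upwards [(hc.tendsto s).eventually (gt_mem_nhds h3)] with x hx
      exact expNegInvGlue.zero_of_nonpos (by linarith)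
    have h5 : deriv k =ᶠ[𝓝 s] fun _ => 0 := by
      simpa using h4.deriv
    refine ⟨?_, ?_⟩
    · rw [he]
      exact h4.self_of_nhds
    · rw [he₂]
      simpa using h5.deriv.self_of_nhds
  · have h6 : e (t₀ : TimeCircle) = k t₀ := he t₀
    rw [h6]
    refine (expNegInvGlue.pos_of_pos ?_).ne'
    rw [sub_self, Real.cos_zero, sub_pos, ← Real.cos_zero]
    exact Real.cos_lt_cos_of_nonneg_of_le_pi le_rfl hδπ.le hδ

section TestFunction

variable {M : Type*} [MetricSpace M] [MeasurableSpace M] [BorelSpace M] [CompactSpace M]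
variable (μ : Measure M) [IsFiniteMeasure μ]

/-- There are localized functions on which the wave operator is positive. -/
theorem exists_localized {A : L2M μ →ₗ.[ℝ] L2M μ} (hA : AssumptionA μ A)
    {U : Set (M × TimeCircle)} (hU : IsOpen U) (hne : U.Nonempty) :
    ∃ u w : L2MS μ, (u, w) ∈ (waveOperator μ A).graph ∧ 0 < inner ℝ u w ∧
      ∀ᵐ z ∂(prodMeasure μ), z ∉ U → w z = 0 := by
  obtain ⟨⟨x₀, t₀⟩, hz⟩ := hne
  obtain ⟨U₁, I, hU₁, hI, hx₀, ht₀, hsub⟩ := isOpen_prod_iff.1 hU x₀ t₀ hz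
  -- Locality of A applies on open sets only, so Aφ is controlled off closure V, which therefore has
  -- to lie inside U₁.
  obtain ⟨V, hV, hx₀V, hVU⟩ := (hU₁.mem_nhds hx₀ |> fun h => exists_mem_nhds_isClosed_subset h) |>
    fun ⟨t, h1, h2, h3⟩ => (⟨interior t, isOpen_interior, mem_interior_iff_mem_nhds.2 h1,
      (closure_minimal interior_subset h2).trans h3⟩ :
      ∃ V : Set M, IsOpen V ∧ x₀ ∈ V ∧ closure V ⊆ U₁)
  obtain ⟨e, e₂, hee, hsupp, t₁, ht₁⟩ := exists_bump_circle hI ⟨t₀, ht₀⟩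
  have hint : ∀ k : C(TimeCircle, ℝ), Integrable k := fun k =>
    k.continuous.integrable_of_hasCompactSupport (HasCompactSupport.of_compactSpace _)
  set c := ∫ t, e t * e t with hc
  set d := ∫ t, e t * e₂ t with hd
  have hcpos : 0 < c := by
    refine Continuous.integral_pos_of_hasCompactSupport_nonneg_nonzero (x := t₁) (by fun_prop)
      (HasCompactSupport.of_compactSpace _) (fun t => mul_self_nonneg _) ?_
    exact mul_ne_zero ht₁ ht₁
  -- The threshold −d/c makes ⟨u, Lu⟩ = c⟨Aφ, φ⟩ + d⟨φ, φ⟩ positive for u = φ ⊗ e.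
  obtain ⟨_, ⟨φ, hφ0, hφV, rfl⟩, hlt⟩ :=
    not_bddAbove_iff.1 (hA.unboundedAbove V hV ⟨x₀, hx₀V⟩) (-d / c)
  have hφpos : 0 < inner ℝ (φ : L2M μ) (φ : L2M μ) := by
    rw [real_inner_self_eq_norm_sq]
    have : ‖(φ : L2M μ)‖ ≠ 0 := norm_ne_zero_iff.2 fun h => hφ0 (Subtype.ext h)
    positivity
  have hφcl : ∀ᵐ x ∂μ, x ∉ closure V → (φ : L2M μ) x = 0 := by
    have := (ae_restrict_iff' hV.measurableSet.compl).1 hφV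
    filter_upwards [this] with x hx hxV
    exact hx fun h => hxV (subset_closure h)
  have hAφcl : ∀ᵐ x ∂μ, x ∉ closure V → A φ x = 0 := by
    have hopen : IsOpen (closure V)ᶜ := isClosed_closure.isOpen_compl
    rcases (closure V)ᶜ.eq_empty_or_nonempty with h | h
    · refine Eventually.of_forall fun x hx => ?_
      have : x ∈ (closure V)ᶜ := hx
      rw [h] at this
      exact this.elim
    · have h1 := hA.isLocal _ hopen h φ ((ae_restrict_iff' hopen.measurableSet).2 hφcl)
      exact (ae_restrict_iff' hopen.measurableSet).1 h1
  set u := tensor μ (φ : L2M μ) e with hu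
  set w := tensor μ (A φ) e + tensor μ (φ : L2M μ) e₂ with hw
  refine ⟨u, w, ?_, ?_, ?_⟩
  · rw [(isDiagonal_waveOperator μ hA.selfAdjoint hA.compactResolvent).mem_graph]
    rintro ⟨l, ⟨ζ, hζ⟩, k⟩
    simp only
    obtain ⟨hζ1, hζ2⟩ := (mem_eigenspace_iff A l ζ).1 hζ
    have h1 : inner ℝ ζ (A φ) = l * inner ℝ ζ (φ : L2M μ) := by
      have := inner_symm_of_isSelfAdjoint hA.selfAdjoint ⟨ζ, hζ1⟩ φ
      rw [hζ2, real_inner_smul_left] at this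
      exact this.symm
    have h2 : ∫ t, circleMode k t * e₂ t = -(k : ℝ) ^ 2 * ∫ t, circleMode k t * e t := by
      rw [← integral_mul_symm (isSecondDeriv_circleMode k) hee, ← integral_const_mul]
      refine integral_congr_ae (Eventually.of_forall fun t => ?_)
      simp only [ContinuousMap.smul_apply, smul_eq_mul]
      ring
    rw [hw, hu, inner_add_right, inner_tensor_tensor, inner_tensor_tensor, inner_tensor_tensor,
      h1, h2]
    ring
  · rw [hw, hu, inner_add_right, inner_tensor_tensor, inner_tensor_tensor, ← hc, ← hd,
      real_inner_comm]
    rw [div_lt_div_iff₀ hcpos hφpos] at hlt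
    linarith
  · have h1 : ∀ᵐ z ∂(prodMeasure μ), z.1 ∉ closure V → (φ : L2M μ) z.1 = 0 :=
      Measure.quasiMeasurePreserving_fst.ae hφcl
    have h2 : ∀ᵐ z ∂(prodMeasure μ), z.1 ∉ closure V → A φ z.1 = 0 :=
      Measure.quasiMeasurePreserving_fst.ae hAφcl
    filter_upwards [Lp.coeFn_add (tensor μ (A φ) e) (tensor μ (φ : L2M μ) e₂),
      coeFn_tensor μ (A φ) e, coeFn_tensor μ (φ : L2M μ) e₂, h1, h2] with z h3 h4 h5 h1 h2 hz
    rw [hw, h3, Pi.add_apply, h4, h5]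
    by_cases h6 : z.1 ∈ closure V
    · have h7 : z.2 ∉ I := fun h7 => hz (hsub ⟨hVU h6, h7⟩)
      rw [(hsupp _ h7).1, (hsupp _ h7).2]
      simp
    · rw [h1 h6, h2 h6]
      simp

end TestFunction

/-! ### The weighted measure and the form of the wave operator -/

section Weight

variable {Ω : Type*} [MeasurableSpace Ω] {m : Measure Ω} {q : Ω → ℝ}

/-- The measure `q dm`. -/
def weighted (m : Measure Ω) (q : Ω → ℝ) : Measure Ω := m.withDensity fun z => ENNReal.ofReal (q z)

theorem weighted_le (hq : MemLp q ⊤ m) : ∃ c : NNReal, weighted m q ≤ c • m := by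
  have hfin : eLpNorm q ⊤ m ≠ ∞ := hq.2.ne
  refine ⟨(eLpNorm q ⊤ m).toNNReal, ?_⟩
  have h1 : weighted m q ≤ m.withDensity fun _ => eLpNorm q ⊤ m := by
    refine withDensity_mono ?_
    filter_upwards [ae_le_eLpNormEssSup (f := q) (μ := m)] with z hz
    rw [eLpNorm_exponent_top]
    refine le_trans ?_ hz
    rw [Real.enorm_eq_ofReal_abs]
    exact ENNReal.ofReal_le_ofReal (le_abs_self _)
  rw [withDensity_const] at h1
  refine h1.trans_eq ?_
  rw [← ENNReal.coe_toNNReal hfin]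
  rfl

theorem integral_weighted (hq : MemLp q ⊤ m) (hq0 : ∀ᵐ z ∂m, 0 ≤ q z) (g : Ω → ℝ) :
    ∫ z, g z ∂(weighted m q) = ∫ z, q z * g z ∂m := by
  rw [weighted, integral_withDensity_eq_integral_toReal_smul₀ hq.1.aemeasurable.ennreal_ofReal
    (Eventually.of_forall fun _ => ENNReal.ofReal_lt_top)]
  refine integral_congr_ae ?_
  filter_upwards [hq0] with z hz
  rw [ENNReal.toReal_ofReal hz, smul_eq_mul]

theorem integrable_weighted_iff (hq : MemLp q ⊤ m) (hq0 : ∀ᵐ z ∂m, 0 ≤ q z) {g : Ω → ℝ} :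
    Integrable g (weighted m q) ↔ Integrable (fun z => q z * g z) m := by
  rw [weighted, integrable_withDensity_iff_integrable_smul₀' hq.1.aemeasurable.ennreal_ofReal
    (Eventually.of_forall fun _ => ENNReal.ofReal_lt_top)]
  refine integrable_congr ?_
  filter_upwards [hq0] with z hz
  rw [ENNReal.toReal_ofReal hz, smul_eq_mul]

theorem memLp_weighted_iff (hq : MemLp q ⊤ m) (hq0 : ∀ᵐ z ∂m, 0 ≤ q z) {p : ℝ} (hp : 0 < p)
    {g : Ω → ℝ} (hg : AEStronglyMeasurable g m) :
    MemLp g (ENNReal.ofReal p) (weighted m q)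
      ↔ ∫⁻ z, ENNReal.ofReal (q z * |g z| ^ p) ∂m < ∞ := by
  have hac : weighted m q ≪ m := withDensity_absolutelyContinuous _ _
  have h1 : ∫⁻ z, ‖g z‖ₑ ^ p ∂(weighted m q) = ∫⁻ z, ENNReal.ofReal (q z * |g z| ^ p) ∂m := by
    rw [weighted, lintegral_withDensity_eq_lintegral_mul₀ hq.1.aemeasurable.ennreal_ofReal
      (hg.enorm.pow_const p)]
    refine lintegral_congr_ae ?_
    filter_upwards [hq0] with z hz
    rw [Pi.mul_apply, ENNReal.ofReal_mul hz, ← ENNReal.ofReal_rpow_of_nonneg (abs_nonneg _) hp.le,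
      Real.enorm_eq_ofReal_abs]
  have h2 := eLpNorm_lt_top_iff_lintegral_rpow_enorm_lt_top (f := g) (μ := weighted m q)
    (p := ENNReal.ofReal p) (by simpa using hp) ENNReal.ofReal_ne_top
  rw [ENNReal.toReal_ofReal hp.le, h1] at h2
  exact ⟨fun h => h2.1 h.2, fun h => ⟨hg.mono_ac hac, h2.2 h⟩⟩

theorem ae_of_ae_weighted (hq : MemLp q ⊤ m) {P : Ω → Prop} (h : ∀ᵐ z ∂(weighted m q), P z) :
    ∀ᵐ z ∂m, 0 < q z → P z := by
  rw [weighted, ae_withDensity_iff' hq.1.aemeasurable.ennreal_ofReal] at h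
  filter_upwards [h] with z hz hpos
  exact hz (by simpa using hpos)

theorem isFiniteMeasure_weighted [IsFiniteMeasure m] (hq : MemLp q ⊤ m) :
    IsFiniteMeasure (weighted m q) := by
  obtain ⟨c, hc⟩ := weighted_le hq
  exact isFiniteMeasure_of_le _ hc

end Weight

section Form

variable {M : Type*} [MetricSpace M] [CompactSpace M] [MeasurableSpace M] [BorelSpace M]
  (μ : Measure M) [IsFiniteMeasure μ] {A : L2M μ →ₗ.[ℝ] L2M μ} {p : ℝ}
  {q : M × TimeCircle → ℝ}

/-- The indefinite form of the wave operator. -/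
def waveForm (hA : AssumptionA μ A) (hq : MemLp q ⊤ (prodMeasure μ))
    (hq0 : ∀ᵐ z ∂(prodMeasure μ), 0 ≤ q z) (hCE : CompactEmbedding μ A p)
    (hCC : ControlCondition μ A q) :
    IndefiniteForm (prodMeasure μ) (weighted (prodMeasure μ) q) p :=
  have h := isDiagonal_waveOperator μ hA.selfAdjoint hA.compactResolvent
  have hmem : ∀ B u, spectralProj (waveOperator μ A) B u ∈ spectralSubspace (waveOperator μ A) B :=
    fun B u => h.spectralProj_eq_self_iff.1 (by rw [h.spectralProj_spectralProj, Set.inter_self])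
  { posProj := Ppos μ A
    negProj := Pneg μ A
    kerProj := Pzero μ A
    posForm := normSqPos μ A
    negForm := normSqNeg μ A
    posInner := innerPos μ A
    negInner := innerNeg μ A
    sum_proj := h.sum_spectralProj
    pos_neg := h.spectralProj_disjoint (by ext x; simp; intro; linarith)
    pos_ker := h.spectralProj_disjoint (by simp)
    neg_pos := h.spectralProj_disjoint (by ext x; simp; intro; linarith)
    neg_ker := h.spectralProj_disjoint (by simp)
    ker_pos := h.spectralProj_disjoint (by simp)
    ker_neg := h.spectralProj_disjoint (by simp)
    posQuad := isQuadForm_formNormSq _ _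
    negQuad := isQuadForm_formNormSq _ _
    posForm_proj := h.formNormSq_spectralProj _
    negForm_proj := h.formNormSq_spectralProj _
    memLp_pos := fun u hu => hCE.1.1 _ ⟨hmem _ u, by
      rw [Ppos, h.formNormSq_spectralProj]; exact hu⟩
    memLp_neg := fun u hu => hCE.2.1 _ ⟨hmem _ u, by
      rw [Pneg, h.formNormSq_spectralProj]; exact hu⟩
    pos_compact := fun u C hu => hCE.1.2 (fun n => Ppos μ A (u n)) C fun n => by
      have e : normSqPos μ A (Ppos μ A (u n)) = normSqPos μ A (u n) :=
        h.formNormSq_spectralProj _ _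
      exact ⟨⟨hmem _ _, (e.trans_le (hu n)).trans_lt ENNReal.ofReal_lt_top⟩, e.trans_le (hu n)⟩
    neg_compact := fun u C hu => hCE.2.2 (fun n => Pneg μ A (u n)) C fun n => by
      have e : normSqNeg μ A (Pneg μ A (u n)) = normSqNeg μ A (u n) :=
        h.formNormSq_spectralProj _ _
      exact ⟨⟨hmem _ _, (e.trans_le (hu n)).trans_lt ENNReal.ofReal_lt_top⟩, e.trans_le (hu n)⟩
    le_smul := weighted_le hq
    control := by
      obtain ⟨C, hC, hc⟩ := hCC
      refine ⟨C, hC, fun u hu => ?_⟩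
      have h1 := hc u (h.mem_eigenspace.2 fun i hi =>
        h.mem_spectralSubspace.1 (h.spectralProj_eq_self_iff.1 hu) i hi)
      simp only [sq_abs] at h1
      rw [integral_weighted hq hq0, ← real_inner_self_eq_norm_sq, L2.inner_def]
      refine le_trans (le_of_eq ?_) h1
      refine integral_congr_ae (Eventually.of_forall fun z => ?_)
      simp [sq] }

variable (hA : AssumptionA μ A) (hq : MemLp q ⊤ (prodMeasure μ))
  (hq0 : ∀ᵐ z ∂(prodMeasure μ), 0 ≤ q z) (hCE : CompactEmbedding μ A p)
  (hCC : ControlCondition μ A q) [IsFiniteMeasure (weighted (prodMeasure μ) q)]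

/-- `E` asks for weighted p-integrability of the kernel part only, `space` for that of u. The
positive and negative parts lie in L^p(m) by the embedding, hence in L^p(ν), so the conditions
agree. -/
theorem mem_E_iff (hp : 2 < p) {u : L2MS μ} :
    u ∈ E μ A p q ↔ u ∈ (waveForm μ hA hq hq0 hCE hCC).space := by
  have h := isDiagonal_waveOperator μ hA.selfAdjoint hA.compactResolvent
  set S := waveForm μ hA hq hq0 hCE hCC with hS
  have hp1 : 0 < p := by linarith
  have hmem : ∀ B u, spectralProj (waveOperator μ A) B u ∈ spectralSubspace (waveOperator μ A) B :=
    fun B u => h.spectralProj_eq_self_iff.1 (by rw [h.spectralProj_spectralProj, Set.inter_self])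
  have hker : Pzero μ A u ∈ eigenspace (waveOperator μ A) 0 :=
    h.mem_eigenspace.2 fun i hi => h.mem_spectralSubspace.1 (hmem {0} u) i hi
  have hzero : MemLp (Pzero μ A u) (ENNReal.ofReal p) (weighted (prodMeasure μ) q)
      ↔ ∫⁻ z, ENNReal.ofReal (q z * |Pzero μ A u z| ^ p) ∂(prodMeasure μ) < ∞ :=
    memLp_weighted_iff hq hq0 hp1 (Lp.aestronglyMeasurable _)
  constructor
  · rintro ⟨⟨-, h1⟩, ⟨-, h2⟩, -, h3⟩
    have h1' : S.posForm u < ∞ := by rw [← S.posForm_proj]; exact h1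
    have h2' : S.negForm u < ∞ := by rw [← S.negForm_proj]; exact h2
    have h3' : S.kerProj u ∈ S.space := by
      refine ⟨?_, ?_, hzero.2 h3⟩
      · rw [S.posForm_eq_zero (S.pos_ker u)]; exact ENNReal.zero_lt_top
      · rw [S.negForm_eq_zero (S.neg_ker u)]; exact ENNReal.zero_lt_top
    rw [← S.sum_proj u]
    exact S.space.add_mem (S.space.add_mem (S.posProj_mem h1') (S.negProj_mem h2')) h3'
  · intro hu
    refine ⟨⟨hmem _ u, ?_⟩, ⟨hmem _ u, ?_⟩, hker, hzero.1 (S.kerProj_mem hu).2.2⟩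
    · exact (S.posForm_proj u).trans_lt hu.1
    · exact (S.negForm_proj u).trans_lt hu.2.1

/-- The integrability clause is automatic by the growth of f, and the forms see only the
projections. -/
theorem isWeakSolution_iff (hp : 2 < p) {f : ℝ → ℝ} (hf : Continuous f)
    (hMC : MonotonicityCondition p f) {u : L2MS μ} :
    IsWeakSolution μ A p q f u ↔ (waveForm μ hA hq hq0 hCE hCC).IsWeak f u := by
  set S := waveForm μ hA hq hq0 hCE hCC with hS
  have hE : ∀ {u : L2MS μ}, u ∈ E μ A p q ↔ u ∈ S.space := mem_E_iff μ hA hq hq0 hCE hCC hp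
  have hint : ∀ v : L2MS μ, ∫ z, f (u z) * v z ∂(weighted (prodMeasure μ) q)
      = ∫ z, q z * f (u z) * v z ∂(prodMeasure μ) := fun v => by
    rw [integral_weighted hq hq0]; simp only [mul_assoc]
  have hform : ∀ v, u ∈ S.space → v ∈ S.space →
      innerPos μ A (Ppos μ A u) (Ppos μ A v) - innerNeg μ A (Pneg μ A u) (Pneg μ A v)
        = S.posInner u v - S.negInner u v := fun v hu hv => by
    rw [S.posInner_congr hu.1 hv.1 (S.pos_pos u).symm (S.pos_pos v).symm,
      S.negInner_congr hu.2.1 hv.2.1 (S.neg_neg u).symm (S.neg_neg v).symm]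
    rfl
  rw [IsWeakSolution, IndefiniteForm.IsWeak, hE]
  refine and_congr_right fun hu => forall_congr' fun v => ?_
  rw [hE]
  refine forall_congr' fun hv => ?_
  rw [hform v hu hv, hint]
  refine and_iff_right ?_
  have := (integrable_weighted_iff hq hq0).1
    (IndefiniteForm.integrable_mul hp hf hMC hu.2.2 hv.2.2)
  simpa only [mul_assoc] using this

theorem energy_eq_phi (f : ℝ → ℝ) (u : L2MS μ) :
    energy μ A q f u = (waveForm μ hA hq hq0 hCE hCC).phi f u := by
  set S := waveForm μ hA hq hq0 hCE hCC with hS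
  have h1 : energy μ A q f u = S.np (S.posProj u) / 2 - S.nm (S.negProj u) / 2
      - ∫ z, q z * primitive f (u z) ∂(prodMeasure μ) := rfl
  rw [h1, ← integral_weighted hq hq0, S.np_proj, S.nm_proj, IndefiniteForm.phi,
    IndefiniteForm.cost, IndefiniteForm.pot]
  ring

/-- There is a positive direction above which no function of small negative energy vanishes on the
support of the weight. -/
theorem exists_direction {U : Set (M × TimeCircle)} (hU : IsOpen U) (hne : U.Nonempty)
    (hqU : ∀ᵐ z ∂((prodMeasure μ).restrict U), 0 < q z) :
    ∃ w₀ ∈ (waveForm μ hA hq hq0 hCE hCC).posSpace,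
      0 < (waveForm μ hA hq hq0 hCE hCC).np w₀ ∧
      ∀ z ∈ (waveForm μ hA hq hq0 hCE hCC).space,
        (waveForm μ hA hq hq0 hCE hCC).posProj z = w₀ →
        (waveForm μ hA hq hq0 hCE hCC).nm z ≤ (waveForm μ hA hq hq0 hCE hCC).np w₀ →
        ¬ z =ᵐ[weighted (prodMeasure μ) q] 0 := by
  have h := isDiagonal_waveOperator μ hA.selfAdjoint hA.compactResolvent
  set S := waveForm μ hA hq hq0 hCE hCC with hS
  obtain ⟨u, w, huw, hpos, hw⟩ := exists_localized μ hA hU hne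
  have hinner : ∀ y, inner ℝ y w = S.posInner y u - S.negInner y u :=
    h.inner_eq_formInner_sub huw
  have hup : S.posForm u < ∞ := h.formNormSq_lt_top_of_mem_graph huw _
  have hun : S.negForm u < ∞ := h.formNormSq_lt_top_of_mem_graph huw _
  have h0 : 0 < S.np u - S.nm u := by
    rw [hinner, S.posQuad.inner_self hup, S.negQuad.inner_self hun] at hpos
    exact hpos
  have hnm := S.nm_nonneg u
  refine ⟨S.posProj u, S.posProj_mem_posSpace hup, by rw [S.np_proj]; linarith, ?_⟩
  intro z hz hproj hle hz0
  rw [S.np_proj] at hle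
  -- On U the weight is positive, so z = 0 there; off U the function w = Lu vanishes.
  have hzw : inner ℝ z w = 0 := by
    rw [L2.inner_def]
    refine integral_eq_zero_of_ae ?_
    rw [ae_restrict_iff' hU.measurableSet] at hqU
    filter_upwards [ae_of_ae_weighted hq hz0, hqU, hw] with x h1 h2 h3
    by_cases hx : x ∈ U
    · simp [h1 (h2 hx)]
    · simp [h3 hx]
  have h1 : S.posInner z u = S.np u := by
    rw [S.posInner_congr hz.1 hup hproj rfl, S.posQuad.inner_self hup]
    rfl
  rw [hinner, h1] at hzw
  -- Orthogonality gives ⟨z⁻, u⁻⟩₋ = ‖u⁺‖₊², hence ‖u⁺‖₊⁴ ≤ ‖u⁺‖₊²‖u⁻‖₋², against ‖u⁺‖₊ > ‖u⁻‖₋.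
  have h2 : S.negInner z u ^ 2 ≤ S.nm z * S.nm u := S.negQuad.sq_inner_le hz.2.1 hun
  have h3 : S.negInner z u = S.np u := by linarith
  rw [h3] at h2
  nlinarith [mul_le_mul_of_nonneg_right hle hnm]

end Form

end NonlinearWave

end

/-! ### Conclusion for the generalized wave equation. -/

theorem mainTheorem2 {M : Type*} [MetricSpace M] [CompactSpace M] [MeasurableSpace M]
    [BorelSpace M] (μ : MeasureTheory.Measure M) [MeasureTheory.IsFiniteMeasure μ]
    (A : NonlinearWave.L2M μ →ₗ.[ℝ] NonlinearWave.L2M μ)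
    (hA : NonlinearWave.AssumptionA μ A)
    (p : ℝ) (hp : 2 < p)
    (f : ℝ → ℝ) (hf : Continuous f) (hMC : NonlinearWave.MonotonicityCondition p f)
    (q : M × NonlinearWave.TimeCircle → ℝ)
    (hq : MeasureTheory.MemLp q ⊤ (NonlinearWave.prodMeasure μ))
    (hq_nonneg : ∀ᵐ z ∂(NonlinearWave.prodMeasure μ), 0 ≤ q z)
    (hq_pos : ∃ U : Set (M × NonlinearWave.TimeCircle), IsOpen U ∧ U.Nonempty ∧
      ∀ᵐ z ∂((NonlinearWave.prodMeasure μ).restrict U), 0 < q z)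
    (hCE : NonlinearWave.CompactEmbedding μ A p)
    (hCC : NonlinearWave.ControlCondition μ A q) :
    ∃ u : NonlinearWave.L2MS μ, NonlinearWave.IsGroundState μ A p q f u := by
  have := NonlinearWave.isFiniteMeasure_weighted hq
  obtain ⟨U, hU, hne, hqU⟩ := hq_pos
  obtain ⟨w₀, hw₀, hnp, hnull⟩ :=
    NonlinearWave.exists_direction μ hA hq hq_nonneg hCE hCC hU hne hqU
  obtain ⟨u, hu, hu0, hmin⟩ := NonlinearWave.IndefiniteForm.exists_groundState
    (NonlinearWave.waveForm μ hA hq hq_nonneg hCE hCC) hp hf hMC hw₀ hnp hnull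
  have hweak := fun v : NonlinearWave.L2MS μ =>
    NonlinearWave.isWeakSolution_iff μ hA hq hq_nonneg hCE hCC hp hf hMC (u := v)
  refine ⟨u, (hweak u).2 hu, hu0, fun v hv hv0 => ?_⟩
  rw [NonlinearWave.energy_eq_phi μ hA hq hq_nonneg hCE hCC,
    NonlinearWave.energy_eq_phi μ hA hq hq_nonneg hCE hCC]
  exact hmin v ((hweak v).1 hv) hv0
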